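/- Let $I_1=(-1,1)$. For a test function $\varphi\in C_c^\infty(\mathbb R)$ let $\mathbf H\varphi(x)=\frac1\pi\,\mathrm{pv}\!\int_{\mathbb R}\frac{\varphi(t)}{x-t}\,dt$ be its Hilbert transform, and for a bounded smooth $\varphi$ that is compactly supported or $2$-periodic let $\tilde{\mathbf H}\varphi(x)=\frac1\pi\,\mathrm{pv}\!\int_{\mathbb R}\varphi(t)\big\{\frac1{x-t}+\frac{t}{1+t^2}\big\}dt$ be its modified Hilbert transform. Let $L^1_0(\mathbb R)$ be the space of (complex-valued) $g\in L^1(\mathbb R)$ with $\int_{\mathbb R} g=0$. For $f\in L^1(\mathbb R)$ and $g\in L^1_0(\mathbb R)$ let $f+\mathbf Hg$ be the distribution on $\mathbb R$ given by $\langle\varphi,f+\mathbf Hg\rangle=\int\varphi f-\int(\mathbf H\varphi)\,g$, and let $\mathfrak L_0(\mathbb R)=L^1(\mathbb R)+\mathbf H L^1_0(\mathbb R)$ be the space of all these distributions. Let $\mathfrak L(I_1)$ be the space of the restrictions to $I_1$ of the elements of $\mathfrak L_0(\mathbb R)$, with the quotient norm $$\|u\|_{\mathfrak L(I_1)}=\inf\big\{\|f\|_{L^1(\mathbb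 R)}+\|g\|_{L^1(\mathbb R)}:\ f\in L^1(\mathbb R),\ g\in L^1_0(\mathbb R),\ u=(f+\mathbf Hg)|_{I_1}\big\}.$$ Fix $0<\beta\le1$. Put $\mathbf J_\beta f(x)=\frac{\beta}{x^2}f(-\frac{\beta}{x})$ for $f\in L^1(\mathbb R)$ and $\mathbf J_\beta(f+\mathbf Hg)=\mathbf J_\beta f+\mathbf H\mathbf J_\beta g$ on $\mathfrak L_0(\mathbb R)$. For $V=f+\mathbf Hg\in\mathfrak L_0(\mathbb R)$ let $\mathbf\Sigma_2V=\sum_{j\ne0}V(\cdot+2j)$ be the distribution defined by $\langle\varphi,\mathbf\Sigma_2V\rangle=\langle\mathbf\Pi_2\varphi,V\rangle-\langle\varphi,V\rangle$, where $\mathbf\Pi_2\varphi(x)=\sum_{j\in\mathbb Z}\varphi(x+2j)$ and $\langle\psi,V\rangle=\int\psi f-\int(\tilde{\mathbf H}\psi)\,g$ for $\psi=\varphi$ and $\psi=\mathbf\Pi_2\varphi$. Then there is a well-defined linear operator (the subtransfer operator) $\mathbf T_\beta$ on $\mathfrak L(I_1)$ with $$\mathbf T_\beta(U|_{I_1})=(\mathbf\Sigma_2\mathbf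 J_\beta U)|_{I_1},\qquad U\in\mathfrak L_0(\mathbb R);$$ it extends the subtransfer operator $$\mathbf T_\beta f(x)=\sum_{j\in\mathbb Z\setminus\{0\}}\frac{\beta}{(2j+x)^2}\,f\Big(-\frac{\beta}{2j+x}\Big),\qquad x\in I_1,\quad f\in L^1(I_1),$$ it is bounded on $\mathfrak L(I_1)$, and its operator norm is strictly greater than $1$. -/

import Mathlib

open MeasureTheory TopologicalSpace Filter
open scoped Distributions Topology

noncomputable section

namespace GaussType

/-- The Hilbert transform of a test function,
`Hφ(x) = (1/2π) ∫ (φ(x-t) - φ(x+t)) / t dt`, which is the symmetrized (absolutely convergent)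
form of `(1/π) pv ∫ φ(t) / (x-t) dt`. -/
def hilbert (φ : ℝ → ℝ) (x : ℝ) : ℝ :=
  (1 / (2 * Real.pi)) * ∫ t : ℝ, (φ (x - t) - φ (x + t)) / t

/-- The modified Hilbert transform of a bounded function,
`H̃φ(x) = (1/π) pv ∫ φ(t) {1/(x-t) + t/(1+t²)} dt`. -/
def modHilbert (φ : ℝ → ℝ) (x : ℝ) : ℝ :=
  limUnder (𝓝[>] (0 : ℝ)) fun ε : ℝ =>
    (1 / Real.pi) * ∫ t in {t : ℝ | ε < |x - t|}, φ t * (1 / (x - t) + t / (1 + t ^ 2))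

/-- `L¹(ℝ)`, complex-valued. -/
abbrev L1 : Type := Lp ℂ 1 (volume : Measure ℝ)

/-- `L¹₀(ℝ)`: the functions in `L¹(ℝ)` whose integral vanishes. -/
def L10 : Submodule ℂ L1 where
  carrier := {g | ∫ x, g x = 0}
  zero_mem' := by
    change ∫ x, (0 : L1) x = 0
    rw [integral_congr_ae (Lp.coeFn_zero ℂ 1 volume)]
    simp
  add_mem' := by
    intro a b ha hb
    change ∫ x, (a + b) x = 0
    rw [integral_congr_ae (Lp.coeFn_add a b)]
    simp only [Pi.add_apply]
    rw [integral_add (L1.integrable_coeFn a) (L1.integrable_coeFn b), ha, hb, add_zero]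
  smul_mem' := by
    intro c a ha
    change ∫ x, (c • a) x = 0
    rw [integral_congr_ae (Lp.coeFn_smul c a)]
    simp only [Pi.smul_apply]
    rw [integral_smul, ha, smul_zero]

/-! ### Elementary estimates for the Hilbert transform of a test function -/

lemma hilbert_integrand_bound {φ : ℝ → ℝ} {D : ℝ} (hφ : Differentiable ℝ φ)
    (hD : ∀ x, ‖deriv φ x‖ ≤ D) (x t : ℝ) : ‖(φ (x - t) - φ (x + t)) / t‖ ≤ 2 * D := by
  have hD0 : 0 ≤ D := (norm_nonneg _).trans (hD 0)
  rcases eq_or_ne t 0 with rfl | ht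
  · simpa using hD0
  rw [norm_div, div_le_iff₀ (norm_pos_iff.mpr ht)]
  have h := convex_univ.norm_image_sub_le_of_norm_deriv_le (𝕜 := ℝ) (f := φ) (C := D)
    (fun y _ => hφ y) (fun y _ => hD y) (Set.mem_univ (x + t)) (Set.mem_univ (x - t))
  refine h.trans (le_of_eq ?_)
  have : x - t - (x + t) = -(2 * t) := by ring
  rw [this, norm_neg, norm_mul, Real.norm_ofNat]
  ring

lemma hilbert_integrand_measurable {φ : ℝ → ℝ} (hφ : Continuous φ) :
    StronglyMeasurable (Function.uncurry fun x t : ℝ => (φ (x - t) - φ (x + t)) / t) := by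
  apply Measurable.stronglyMeasurable
  have := hφ.measurable
  unfold Function.uncurry
  fun_prop

/-- The set off which `t ↦ (φ(x-t) - φ(x+t)) / t` vanishes when `φ` is supported in `K`. -/
def hilbertSet (K : Set ℝ) (x : ℝ) : Set ℝ := (fun t => x - t) ⁻¹' K ∪ (fun t => x + t) ⁻¹' K

lemma volume_hilbertSet_le (K : Set ℝ) (x : ℝ) :
    volume (hilbertSet K x) ≤ volume K + volume K := by
  refine (measure_union_le _ _).trans (le_of_eq ?_)
  congr 1
  · exact (volume.measurePreserving_sub_left x).measure_preimage_equiv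
      (f := MeasurableEquiv.subLeft x) K
  · exact measure_preimage_add volume x K

lemma hilbert_integrand_zero {φ : ℝ → ℝ} {K : Set ℝ} (hK : ∀ x ∉ K, φ x = 0) (x t : ℝ)
    (ht : t ∉ hilbertSet K x) : (φ (x - t) - φ (x + t)) / t = 0 := by
  have h : ¬ (x - t ∈ K ∨ x + t ∈ K) := ht
  rw [not_or] at h
  rw [hK _ h.1, hK _ h.2, sub_zero, zero_div]

lemma measurableSet_hilbertSet {K : Set ℝ} (hK : IsCompact K) (x : ℝ) :
    MeasurableSet (hilbertSet K x) := by
  have := hK.measurableSet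
  refine MeasurableSet.union ?_ ?_
  · exact (measurable_const.sub measurable_id) this
  · exact (measurable_const.add measurable_id) this

lemma volume_hilbertSet_lt_top {K : Set ℝ} (hK : IsCompact K) (x : ℝ) :
    volume (hilbertSet K x) < ⊤ :=
  (volume_hilbertSet_le K x).trans_lt (ENNReal.add_lt_top.2 ⟨hK.measure_lt_top, hK.measure_lt_top⟩)

lemma hilbert_integrand_integrable {φ : ℝ → ℝ} {K : Set ℝ} {D : ℝ} (hK : IsCompact K)
    (hφ : Differentiable ℝ φ) (hφK : ∀ x ∉ K, φ x = 0) (hD : ∀ x, ‖deriv φ x‖ ≤ D) (x : ℝ) :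
    Integrable fun t : ℝ => (φ (x - t) - φ (x + t)) / t := by
  have hm : StronglyMeasurable fun t : ℝ => (φ (x - t) - φ (x + t)) / t :=
    (hilbert_integrand_measurable hφ.continuous).comp_measurable
      (measurable_const.prodMk measurable_id)
  have hon : IntegrableOn (fun t : ℝ => (φ (x - t) - φ (x + t)) / t) (hilbertSet K x) :=
    Measure.integrableOn_of_bounded (volume_hilbertSet_lt_top hK x).ne hm.aestronglyMeasurable
      (Eventually.of_forall fun t => hilbert_integrand_bound hφ hD x t)
  exact hon.integrable_of_forall_notMem_eq_zero
    fun t ht => hilbert_integrand_zero hφK x t ht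

lemma hilbert_bound {φ : ℝ → ℝ} {K : Set ℝ} {D : ℝ} (hK : IsCompact K)
    (hφ : Differentiable ℝ φ) (hφK : ∀ x ∉ K, φ x = 0) (hD : ∀ x, ‖deriv φ x‖ ≤ D) (x : ℝ) :
    ‖hilbert φ x‖ ≤ 4 * volume.real K * D := by
  have hD0 : 0 ≤ D := (norm_nonneg _).trans (hD 0)
  have hpi : 1 / (2 * Real.pi) ≤ 1 := by
    rw [div_le_one (by positivity)]
    linarith [Real.pi_gt_three]
  have hvol : volume.real (hilbertSet K x) ≤ 2 * volume.real K := by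
    have := ENNReal.toReal_mono (ENNReal.add_lt_top.2 ⟨hK.measure_lt_top, hK.measure_lt_top⟩).ne
      (volume_hilbertSet_le K x)
    rw [ENNReal.toReal_add hK.measure_lt_top.ne hK.measure_lt_top.ne] at this
    simpa [Measure.real, two_mul] using this
  have hint : ‖∫ t : ℝ, (φ (x - t) - φ (x + t)) / t‖ ≤ 2 * D * volume.real (hilbertSet K x) := by
    rw [← setIntegral_eq_integral_of_forall_compl_eq_zero
      (fun t ht => hilbert_integrand_zero hφK x t ht)]
    exact norm_setIntegral_le_of_norm_le_const (volume_hilbertSet_lt_top hK x)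
      fun t _ => hilbert_integrand_bound hφ hD x t
  unfold hilbert
  rw [norm_mul, Real.norm_of_nonneg (by positivity : (0 : ℝ) ≤ 1 / (2 * Real.pi))]
  calc 1 / (2 * Real.pi) * ‖∫ t : ℝ, (φ (x - t) - φ (x + t)) / t‖
      ≤ 1 * (2 * D * (2 * volume.real K)) := by gcongr; exact hint.trans (by gcongr)
    _ = 4 * volume.real K * D := by ring

lemma hilbert_measurable {φ : ℝ → ℝ} (hφ : Continuous φ) : StronglyMeasurable (hilbert φ) := by
  unfold hilbert
  exact (hilbert_integrand_measurable hφ).integral_prod_right.const_mul _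

section TestFunctions

variable {Ω : Opens ℝ}

lemma test_differentiable (φ : 𝓓(Ω, ℝ)) : Differentiable ℝ φ :=
  φ.contDiff.differentiable (by simp)

lemma test_zero (φ : 𝓓(Ω, ℝ)) : ∀ x ∉ tsupport φ, φ x = 0 :=
  fun _ hx => image_eq_zero_of_notMem_tsupport hx

lemma test_deriv_bound (φ : 𝓓(Ω, ℝ)) : ∃ D, ∀ x, ‖deriv φ x‖ ≤ D :=
  (φ.hasCompactSupport.deriv).exists_bound_of_continuous
    (φ.contDiff.continuous_deriv (by simp))

lemma test_bound (φ : 𝓓(Ω, ℝ)) : ∃ C, ∀ x, ‖φ x‖ ≤ C :=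
  φ.hasCompactSupport.exists_bound_of_continuous φ.continuous

lemma hilbert_test_bound (φ : 𝓓(Ω, ℝ)) : ∃ C, ∀ x, ‖hilbert φ x‖ ≤ C := by
  obtain ⟨D, hD⟩ := test_deriv_bound φ
  exact ⟨_, hilbert_bound φ.hasCompactSupport (test_differentiable φ) (test_zero φ) hD⟩

lemma hilbert_test_integrable (φ : 𝓓(Ω, ℝ)) (x : ℝ) :
    Integrable fun t : ℝ => (φ (x - t) - φ (x + t)) / t := by
  obtain ⟨D, hD⟩ := test_deriv_bound φ
  exact hilbert_integrand_integrable φ.hasCompactSupport (test_differentiable φ) (test_zero φ) hD x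

lemma hilbert_test_add (φ ψ : 𝓓(Ω, ℝ)) (x : ℝ) :
    hilbert (φ + ψ : 𝓓(Ω, ℝ)) x = hilbert φ x + hilbert ψ x := by
  unfold hilbert
  rw [← mul_add, ← integral_add (hilbert_test_integrable φ x) (hilbert_test_integrable ψ x)]
  congr 2
  ext t
  simp only [add_apply]
  ring

lemma hilbert_test_smul (c : ℝ) (φ : 𝓓(Ω, ℝ)) (x : ℝ) :
    hilbert (c • φ : 𝓓(Ω, ℝ)) x = c * hilbert φ x := by
  unfold hilbert
  have h : (fun t : ℝ => ((c • φ : 𝓓(Ω, ℝ)) (x - t) - (c • φ : 𝓓(Ω, ℝ)) (x + t)) / t) =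
      fun t => c * ((φ (x - t) - φ (x + t)) / t) := by
    ext t
    simp only [smul_apply, smul_eq_mul]
    ring
  rw [h, integral_const_mul]
  ring

/-- `φ · f` is integrable for `φ` a bounded measurable function. -/
lemma integrable_mul_L1 {φ : ℝ → ℝ} (hφ : StronglyMeasurable φ) (hb : ∃ C, ∀ x, ‖φ x‖ ≤ C)
    (f : L1) : Integrable fun x => (φ x : ℂ) * f x := by
  obtain ⟨C, hC⟩ := hb
  refine (L1.integrable_coeFn f).bdd_mul (c := C)
    (Complex.continuous_ofReal.comp_stronglyMeasurable hφ).aestronglyMeasurable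
    (Eventually.of_forall fun x => ?_)
  simpa using hC x

lemma norm_integral_mul_L1_le {φ : ℝ → ℝ} {C : ℝ} (hC : ∀ x, ‖φ x‖ ≤ C) (f : L1) :
    ‖∫ x, (φ x : ℂ) * f x‖ ≤ C * ‖f‖ := by
  rw [L1.norm_eq_integral_norm, ← integral_const_mul]
  refine norm_integral_le_of_norm_le ((L1.integrable_coeFn f).norm.const_mul C)
    (Eventually.of_forall fun x => ?_)
  rw [norm_mul]
  gcongr
  simpa using hC x

lemma integrable_test_mul (φ : 𝓓(Ω, ℝ)) (f : L1) : Integrable fun x => (φ x : ℂ) * f x :=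
  integrable_mul_L1 φ.continuous.stronglyMeasurable (test_bound φ) f

lemma integrable_hilbert_mul (φ : 𝓓(Ω, ℝ)) (g : L1) :
    Integrable fun x => (hilbert φ x : ℂ) * g x :=
  integrable_mul_L1 (hilbert_measurable φ.continuous) (hilbert_test_bound φ) g

end TestFunctions

/-! ### The spaces of distributions -/

/-- The action `⟨φ, f + Hg⟩ = ∫ φ f - ∫ (Hφ) g` on a test function `φ`. -/
def action (f g : L1) (φ : ℝ → ℝ) : ℂ :=
  (∫ x, (φ x : ℂ) * f x) - ∫ x, (hilbert φ x : ℂ) * g x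

lemma action_add_test {Ω : Opens ℝ} (f g : L1) (φ ψ : 𝓓(Ω, ℝ)) :
    action f g (φ + ψ : 𝓓(Ω, ℝ)) = action f g φ + action f g ψ := by
  simp only [action, hilbert_test_add, add_apply, Complex.ofReal_add, add_mul]
  rw [integral_add (integrable_test_mul φ f) (integrable_test_mul ψ f),
    integral_add (integrable_hilbert_mul φ g) (integrable_hilbert_mul ψ g)]
  ring

lemma action_smul_test {Ω : Opens ℝ} (f g : L1) (c : ℝ) (φ : 𝓓(Ω, ℝ)) :
    action f g (c • φ : 𝓓(Ω, ℝ)) = c • action f g φ := by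
  simp only [action, hilbert_test_smul, smul_apply, smul_eq_mul, Complex.ofReal_mul,
    mul_assoc, integral_const_mul, Complex.real_smul, mul_sub]

lemma action_seminorm_bound (K : Compacts ℝ) (f g : L1) (φ : 𝓓_{K}(ℝ, ℝ)) :
    ‖action f g φ‖ ≤ (‖f‖ + 4 * volume.real (K : Set ℝ) * ‖g‖) *
      (({0, 1} : Finset ℕ).sup fun i => N[ℝ; ℝ]_{K, i}) φ := by
  set S := (({0, 1} : Finset ℕ).sup fun i => N[ℝ; ℝ]_{K, i}) φ with hS
  have h0 : ∀ x, ‖φ x‖ ≤ S := fun x =>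
    (ContDiffMapSupportedIn.norm_apply_le_seminorm ℝ).trans
      (Seminorm.le_finset_sup_apply (p := fun i => N[ℝ; ℝ]_{K, i}) (by simp))
  have h1 : ∀ x, ‖deriv φ x‖ ≤ S := fun x => by
    rw [← iteratedDeriv_one, ← norm_iteratedFDeriv_eq_norm_iteratedDeriv]
    exact (ContDiffMapSupportedIn.norm_iteratedFDeriv_apply_le_seminorm_top ℝ).trans
      (Seminorm.le_finset_sup_apply (p := fun i => N[ℝ; ℝ]_{K, i}) (by simp))
  have h2 := hilbert_bound K.isCompact (φ.contDiff.differentiable (by simp))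
    (fun x hx => φ.zero_on_compl hx) h1
  calc ‖action f g φ‖ ≤ S * ‖f‖ + (4 * volume.real (K : Set ℝ) * S) * ‖g‖ :=
        (norm_sub_le _ _).trans
          (add_le_add (norm_integral_mul_L1_le h0 f) (norm_integral_mul_L1_le h2 g))
    _ = _ := by ring

lemma norm_action_le {Ω : Opens ℝ} (φ : 𝓓(Ω, ℝ)) :
    ∃ C, ∀ f g : L1, ‖action f g φ‖ ≤ C * (‖f‖ + ‖g‖) := by
  obtain ⟨A, hA⟩ := test_bound φ
  obtain ⟨B, hB⟩ := hilbert_test_bound φ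
  refine ⟨max A B, fun f g => ?_⟩
  rw [mul_add]
  refine (norm_sub_le _ _).trans (add_le_add ?_ ?_)
  · exact (norm_integral_mul_L1_le hA f).trans (by gcongr; exact le_max_left _ _)
  · exact (norm_integral_mul_L1_le hB g).trans (by gcongr; exact le_max_right _ _)

/-- The restriction to the open set `Ω` of the distribution `f + Hg` on the line. -/
def toDistribution (Ω : Opens ℝ) (f g : L1) : 𝓓'(Ω, ℂ) :=
  TestFunction.mkCLM ℝ (fun φ : 𝓓(Ω, ℝ) => action f g φ)
    (action_add_test f g) (action_smul_test f g) fun K hK =>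
      (ContDiffMapSupportedIn.mkCLMtoNormedSpace (𝕜 := ℝ)
        (fun φ : 𝓓_{K}(ℝ, ℝ) => action f g φ)
        (fun φ ψ => action_add_test f g
          (TestFunction.ofSupportedIn hK φ) (TestFunction.ofSupportedIn hK ψ))
        (fun c φ => action_smul_test f g c (TestFunction.ofSupportedIn hK φ))
        ⟨{0, 1}, ‖f‖ + 4 * volume.real (K : Set ℝ) * ‖g‖, by positivity,
          action_seminorm_bound K f g⟩).continuous

@[simp]
lemma toDistribution_apply (Ω : Opens ℝ) (f g : L1) (φ : 𝓓(Ω, ℝ)) :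
    toDistribution Ω f g φ = action f g φ := rfl

/-- The linear map `(f, g) ↦ (f + Hg)|_Ω` on `L¹(ℝ) × L¹₀(ℝ)`. -/
def toDistributionLM (Ω : Opens ℝ) : (L1 × L10) →ₗ[ℂ] 𝓓'(Ω, ℂ) where
  toFun p := toDistribution Ω p.1 p.2
  map_add' p q := by
    ext φ
    simp only [add_apply, toDistribution_apply, action, Prod.fst_add, Prod.snd_add,
      Submodule.coe_add]
    have h (a b : L1) (χ : ℝ → ℝ) : (∫ x, (χ x : ℂ) * (a + b : L1) x) =
        ∫ x, ((χ x : ℂ) * a x + (χ x : ℂ) * b x) :=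
      integral_congr_ae ((Lp.coeFn_add a b).mono fun x hx => by
        simp only [hx, Pi.add_apply, mul_add])
    rw [h, h, integral_add (integrable_test_mul φ _) (integrable_test_mul φ _),
      integral_add (integrable_hilbert_mul φ _) (integrable_hilbert_mul φ _)]
    ring
  map_smul' c p := by
    ext φ
    simp only [smul_apply, toDistribution_apply, action, Prod.smul_fst, Prod.smul_snd,
      Submodule.coe_smul, RingHom.id_apply]
    have h (a : L1) (χ : ℝ → ℝ) : (∫ x, (χ x : ℂ) * (c • a : L1) x) =
        ∫ x, c * ((χ x : ℂ) * a x) :=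
      integral_congr_ae ((Lp.coeFn_smul c a).mono fun x hx => by
        simp only [hx, Pi.smul_apply, smul_eq_mul]; ring)
    rw [h, h, integral_const_mul, integral_const_mul, smul_eq_mul]
    ring

/-- The space `𝔏(Ω)`: the distributions on the open set `Ω` which are restrictions to `Ω` of
elements of `𝔏₀(ℝ) = L¹(ℝ) + H L¹₀(ℝ)`. In particular `𝔏(⊤)` is `𝔏₀(ℝ)` itself. This is a
type of its own because it carries the norm below, not the topology of `𝓓'(Ω, ℂ)`. -/
def LSpace (Ω : Opens ℝ) : Type := LinearMap.range (toDistributionLM Ω)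

instance (Ω : Opens ℝ) : AddCommGroup (LSpace Ω) :=
  inferInstanceAs (AddCommGroup (LinearMap.range (toDistributionLM Ω)))

instance (Ω : Opens ℝ) : Module ℂ (LSpace Ω) :=
  inferInstanceAs (Module ℂ (LinearMap.range (toDistributionLM Ω)))

namespace LSpace

variable {Ω : Opens ℝ}

/-- An element of `𝔏(Ω)` as a distribution on `Ω`. -/
def toDist : LSpace Ω →ₗ[ℂ] 𝓓'(Ω, ℂ) := (LinearMap.range (toDistributionLM Ω)).subtype

lemma toDist_injective : Function.Injective (toDist (Ω := Ω)) := Subtype.val_injective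

/-- The element `(f + Hg)|_Ω` of `𝔏(Ω)`, where `f ∈ L¹(ℝ)` and `g ∈ L¹₀(ℝ)`. -/
def mk (Ω : Opens ℝ) : (L1 × L10) →ₗ[ℂ] LSpace Ω := (toDistributionLM Ω).rangeRestrict

lemma mk_surjective : Function.Surjective (mk Ω) := (toDistributionLM Ω).surjective_rangeRestrict

lemma toDist_mk (f : L1) (g : L10) (φ : 𝓓(Ω, ℝ)) : toDist (mk Ω (f, g)) φ = action f g φ := rfl

/-- The norm of `𝔏(Ω)`: the infimum of `‖f‖₁ + ‖g‖₁` over all `f ∈ L¹(ℝ)` and `g ∈ L¹₀(ℝ)` with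
`u = (f + Hg)|_Ω`. For `Ω = ⊤` this is the norm of `𝔏₀(ℝ)`, and in general it is the quotient norm
`inf ‖U‖` over all `U ∈ 𝔏₀(ℝ)` with `U|_Ω = u`. -/
instance : Norm (LSpace Ω) where
  norm u := sInf {r | ∃ (f : L1) (g : L10), mk Ω (f, g) = u ∧ r = ‖f‖ + ‖g‖}

lemma norm_mk_le (f : L1) (g : L10) : ‖mk Ω (f, g)‖ ≤ ‖f‖ + ‖g‖ :=
  csInf_le ⟨0, by rintro _ ⟨f, g, -, rfl⟩; positivity⟩ ⟨f, g, rfl, rfl⟩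

lemma le_norm {u : LSpace Ω} {c : ℝ}
    (h : ∀ (f : L1) (g : L10), mk Ω (f, g) = u → c ≤ ‖f‖ + ‖g‖) : c ≤ ‖u‖ := by
  obtain ⟨⟨f, g⟩, hfg⟩ := mk_surjective u
  refine le_csInf ⟨_, f, g, hfg, rfl⟩ ?_
  rintro _ ⟨f, g, hu, rfl⟩
  exact h f g hu

lemma norm_smul_le (c : ℂ) (u : LSpace Ω) : ‖c • u‖ ≤ ‖c‖ * ‖u‖ := by
  rcases eq_or_ne c 0 with rfl | hc
  · have h := norm_mk_le (Ω := Ω) 0 0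
    rw [Prod.mk_zero_zero, map_zero] at h
    simpa using h
  · rw [← div_le_iff₀' (norm_pos_iff.mpr hc)]
    refine le_norm fun f g hu => ?_
    rw [div_le_iff₀' (norm_pos_iff.mpr hc), ← hu, ← map_smul, Prod.smul_mk]
    refine (norm_mk_le _ _).trans (le_of_eq ?_)
    rw [norm_smul, norm_smul, mul_add]

lemma normCore (Ω : Opens ℝ) : NormedSpace.Core ℂ (LSpace Ω) where
  norm_nonneg u := le_norm fun f g _ => by positivity
  norm_smul c u := by
    refine le_antisymm (norm_smul_le c u) ?_
    rcases eq_or_ne c 0 with rfl | hc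
    · simpa using le_norm (u := (0 : ℂ) • u) fun f g _ => by positivity
    · have h := norm_smul_le c⁻¹ (c • u)
      rw [inv_smul_smul₀ hc, norm_inv] at h
      rwa [← div_eq_inv_mul, le_div_iff₀' (norm_pos_iff.mpr hc)] at h
  norm_triangle u v := by
    rw [← sub_le_iff_le_add]
    refine le_norm fun f g hu => ?_
    rw [sub_le_comm]
    refine le_norm fun f' g' hv => ?_
    rw [sub_le_iff_le_add, ← hu, ← hv, ← map_add, Prod.mk_add_mk]
    refine (norm_mk_le _ _).trans ?_
    linarith [norm_add_le f f', norm_add_le g g']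
  norm_eq_zero_iff u := by
    constructor
    · intro h0
      apply toDist_injective
      rw [map_zero]
      ext φ
      obtain ⟨C, hC⟩ := norm_action_le φ
      have hC' : ∀ (f : L1) (g : L10), mk Ω (f, g) = u →
          ‖toDist u φ‖ ≤ (|C| + 1) * (‖f‖ + ‖g‖) := by
        rintro f g rfl
        refine (hC f g).trans (mul_le_mul_of_nonneg_right ?_ (by positivity))
        linarith [le_abs_self C]
      have h1 : ‖toDist u φ‖ / (|C| + 1) ≤ ‖u‖ := le_norm fun f g hu => by
        rw [div_le_iff₀' (by positivity)]
        exact hC' f g hu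
      rw [h0, div_le_iff₀' (by positivity), mul_zero] at h1
      simpa using h1
    · rintro rfl
      refine le_antisymm ?_ (le_norm fun f g _ => by positivity)
      have h := norm_mk_le (Ω := Ω) 0 0
      rw [Prod.mk_zero_zero, map_zero] at h
      simpa using h

instance : NormedAddCommGroup (LSpace Ω) := NormedAddCommGroup.ofCore (normCore Ω)

instance : NormedSpace ℂ (LSpace Ω) := NormedSpace.ofCore (normCore Ω)

end LSpace

/-! ### The subtransfer operator -/

/-- The open interval `I₁ = ]-1, 1[`. -/
def I₁ : Opens ℝ := ⟨Set.Ioo (-1) 1, isOpen_Ioo⟩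

/-- The involution `J_β f(x) = (β / x²) f(-β / x)` on `L¹(ℝ)`. On `𝔏₀(ℝ)` it acts by
`J_β (f + Hg) = J_β f + H (J_β g)`. -/
def invol (β : ℝ) (f : ℝ → ℂ) (x : ℝ) : ℂ := ((β / x ^ 2 : ℝ) : ℂ) * f (-β / x)

/-- The periodization `P₂ φ(x) = ∑_{j ∈ ℤ} φ(x + 2j)` (a locally finite sum for a test function). -/
def periodize (φ : ℝ → ℝ) (x : ℝ) : ℝ := ∑' j : ℤ, φ (x + 2 * j)

/-- The dual action `⟨φ, f + Hg⟩ = ∫ φ f - ∫ (H̃φ) g` of an element of `𝔏₀(ℝ)` on a smooth bounded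
function `φ`, which is either compactly supported or `2`-periodic. -/
def extAction (φ : ℝ → ℝ) (f g : ℝ → ℂ) : ℂ :=
  (∫ x, (φ x : ℂ) * f x) - ∫ x, (modHilbert φ x : ℂ) * g x

/-- The action on a test function `φ` of `Σ₂ V = P₂ V - V = ∑_{j ≠ 0} V(· + 2j)`, where
`V = f + Hg` is in `𝔏₀(ℝ)` and `⟨φ, P₂ V⟩ = ⟨P₂ φ, V⟩`. -/
def superAction (φ : ℝ → ℝ) (f g : ℝ → ℂ) : ℂ :=
  extAction (periodize φ) f g - extAction φ f g

/-- `T` is the subtransfer operator on `𝔏(I₁)`: for every `U = f + Hg` in `𝔏₀(ℝ)`, the value of `T`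
at the restriction of `U` to `I₁` is the restriction to `I₁` of `Σ₂ J_β U`. As every element of
`𝔏(I₁)` is such a restriction, there is at most one such `T`. -/
def IsSubtransfer (β : ℝ) (T : LSpace I₁ →ₗ[ℂ] LSpace I₁) : Prop :=
  ∀ (f : L1) (g : L10) (φ : 𝓓(I₁, ℝ)),
    (T (LSpace.mk I₁ (f, g))).toDist φ = superAction φ (invol β f) (invol β (g : L1))

/-- The subtransfer operator on functions,
`T_β f(x) = ∑_{j ≠ 0} β / (2j + x)² f(-β / (2j + x))`. -/
def subtransferFun (β : ℝ) (f : ℝ → ℂ) (x : ℝ) : ℂ :=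
  ∑' j : {j : ℤ // j ≠ 0}, ((β / (2 * (j : ℤ) + x) ^ 2 : ℝ) : ℂ) * f (-β / (2 * (j : ℤ) + x))

end GaussType

end

noncomputable section

namespace GaussType

/-! ### The Hilbert transform of compactly supported functions -/

section HilbertTransform

variable {θ η : ℝ → ℝ}

/-! Write Πφ for the 2-periodization of a test function φ on I₁ and H̃ for the modified Hilbert
transform. Pairing φ with Σ₂J_βU means pairing Πφ - φ with J_βU, so H̃Πφ must first be understood.
It is bounded and 2-periodic. Boundedness comes from cutting Πφ off at radius R: up to a slowly
varying remainder the result is the derivative of a bounded function, so its Hilbert transform is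
bounded uniformly in R (`exists_hilbert_taper_bound`), and these transforms, normalized at 0,
converge to H̃Πφ normalized at 0 (`tendsto_hilbert_taper`).

Values in 𝔏(I₁) (`exists_representation`, `exists_subtransfer_value`): integrals against a periodic
function fold onto one period. There H̃Πφ is a sum of three translates of Hφ, a constant that mean
zero kills, and an integral of Πφ against a kernel of size (1 + t²)⁻¹. The translates yield the new
H-part, and the kernel is transposed into an L¹ function. This also gives the bound 8 for the norm.

Well-definedness (`superAction_eq_zero`): let U vanish on I₁. Since Πφ - φ vanishes on a
neighbourhood of [-1, 1], its pullback under x ↦ -β/x is supported inside I₁, but is in general not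
smooth at 0. Tapering Πφ makes the pullback a test function, on which U vanishes. The Hilbert
transform commutes with the inversion up to a constant (`hilbert_inversion`), and dominated
convergence removes the taper.

Norm above 1 (`IsSubtransfer.one_lt_norm`): take an even bump 0 ≤ φ ≤ 1 with flanks so steep that M
= max |Hφ| ≥ 1. Then |⟨φ, u⟩| ≤ M‖u‖ on 𝔏(I₁). Let s be near the support with Hφ(s) = M. By oddness
Hφ(-s) = -M, so H̃Πφ - H̃φ contains the value M at -2 + s and -M at 2 - s. The remaining translates
add a strictly positive amount to the difference of the two values, because 1/2 - 1/4 - 1/6 > 0, and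
the tail has the same sign. If J_βg is the difference of short indicators at these two points, |⟨φ,
T(Hg)⟩| exceeds M times the bound for ‖g‖₁, which is impossible when ‖T‖ ≤ 1. -/

lemma exists_deriv_bound (hθ : ContDiff ℝ 1 θ) (hc : HasCompactSupport θ) :
    ∃ D, ∀ x, ‖deriv θ x‖ ≤ D :=
  hc.deriv.exists_bound_of_continuous (hθ.continuous_deriv (by simp))

lemma hilbert_integrable (hθ : ContDiff ℝ 1 θ) (hc : HasCompactSupport θ) (x : ℝ) :
    Integrable fun t : ℝ => (θ (x - t) - θ (x + t)) / t := by
  obtain ⟨D, hD⟩ := exists_deriv_bound hθ hc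
  exact hilbert_integrand_integrable hc (hθ.differentiable (by simp))
    (fun _ hx => image_eq_zero_of_notMem_tsupport hx) hD x

lemma exists_hilbert_bound (hθ : ContDiff ℝ 1 θ) (hc : HasCompactSupport θ) :
    ∃ C, ∀ x, ‖hilbert θ x‖ ≤ C := by
  obtain ⟨D, hD⟩ := exists_deriv_bound hθ hc
  exact ⟨_, hilbert_bound hc (hθ.differentiable (by simp))
    (fun _ hx => image_eq_zero_of_notMem_tsupport hx) hD⟩

lemma hilbert_add (hθ : ContDiff ℝ 1 θ) (hc : HasCompactSupport θ) (hη : ContDiff ℝ 1 η)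
    (hc' : HasCompactSupport η) (x : ℝ) :
    hilbert (fun t => θ t + η t) x = hilbert θ x + hilbert η x := by
  unfold hilbert
  rw [← mul_add, ← integral_add (hilbert_integrable hθ hc x) (hilbert_integrable hη hc' x)]
  congr 2
  ext t
  ring

lemma hilbert_sub (hθ : ContDiff ℝ 1 θ) (hc : HasCompactSupport θ) (hη : ContDiff ℝ 1 η)
    (hc' : HasCompactSupport η) (x : ℝ) :
    hilbert (fun t => θ t - η t) x = hilbert θ x - hilbert η x := by
  unfold hilbert
  rw [← mul_sub, ← integral_sub (hilbert_integrable hθ hc x) (hilbert_integrable hη hc' x)]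
  congr 2
  ext t
  ring

lemma hilbert_sum {ι : Type*} (s : Finset ι) {f : ι → ℝ → ℝ} (hf : ∀ i, ContDiff ℝ 1 (f i))
    (hc : ∀ i, HasCompactSupport (f i)) (x : ℝ) :
    hilbert (fun t => ∑ i ∈ s, f i t) x = ∑ i ∈ s, hilbert (f i) x := by
  unfold hilbert
  rw [← Finset.mul_sum, ← integral_finsetSum _ fun i _ => hilbert_integrable (hf i) (hc i) x]
  congr 2
  ext t
  rw [← Finset.sum_sub_distrib, Finset.sum_div]

lemma hilbert_comp_add (θ : ℝ → ℝ) (a x : ℝ) :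
    hilbert (fun t => θ (t + a)) x = hilbert θ (x + a) := by
  unfold hilbert
  congr 2
  ext t
  beta_reduce
  rw [show x - t + a = x + a - t by ring, show x + t + a = x + a + t by ring]

lemma hilbert_neg_of_even (he : ∀ t, θ (-t) = θ t) (x : ℝ) : hilbert θ (-x) = -hilbert θ x := by
  unfold hilbert
  rw [← mul_neg, ← integral_neg]
  congr 2
  ext t
  rw [show -x - t = -(x + t) by ring, show -x + t = -(x - t) by ring, he, he]
  ring

lemma hilbert_continuous (hθ : ContDiff ℝ 1 θ) (hc : HasCompactSupport θ) :
    Continuous (hilbert θ) := by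
  obtain ⟨D, hD⟩ := exists_deriv_bound hθ hc
  obtain ⟨R, hR⟩ := hc.isCompact.isBounded.subset_closedBall (0 : ℝ)
  have hz : ∀ x, R < |x| → θ x = 0 := fun x hx =>
    image_eq_zero_of_notMem_tsupport fun h => by
      have := hR h
      rw [Metric.mem_closedBall, dist_zero_right, Real.norm_eq_abs] at this
      linarith
  rw [continuous_iff_continuousAt]
  intro x₀
  refine ContinuousAt.mul continuousAt_const ?_
  -- For x within 1 of x₀ the integrand is at most 2D and vanishes for |t| > R + |x₀| + 1, which
  -- gives one integrable majorant.
  refine continuousAt_of_dominated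
    (bound := (Set.Icc (-(R + |x₀| + 1)) (R + |x₀| + 1)).indicator fun _ => 2 * D) ?_ ?_ ?_ ?_
  · refine Eventually.of_forall fun x => ?_
    exact (hilbert_integrable hθ hc x).aestronglyMeasurable
  · filter_upwards [Metric.ball_mem_nhds x₀ one_pos] with x hx
    refine Eventually.of_forall fun t => ?_
    have hx' : |x| < |x₀| + 1 := by
      rw [Metric.mem_ball, Real.dist_eq] at hx
      linarith [abs_sub_abs_le_abs_sub x x₀]
    by_cases ht : t ∈ Set.Icc (-(R + |x₀| + 1)) (R + |x₀| + 1)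
    · rw [Set.indicator_of_mem ht]
      exact hilbert_integrand_bound (hθ.differentiable (by simp)) hD x t
    · rw [Set.indicator_of_notMem ht]
      have ht' : R + |x₀| + 1 < |t| := by
        rw [Set.mem_Icc, ← abs_le] at ht
        exact not_le.1 ht
      rw [hz (x - t), hz (x + t)]
      · simp
      · have := abs_sub_abs_le_abs_sub t (-x)
        rw [abs_neg, sub_neg_eq_add, add_comm t x] at this
        linarith
      · have := abs_sub_abs_le_abs_sub t x
        rw [abs_sub_comm t x] at this
        linarith
  · exact (integrable_indicator_iff measurableSet_Icc).2
      (integrableOn_const (by simp))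
  · refine Eventually.of_forall fun t => ?_
    have := hθ.continuous
    exact Continuous.continuousAt (by fun_prop)

/-! ### Truncated singular integrals and principal values -/

lemma integrable_indicator_div (hθ : Integrable θ) (x : ℝ) {ε : ℝ} (hε : 0 < ε) :
    Integrable ({s : ℝ | ε < |s|}.indicator fun s => θ (x - s) / s) := by
  have hm : MeasurableSet {s : ℝ | ε < |s|} := measurableSet_lt measurable_const measurable_abs
  have hi : Integrable fun s => θ (x - s) := hθ.comp_sub_left x
  have : ({s : ℝ | ε < |s|}.indicator fun s => θ (x - s) / s) =
      fun s => {s : ℝ | ε < |s|}.indicator (fun s => s⁻¹) s * θ (x - s) := by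
    ext s
    by_cases hs : s ∈ {s : ℝ | ε < |s|}
    · simp only [Set.indicator_of_mem hs]
      ring
    · simp only [Set.indicator_of_notMem hs, zero_mul]
  rw [this]
  refine hi.bdd_mul (c := ε⁻¹) (measurable_inv.indicator hm).aestronglyMeasurable
    (Eventually.of_forall fun s => ?_)
  by_cases hs : s ∈ {s : ℝ | ε < |s|}
  · rw [Set.indicator_of_mem hs, norm_inv, Real.norm_eq_abs]
    exact inv_anti₀ hε (le_of_lt hs)
  · rw [Set.indicator_of_notMem hs, norm_zero]
    positivity

/-- Symmetrization of a truncated singular integral. -/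
lemma setIntegral_div_eq_symmetrized (hθ : Integrable θ) (x : ℝ) {ε : ℝ} (hε : 0 < ε) :
    ∫ t in {t : ℝ | ε < |x - t|}, θ t / (x - t) =
      (1 / 2) * ∫ s in {s : ℝ | ε < |s|}, (θ (x - s) - θ (x + s)) / s := by
  have hm : MeasurableSet {s : ℝ | ε < |s|} := measurableSet_lt measurable_const measurable_abs
  have hm' : MeasurableSet {t : ℝ | ε < |x - t|} :=
    measurableSet_lt measurable_const (by fun_prop)
  have hA := integrable_indicator_div hθ x hε
  have h1 : ∫ t in {t : ℝ | ε < |x - t|}, θ t / (x - t) =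
      ∫ s, {s : ℝ | ε < |s|}.indicator (fun s => θ (x - s) / s) s := by
    rw [← integral_indicator hm',
      ← integral_sub_left_eq_self ({s : ℝ | ε < |s|}.indicator fun s => θ (x - s) / s) volume x]
    congr 1
    ext t
    simp only [Set.indicator_apply, Set.mem_ofPred_eq, sub_sub_cancel]
  -- The reflection s ↦ -s preserves the truncation; averaging both forms produces the symmetrized
  -- integrand.
  have h2 : ∫ s, {s : ℝ | ε < |s|}.indicator (fun s => θ (x - s) / s) s =
      ∫ s, {s : ℝ | ε < |s|}.indicator (fun s => -(θ (x + s) / s)) s := by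
    rw [← integral_neg_eq_self]
    congr 1
    ext s
    simp only [Set.indicator_apply, Set.mem_ofPred_eq, abs_neg, sub_neg_eq_add, div_neg]
  have hB : Integrable ({s : ℝ | ε < |s|}.indicator fun s => -(θ (x + s) / s)) := by
    convert hA.comp_neg using 1
    ext s
    simp only [Set.indicator_apply, Set.mem_ofPred_eq, abs_neg, sub_neg_eq_add, div_neg]
  have h3 : ∫ s in {s : ℝ | ε < |s|}, (θ (x - s) - θ (x + s)) / s =
      (∫ s, {s : ℝ | ε < |s|}.indicator (fun s => θ (x - s) / s) s) +
      ∫ s, {s : ℝ | ε < |s|}.indicator (fun s => -(θ (x + s) / s)) s := by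
    rw [← integral_add hA hB, ← integral_indicator hm]
    congr 1
    ext s
    simp only [Set.indicator_apply, Set.mem_ofPred_eq]
    split_ifs
    · ring
    · ring
  rw [h1, h3, ← h2]
  ring

/-- The Hilbert transform at a point with distance at least `r` to the support. -/
lemma hilbert_eq_of_zero_near (hθ : Integrable θ) {x r : ℝ} (hr : 0 < r)
    (hz : ∀ t, |x - t| < r → θ t = 0) :
    hilbert θ x = (1 / Real.pi) * ∫ t, θ t / (x - t) := by
  have h := setIntegral_div_eq_symmetrized hθ x (half_pos hr)
  rw [setIntegral_eq_integral_of_forall_compl_eq_zero,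
    setIntegral_eq_integral_of_forall_compl_eq_zero] at h
  · rw [h]
    unfold hilbert
    ring
  · intro s hs
    have hs' : |s| < r := by
      rw [Set.mem_ofPred_eq, not_lt] at hs
      linarith
    rw [hz (x - s) (by simpa using hs'), hz (x + s) (by simpa using hs')]
    simp
  · intro t ht
    rw [Set.mem_ofPred_eq, not_lt] at ht
    rw [hz t (by linarith), zero_div]

/-- The symmetrized integrand is absolutely integrable, so its truncations converge by dominated
convergence. This identifies `hilbert` with the principal value. -/
lemma tendsto_truncated_hilbert (hθ : ContDiff ℝ 1 θ) (hc : HasCompactSupport θ) (x : ℝ) :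
    Tendsto (fun ε : ℝ => ∫ t in {t : ℝ | ε < |x - t|}, θ t / (x - t)) (𝓝[>] 0)
      (𝓝 (Real.pi * hilbert θ x)) := by
  have hi := hilbert_integrable hθ hc x
  have h : Tendsto (fun ε : ℝ => ∫ s in {s : ℝ | ε < |s|}, (θ (x - s) - θ (x + s)) / s) (𝓝[>] 0)
      (𝓝 (∫ s, (θ (x - s) - θ (x + s)) / s)) := by
    have hm (ε : ℝ) : MeasurableSet {s : ℝ | ε < |s|} :=
      measurableSet_lt measurable_const measurable_abs
    simp_rw [← integral_indicator (hm _)]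
    refine tendsto_integral_filter_of_dominated_convergence _ ?_ ?_ hi.norm ?_
    · exact Eventually.of_forall fun ε => hi.aestronglyMeasurable.indicator (hm ε)
    · exact Eventually.of_forall fun ε => Eventually.of_forall fun s => norm_indicator_le_norm_self _ _
    · filter_upwards [compl_mem_ae_iff.2 (measure_singleton (0 : ℝ))] with s hs
      refine tendsto_const_nhds.congr' ?_
      have hs' : 0 < |s| := abs_pos.2 hs
      filter_upwards [nhdsWithin_le_nhds (Iio_mem_nhds hs')] with ε hε
      rw [Set.indicator_of_mem (show s ∈ {s : ℝ | ε < |s|} from hε)]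
  refine (h.const_mul (1 / 2)).congr' ?_ |>.trans (le_of_eq ?_)
  · filter_upwards [self_mem_nhdsWithin] with ε hε
    exact (setIntegral_div_eq_symmetrized (hθ.continuous.integrable_of_hasCompactSupport hc) x
      hε).symm
  · congr 1
    unfold hilbert
    field_simp

lemma hilbert_eq_integral_Ioi (θ : ℝ → ℝ) (x : ℝ) :
    hilbert θ x = (1 / Real.pi) * ∫ t in Set.Ioi (0 : ℝ), (θ (x - t) - θ (x + t)) / t := by
  have h := integral_comp_abs (f := fun t => (θ (x - t) - θ (x + t)) / t)
  have h' : (fun t : ℝ => (θ (x - |t|) - θ (x + |t|)) / |t|) =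
      fun t => (θ (x - t) - θ (x + t)) / t := by
    ext t
    rcases abs_cases t with ⟨h, _⟩ | ⟨h, _⟩
    · rw [h]
    · rw [h, sub_neg_eq_add, ← sub_eq_add_neg, div_neg, ← neg_div, neg_sub]
  unfold hilbert
  beta_reduce at h
  rw [h'] at h
  rw [h]
  ring

/-! ### Logarithmic potentials and integration by parts -/

lemma locallyIntegrable_log : LocallyIntegrable Real.log := by
  rw [locallyIntegrable_iff]
  intro K hK
  obtain ⟨R, hR⟩ := hK.isBounded.subset_closedBall (0 : ℝ)
  rw [Real.closedBall_eq_Icc] at hR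
  rcases le_or_gt 0 R with h | h
  · refine IntegrableOn.mono_set ?_ hR
    rw [integrableOn_Icc_iff_integrableOn_Ioc,
      ← intervalIntegrable_iff_integrableOn_Ioc_of_le (by linarith)]
    exact intervalIntegral.intervalIntegrable_log'
  · rw [Set.Icc_eq_empty (by linarith)] at hR
    rw [Set.subset_empty_iff.1 hR]
    exact integrableOn_empty

lemma integrable_mul_log (hθ : Continuous θ) (hc : HasCompactSupport θ) :
    Integrable fun t => θ t * Real.log t :=
  locallyIntegrable_log.integrable_smul_left_of_hasCompactSupport hθ hc

lemma integrable_mul_log_sub (hθ : Continuous θ) (hc : HasCompactSupport θ) (x : ℝ) :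
    Integrable fun t => θ t * Real.log (x - t) := by
  have h := (integrable_mul_log (θ := fun s => θ (x - s)) (by fun_prop)
    (hc.comp_homeomorph (Homeomorph.subLeft x))).comp_sub_left x
  simpa using h

lemma eventually_atTop_zero (hc : HasCompactSupport θ) (x : ℝ) :
    ∀ᶠ t in atTop, θ (x - t) = 0 ∧ θ (x + t) = 0 := by
  obtain ⟨R, hR⟩ := hc.isCompact.isBounded.subset_closedBall (0 : ℝ)
  have hz : ∀ x, R < |x| → θ x = 0 := fun x hx =>
    image_eq_zero_of_notMem_tsupport fun h => by
      have := hR h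
      rw [Metric.mem_closedBall, dist_zero_right, Real.norm_eq_abs] at this
      linarith
  filter_upwards [eventually_gt_atTop (R + |x|)] with t ht
  have h1 := neg_abs_le x
  have h2 := le_abs_self x
  constructor
  · apply hz
    have := neg_le_abs (x - t)
    linarith
  · apply hz
    have := le_abs_self (x + t)
    linarith

/-- Integration by parts: the Hilbert transform as a logarithmic potential. -/
lemma hilbert_eq_integral_log (hθ : ContDiff ℝ 1 θ) (hc : HasCompactSupport θ) (x : ℝ) :
    hilbert θ x = (1 / Real.pi) * ∫ t, deriv θ t * Real.log (x - t) := by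
  have hd : ∀ y, HasDerivAt θ (deriv θ y) y := fun y =>
    (hθ.differentiable (by simp) y).hasDerivAt
  have hcont : Continuous (deriv θ) := hθ.continuous_deriv (by simp)
  have hlog := integrable_mul_log_sub hcont hc.deriv x
  have hi1 : Integrable fun t => deriv θ (x - t) * Real.log t := by
    simpa using hlog.comp_sub_left x
  have hi2 : Integrable fun t => deriv θ (x + t) * Real.log t := by
    have := hlog.comp_add_left x
    simpa using this
  -- Integration by parts of the symmetrized integral on (0, ∞), with log t as primitive of 1/t.
  -- Both boundary terms vanish.
  have hparts := integral_Ioi_mul_deriv_eq_deriv_mul (a := (0 : ℝ)) (a' := 0) (b' := 0)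
    (u := fun t => θ (x - t) - θ (x + t)) (u' := fun t => -(deriv θ (x - t) + deriv θ (x + t)))
    (v := Real.log) (v' := fun t => t⁻¹) ?_ ?_ ?_ ?_ ?_ ?_
  · rw [hilbert_eq_integral_Ioi]
    congr 1
    simp only [div_eq_mul_inv]
    rw [hparts]
    have h1 := integral_comp_abs
      (f := fun t => (deriv θ (x - t) + deriv θ (x + t)) * Real.log t)
    have h2 : (fun t : ℝ => (deriv θ (x - |t|) + deriv θ (x + |t|)) * Real.log |t|) =
        fun t => deriv θ (x - t) * Real.log t + deriv θ (x + t) * Real.log t := by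
      ext t
      rw [Real.log_abs]
      rcases abs_cases t with ⟨h, _⟩ | ⟨h, _⟩
      · rw [h]
        ring
      · rw [h, sub_neg_eq_add, ← sub_eq_add_neg]
        ring
    beta_reduce at h1
    rw [h2, integral_add hi1 hi2] at h1
    have h3 : ∫ t, deriv θ (x - t) * Real.log t = ∫ t, deriv θ t * Real.log (x - t) := by
      rw [← integral_sub_left_eq_self (fun t => deriv θ t * Real.log (x - t)) volume x]
      simp
    have h4 : ∫ t, deriv θ (x + t) * Real.log t = ∫ t, deriv θ t * Real.log (x - t) := by
      rw [← integral_add_left_eq_self (fun t => deriv θ t * Real.log (x - t)) x]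
      simp
    rw [h3, h4] at h1
    simp only [neg_mul, integral_neg]
    linarith
  · intro t _
    have e1 : HasDerivAt (fun t => θ (x - t)) (deriv θ (x - t) * (-1)) t :=
      (hd (x - t)).comp t ((hasDerivAt_id t).const_sub x)
    have e2 : HasDerivAt (fun t => θ (x + t)) (deriv θ (x + t) * 1) t :=
      (hd (x + t)).comp t ((hasDerivAt_id t).const_add x)
    exact (e1.sub e2).congr_deriv (by ring)
  · intro t ht
    exact Real.hasDerivAt_log (ne_of_gt ht)
  · have := (hilbert_integrable hθ hc x).integrableOn (s := Set.Ioi 0)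
    simpa only [div_eq_mul_inv, Pi.mul_def] using this
  · have := ((hi1.add hi2).neg).integrableOn (s := Set.Ioi 0)
    refine this.congr_fun (fun t _ => ?_) measurableSet_Ioi
    simp only [Pi.neg_apply, Pi.add_apply, Pi.mul_apply]
    ring
  -- At 0 the difference θ(x - t) - θ(x + t) is O(t), which beats the logarithm.
  · obtain ⟨D, hD⟩ := exists_deriv_bound hθ hc
    have hlim : Tendsto (fun t : ℝ => 2 * D * |Real.log t * t|) (𝓝[>] 0) (𝓝 0) := by
      have hcm : Continuous fun t : ℝ => 2 * D * |t * Real.log t| :=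
        (Real.continuous_mul_log.abs).const_mul _
      have := hcm.tendsto 0
      simp only [zero_mul, abs_zero, mul_zero] at this
      simpa only [mul_comm (Real.log _)] using this.mono_left nhdsWithin_le_nhds
    refine squeeze_zero_norm' ?_ hlim
    filter_upwards [self_mem_nhdsWithin] with t ht
    have hb := hilbert_integrand_bound (hθ.differentiable (by simp)) hD x t
    rw [norm_div, div_le_iff₀ (norm_pos_iff.2 (ne_of_gt ht))] at hb
    rw [Pi.mul_apply, norm_mul, abs_mul, Real.norm_eq_abs (Real.log t)]
    rw [Real.norm_eq_abs t] at hb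
    nlinarith [mul_le_mul_of_nonneg_right hb (abs_nonneg (Real.log t))]
  · refine tendsto_const_nhds.congr' ?_
    filter_upwards [eventually_atTop_zero hc x] with t ht
    simp [ht.1, ht.2]

/-- The Hilbert transform of the derivative of a `C²` function is controlled by uniform bounds for
the function and its second derivative, whatever the size of the support. -/
lemma hilbert_deriv_bound {u : ℝ → ℝ} (hu : ContDiff ℝ 2 u) (hc : HasCompactSupport u) {A E : ℝ}
    (hA : ∀ x, ‖u x‖ ≤ A) (hE : ∀ x, ‖deriv (deriv u) x‖ ≤ E) (x : ℝ) :
    ‖hilbert (deriv u) x‖ ≤ 2 * E + 4 * A := by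
  have hA0 : 0 ≤ A := (norm_nonneg _).trans (hA 0)
  have hE0 : 0 ≤ E := (norm_nonneg _).trans (hE 0)
  have hu' : ContDiff ℝ 1 (deriv u) := by
    have := (contDiff_succ_iff_deriv (n := 1)).1 hu
    exact this.2.2
  have hd : ∀ y, HasDerivAt u (deriv u y) y := fun y =>
    (hu.differentiable (by simp) y).hasDerivAt
  have hi := hilbert_integrable hu' hc.deriv x
  -- On (0, 1] the mean value bound uses only the second derivative of u. On (1, ∞) a further
  -- integration by parts uses only u itself.
  have hsplit : ∫ t in Set.Ioi (0 : ℝ), (deriv u (x - t) - deriv u (x + t)) / t =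
      (∫ t in Set.Ioc (0 : ℝ) 1, (deriv u (x - t) - deriv u (x + t)) / t) +
      ∫ t in Set.Ioi (1 : ℝ), (deriv u (x - t) - deriv u (x + t)) / t := by
    rw [← setIntegral_union (Set.Ioc_disjoint_Ioi le_rfl) measurableSet_Ioi
      hi.integrableOn hi.integrableOn, Set.Ioc_union_Ioi_eq_Ioi zero_le_one]
  have h1 : ‖∫ t in Set.Ioc (0 : ℝ) 1, (deriv u (x - t) - deriv u (x + t)) / t‖ ≤ 2 * E := by
    refine (norm_setIntegral_le_of_norm_le_const (C := 2 * E) (by simp) fun t _ =>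
      hilbert_integrand_bound (hu'.differentiable (by simp)) hE x t).trans (le_of_eq ?_)
    simp
  have hsq : IntegrableOn (fun t : ℝ => t ^ (-2 : ℝ)) (Set.Ioi 1) :=
    integrableOn_Ioi_rpow_of_lt (by norm_num) one_pos
  have hval : ∫ t in Set.Ioi (1 : ℝ), t ^ (-2 : ℝ) = 1 := by
    rw [integral_Ioi_rpow_of_lt (by norm_num) one_pos]
    norm_num
  have hbd : ∀ t ∈ Set.Ioi (1 : ℝ),
      ‖(-(t ^ 2)⁻¹) * (-(u (x - t) + u (x + t)))‖ ≤ 2 * A * t ^ (-2 : ℝ) := by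
    intro t ht
    have ht0 : (0 : ℝ) < t := lt_trans one_pos ht
    rw [norm_mul, norm_neg, norm_neg, Real.rpow_neg ht0.le, norm_inv, norm_pow,
      Real.norm_of_nonneg ht0.le]
    have : ‖u (x - t) + u (x + t)‖ ≤ 2 * A := by
      linarith [norm_add_le (u (x - t)) (u (x + t)), hA (x - t), hA (x + t)]
    have e : t ^ (2 : ℝ) = t ^ 2 := by norm_cast
    rw [e, mul_comm]
    gcongr
  have hcu := hu.continuous
  have hiu : IntegrableOn (fun t : ℝ => (-(t ^ 2)⁻¹) * (-(u (x - t) + u (x + t))))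
      (Set.Ioi 1) := by
    refine Integrable.mono' (hsq.const_mul (2 * A)) ?_
      ((ae_restrict_iff' measurableSet_Ioi).2 (Eventually.of_forall hbd))
    exact Measurable.aestronglyMeasurable (by fun_prop)
  -- The numerator is the derivative of -(u(x - t) + u(x + t)). The boundary term at 1 and the
  -- integral against t⁻² contribute at most 2A each.
  have hparts := integral_Ioi_mul_deriv_eq_deriv_mul (a := (1 : ℝ))
    (a' := -(u (x - 1) + u (x + 1))) (b' := 0)
    (u := fun t => t⁻¹) (u' := fun t => -(t ^ 2)⁻¹)
    (v := fun t => -(u (x - t) + u (x + t))) (v' := fun t => deriv u (x - t) - deriv u (x + t))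
    ?_ ?_ ?_ hiu ?_ ?_
  · have h2 : ‖∫ t in Set.Ioi (1 : ℝ), (deriv u (x - t) - deriv u (x + t)) / t‖ ≤ 4 * A := by
      simp only [div_eq_inv_mul]
      rw [hparts]
      have hint : ‖∫ t in Set.Ioi (1 : ℝ), (-(t ^ 2)⁻¹) * (-(u (x - t) + u (x + t)))‖ ≤ 2 * A := by
        refine (norm_integral_le_of_norm_le (hsq.const_mul (2 * A))
          ((ae_restrict_iff' measurableSet_Ioi).2 (Eventually.of_forall hbd))).trans (le_of_eq ?_)
        rw [integral_const_mul, hval, mul_one]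
      rw [sub_neg_eq_add, zero_add]
      linarith [norm_sub_le (u (x - 1) + u (x + 1))
        (∫ t in Set.Ioi (1 : ℝ), (-(t ^ 2)⁻¹) * (-(u (x - t) + u (x + t)))),
        norm_add_le (u (x - 1)) (u (x + 1)), hA (x - 1), hA (x + 1)]
    rw [hilbert_eq_integral_Ioi, hsplit, norm_mul]
    have hpi : ‖1 / Real.pi‖ ≤ 1 := by
      rw [Real.norm_of_nonneg (by positivity), div_le_one Real.pi_pos]
      linarith [Real.pi_gt_three]
    calc _ ≤ 1 * (2 * E + 4 * A) :=
          mul_le_mul hpi ((norm_add_le _ _).trans (add_le_add h1 h2)) (norm_nonneg _) zero_le_one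
      _ = _ := one_mul _
  · intro t ht
    exact hasDerivAt_inv (ne_of_gt (lt_trans one_pos ht))
  · intro t _
    have e1 : HasDerivAt (fun t => u (x - t)) (deriv u (x - t) * (-1)) t :=
      (hd (x - t)).comp t ((hasDerivAt_id t).const_sub x)
    have e2 : HasDerivAt (fun t => u (x + t)) (deriv u (x + t) * 1) t :=
      (hd (x + t)).comp t ((hasDerivAt_id t).const_add x)
    exact (e1.add e2).neg.congr_deriv (by ring)
  · have := hi.integrableOn (s := Set.Ioi 1)
    simpa only [div_eq_inv_mul, Pi.mul_def] using this
  · refine Tendsto.mono_left ?_ nhdsWithin_le_nhds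
    have : ContinuousAt (fun t : ℝ => t⁻¹ * (-(u (x - t) + u (x + t)))) 1 :=
      ContinuousAt.mul (continuousAt_inv₀ one_ne_zero) (by fun_prop)
    simpa [ContinuousAt, Pi.mul_def] using this
  · refine tendsto_const_nhds.congr' ?_
    filter_upwards [eventually_atTop_zero hc x] with t ht
    simp [ht.1, ht.2]

end HilbertTransform

/-! ### The inversion `x ↦ -β / x` -/

section Inversion

variable {β : ℝ} {E : Type*} [NormedAddCommGroup E] [NormedSpace ℝ E]

lemma inversion_image (hβ : 0 < β) : (fun x : ℝ => -β / x) '' {0}ᶜ = {0}ᶜ := by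
  ext y
  simp only [Set.mem_image, Set.mem_compl_iff, Set.mem_singleton_iff]
  constructor
  · rintro ⟨x, hx, rfl⟩
    exact div_ne_zero (neg_ne_zero.2 hβ.ne') hx
  · intro hy
    refine ⟨-β / y, div_ne_zero (neg_ne_zero.2 hβ.ne') hy, ?_⟩
    have := hβ.ne'
    field_simp

lemma inversion_injOn (hβ : 0 < β) : Set.InjOn (fun x : ℝ => -β / x) {0}ᶜ := by
  intro x hx y hy h
  have h' : -β / x = -β / y := h
  rw [div_eq_div_iff hx hy] at h'
  exact (mul_left_cancel₀ (neg_ne_zero.2 hβ.ne') h').symm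

lemma inversion_hasDerivAt (β : ℝ) {x : ℝ} (hx : x ≠ 0) :
    HasDerivAt (fun x : ℝ => -β / x) (β / x ^ 2) x := by
  simp only [div_eq_mul_inv (-β)]
  exact ((hasDerivAt_inv hx).const_mul (-β)).congr_deriv (by ring)

lemma restrict_compl_singleton_zero : (volume : Measure ℝ).restrict {0}ᶜ = volume :=
  Measure.restrict_eq_self_of_ae_mem (compl_mem_ae_iff.2 (measure_singleton 0))

/-- The weight β / x² is the Jacobian of x ↦ -β / x, a bijection of the punctured line. -/
lemma integral_inversion (hβ : 0 < β) (F : ℝ → E) :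
    ∫ x : ℝ, (β / x ^ 2) • F (-β / x) = ∫ y, F y := by
  have h := integral_image_eq_integral_abs_deriv_smul (s := ({0}ᶜ : Set ℝ))
    (measurableSet_singleton _).compl
    (fun x hx => (inversion_hasDerivAt β (x := x) hx).hasDerivWithinAt) (inversion_injOn hβ) F
  rw [inversion_image hβ, restrict_compl_singleton_zero] at h
  rw [h]
  congr 1
  ext x
  rw [abs_of_nonneg (by positivity)]

lemma integrable_inversion_iff (hβ : 0 < β) (F : ℝ → E) :
    Integrable (fun x : ℝ => (β / x ^ 2) • F (-β / x)) ↔ Integrable F := by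
  have h := integrableOn_image_iff_integrableOn_abs_deriv_smul (s := ({0}ᶜ : Set ℝ))
    (measurableSet_singleton _).compl
    (fun x hx => (inversion_hasDerivAt β (x := x) hx).hasDerivWithinAt) (inversion_injOn hβ) F
  rw [inversion_image hβ] at h
  simp only [IntegrableOn, restrict_compl_singleton_zero] at h
  rw [h]
  have : (fun x : ℝ => |β / x ^ 2| • F (-β / x)) = fun x => (β / x ^ 2) • F (-β / x) := by
    ext x
    rw [abs_of_nonneg (by positivity)]
  rw [this]

lemma invol_eq_smul (β : ℝ) (f : ℝ → ℂ) : invol β f = fun x => (β / x ^ 2) • f (-β / x) := by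
  ext x
  rw [invol, Complex.real_smul]

lemma integrable_invol (hβ : 0 < β) {f : ℝ → ℂ} (hf : Integrable f) : Integrable (invol β f) := by
  rw [invol_eq_smul]
  exact (integrable_inversion_iff hβ f).2 hf

lemma integral_invol (hβ : 0 < β) (f : ℝ → ℂ) : ∫ x, invol β f x = ∫ x, f x := by
  rw [invol_eq_smul]
  exact integral_inversion hβ f

lemma integral_norm_invol (hβ : 0 < β) (f : ℝ → ℂ) : ∫ x, ‖invol β f x‖ = ∫ x, ‖f x‖ := by
  rw [← integral_inversion hβ fun x => ‖f x‖, invol_eq_smul]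
  congr 1
  ext x
  rw [norm_smul, Real.norm_of_nonneg (by positivity), smul_eq_mul]

lemma invol_invol (hβ : 0 < β) (f : ℝ → ℂ) {x : ℝ} (hx : x ≠ 0) :
    invol β (invol β f) x = f x := by
  have := hβ.ne'
  unfold invol
  have e : -β / (-β / x) = x := by field_simp
  rw [e, ← mul_assoc, ← Complex.ofReal_mul]
  have e' : β / x ^ 2 * (β / (-β / x) ^ 2) = 1 := by field_simp
  rw [e', Complex.ofReal_one, one_mul]

/-- The transpose of J_β is composition with the inversion. This moves J_β from functions in L¹ to
test functions and back. -/
lemma integral_mul_invol (hβ : 0 < β) (χ : ℝ → ℝ) (f : ℝ → ℂ) :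
    ∫ y, (χ y : ℂ) * invol β f y = ∫ x, (χ (-β / x) : ℂ) * f x := by
  rw [← integral_inversion hβ fun y => (χ y : ℂ) * invol β f y]
  refine integral_congr_ae ?_
  filter_upwards [compl_mem_ae_iff.2 (measure_singleton (0 : ℝ))] with x hx
  rw [Complex.real_smul]
  have := invol_invol hβ f hx
  rw [invol] at this
  rw [← this]
  ring

variable {θ : ℝ → ℝ}

/-- Near x = 0 the argument -β / x is large, where θ vanishes, so the composite is locally zero
there. The condition θ 0 = 0 covers the point itself, since -β / 0 = 0 by convention. -/
lemma contDiff_inversion {n : WithTop ℕ∞} (hβ : 0 < β) (hθ : ContDiff ℝ n θ) {R : ℝ} (hR : 0 < R)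
    (hz : ∀ y, R < |y| → θ y = 0) (h0 : θ 0 = 0) : ContDiff ℝ n fun x => θ (-β / x) := by
  rw [contDiff_iff_contDiffAt]
  intro x
  rcases eq_or_ne x 0 with rfl | hx
  · have : (fun x => θ (-β / x)) =ᶠ[𝓝 0] fun _ => 0 := by
      filter_upwards [Metric.ball_mem_nhds (0 : ℝ) (div_pos hβ hR)] with x hx
      rcases eq_or_ne x 0 with rfl | hx0
      · simpa using h0
      · apply hz
        rw [Metric.mem_ball, dist_zero_right, Real.norm_eq_abs, lt_div_iff₀ hR] at hx
        rw [abs_div, abs_neg, abs_of_pos hβ, lt_div_iff₀ (abs_pos.2 hx0)]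
        linarith
    exact contDiffAt_const.congr_of_eventuallyEq this
  · exact hθ.contDiffAt.comp x (contDiffAt_const.div contDiffAt_id hx)

/-- Covariance of the Hilbert transform under the inversion `x ↦ -β / x`. -/
lemma hilbert_inversion (hβ : 0 < β) (hθ : ContDiff ℝ 1 θ) (hc : HasCompactSupport θ)
    (hψ : ContDiff ℝ 1 fun x => θ (-β / x)) (hψc : HasCompactSupport fun x => θ (-β / x))
    {x : ℝ} (hx : x ≠ 0) :
    hilbert (fun x => θ (-β / x)) x = hilbert θ (-β / x) - hilbert θ 0 := by
  have hβ' := hβ.ne'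
  set y := -β / x with hy
  have hy0 : y ≠ 0 := div_ne_zero (neg_ne_zero.2 hβ') hx
  have hcont : Continuous (deriv θ) := hθ.continuous_deriv (by simp)
  have hi := hcont.integrable_of_hasCompactSupport hc.deriv (μ := volume)
  have hint0 : ∫ s, deriv θ s = 0 :=
    integral_eq_zero_of_hasDerivAt_of_integrable
      (fun s => (hθ.differentiable (by simp) s).hasDerivAt) hi
      (hθ.continuous.integrable_of_hasCompactSupport hc)
  -- The substitution t = -β / s in the logarithmic potential: the chain rule factor is the
  -- Jacobian.
  have h1 : ∫ t, deriv (fun x => θ (-β / x)) t * Real.log (x - t) =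
      ∫ s, deriv θ s * Real.log (x + β / s) := by
    rw [← integral_inversion hβ fun s => deriv θ s * Real.log (x + β / s)]
    refine integral_congr_ae ?_
    filter_upwards [compl_mem_ae_iff.2 (measure_singleton (0 : ℝ))] with t ht
    have hd : HasDerivAt (fun x => θ (-β / x)) (deriv θ (-β / t) * (β / t ^ 2)) t :=
      ((hθ.differentiable (by simp) _).hasDerivAt).comp t (inversion_hasDerivAt β ht)
    have ht' : t ≠ 0 := ht
    rw [hd.deriv, show β / (-β / t) = -t by field_simp, ← sub_eq_add_neg, smul_eq_mul]
    ring
  have h2 : ∫ s, deriv θ s * Real.log (x + β / s) =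
      ∫ s, (deriv θ s * Real.log (β / y) + deriv θ s * Real.log (y - s) -
        deriv θ s * Real.log (0 - s)) := by
    refine integral_congr_ae ?_
    filter_upwards [compl_mem_ae_iff.2 (measure_singleton (0 : ℝ)),
      compl_mem_ae_iff.2 (measure_singleton y)] with s hs hsy
    have hs0 : s ≠ 0 := hs
    have hsy' : y - s ≠ 0 := sub_ne_zero.2 (Ne.symm hsy)
    have hxy : x = -β / y := by
      rw [hy]
      field_simp
    -- This factorization turns the kernel into log |β/y| + log |y - s| - log |s|. The first term
    -- integrates to zero against θ', and the last produces the constant Hθ(0).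
    have e : x + β / s = β / y * (y - s) / s := by
      rw [hxy]
      field_simp
      ring
    rw [e, Real.log_div (mul_ne_zero (div_ne_zero hβ' hy0) hsy') hs0,
      Real.log_mul (div_ne_zero hβ' hy0) hsy', zero_sub, Real.log_neg_eq_log]
    ring
  have i1 := integrable_mul_log_sub hcont hc.deriv y
  have i2 := integrable_mul_log_sub hcont hc.deriv 0
  have i0 : Integrable fun s => deriv θ s * Real.log (β / y) := hi.mul_const _
  have i01 : Integrable fun s => deriv θ s * Real.log (β / y) + deriv θ s * Real.log (y - s) :=
    i0.add i1
  rw [hilbert_eq_integral_log hψ hψc, h1, h2, integral_sub i01 i2, integral_add i0 i1,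
    integral_mul_const, hint0, zero_mul, zero_add, hilbert_eq_integral_log hθ hc,
    hilbert_eq_integral_log hθ hc, mul_sub]

end Inversion

/-! ### The modified Hilbert transform -/

section ModHilbert

/-- The kernel of the modified Hilbert transform. -/
def modKernel (y t : ℝ) : ℝ := 1 / (y - t) + t / (1 + t ^ 2)

lemma one_add_sq_pos (t : ℝ) : 0 < 1 + t ^ 2 := by positivity

lemma modKernel_eq {y t : ℝ} (h : y - t ≠ 0) :
    modKernel y t = (1 + t * y) / (y - t) * (1 + t ^ 2)⁻¹ := by
  have := (one_add_sq_pos t).ne'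
  unfold modKernel
  field_simp
  ring

/-- The correction t / (1 + t²) cancels the leading term of 1 / (y - t) at infinity, leaving an
integrable kernel. -/
lemma norm_modKernel_le {y t r : ℝ} (hr : 0 < r) (h : r ≤ |y - t|) :
    ‖modKernel y t‖ ≤ ((1 + y ^ 2) / r + |y|) * (1 + t ^ 2)⁻¹ := by
  have hpos : 0 < |y - t| := hr.trans_le h
  rw [modKernel_eq (abs_pos.1 hpos), norm_mul, norm_inv,
    Real.norm_of_nonneg (one_add_sq_pos t).le]
  refine mul_le_mul_of_nonneg_right ?_ (by positivity)
  rw [Real.norm_eq_abs, abs_div, div_le_iff₀ hpos]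
  have h1 : |1 + t * y| ≤ (1 + y ^ 2) + |y| * |y - t| := by
    have : 1 + t * y = (1 + y ^ 2) - y * (y - t) := by ring
    rw [this]
    refine (abs_sub _ _).trans ?_
    rw [abs_mul, abs_of_pos (one_add_sq_pos y)]
  have h2 : (1 + y ^ 2) ≤ (1 + y ^ 2) / r * |y - t| := by
    rw [div_mul_eq_mul_div, le_div_iff₀ hr]
    have := (one_add_sq_pos y).le
    gcongr
  linarith

lemma measurable_modKernel : Measurable (Function.uncurry modKernel) := by
  unfold Function.uncurry modKernel
  fun_prop

lemma measurable_modKernel_right (y : ℝ) : Measurable (modKernel y) := by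
  unfold modKernel
  fun_prop

variable {q θ : ℝ → ℝ}

lemma integrable_mul_modKernel {C : ℝ} (hq : Continuous q) (hC : ∀ t, ‖q t‖ ≤ C) {y r : ℝ}
    (hr : 0 < r) (hz : ∀ t, |y - t| < r → q t = 0) : Integrable fun t => q t * modKernel y t := by
  have hC0 : 0 ≤ C := (norm_nonneg _).trans (hC 0)
  refine Integrable.mono' (integrable_inv_one_add_sq.const_mul (C * ((1 + y ^ 2) / r + |y|)))
    (hq.measurable.mul (measurable_modKernel_right y)).aestronglyMeasurable
    (Eventually.of_forall fun t => ?_)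
  rcases lt_or_ge |y - t| r with h | h
  · rw [hz t h, zero_mul, norm_zero]
    positivity
  · rw [norm_mul, mul_assoc]
    exact mul_le_mul (hC t) (norm_modKernel_le hr h) (norm_nonneg _) hC0

/-- The constant `∫ θ(t) t / (1 + t²) dt` by which the two Hilbert transforms of a compactly
supported function differ, up to the factor `1 / π`. -/
def modConst (θ : ℝ → ℝ) : ℝ := ∫ t, θ t * (t / (1 + t ^ 2))

lemma continuous_div_one_add_sq : Continuous fun t : ℝ => t / (1 + t ^ 2) :=
  continuous_id.div (by fun_prop) fun t => (one_add_sq_pos t).ne'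

lemma integrable_modConst (hθ : Continuous θ) (hc : HasCompactSupport θ) :
    Integrable fun t => θ t * (t / (1 + t ^ 2)) :=
  (hθ.mul continuous_div_one_add_sq).integrable_of_hasCompactSupport hc.mul_right

/-- The modified Hilbert transform at `y` of a bounded function `q` which coincides near `y` with a
compactly supported function `θ`. -/
lemma modHilbert_eq {C : ℝ} (hq : Continuous q) (hC : ∀ t, ‖q t‖ ≤ C)
    (hθ : ContDiff ℝ 1 θ) (hc : HasCompactSupport θ) {y r : ℝ} (hr : 0 < r)
    (hz : ∀ t, |y - t| < r → q t = θ t) :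
    modHilbert q y = hilbert θ y + (1 / Real.pi) * modConst θ +
      (1 / Real.pi) * ∫ t, (q t - θ t) * modKernel y t := by
  obtain ⟨B, hB⟩ := hc.exists_bound_of_continuous hθ.continuous
  have hm (ε : ℝ) : MeasurableSet {t : ℝ | ε < |y - t|} :=
    measurableSet_lt measurable_const (by fun_prop)
  have hfar : Integrable fun t => (q t - θ t) * modKernel y t :=
    integrable_mul_modKernel (C := C + B) (hq.sub hθ.continuous)
      (fun t => (norm_sub_le _ _).trans (add_le_add (hC t) (hB t))) hr
      fun t ht => sub_eq_zero.2 (hz t ht)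
  have hθi := hθ.continuous.integrable_of_hasCompactSupport hc (μ := volume)
  have hci := integrable_modConst hθ.continuous hc
  have hnear {ε : ℝ} (hε : 0 < ε) :
      IntegrableOn (fun t => θ t / (y - t)) {t : ℝ | ε < |y - t|} := by
    rw [← integrable_indicator_iff (hm ε)]
    refine ((integrable_indicator_div hθi y hε).comp_sub_left y).congr
      (Eventually.of_forall fun t => ?_)
    simp only [Set.indicator_apply, Set.mem_ofPred_eq, sub_sub_cancel]
  have hlim2 : Tendsto (fun ε : ℝ => ∫ t in {t : ℝ | ε < |y - t|}, θ t * (t / (1 + t ^ 2)))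
      (𝓝[>] 0) (𝓝 (modConst θ)) := by
    simp_rw [← integral_indicator (hm _)]
    refine tendsto_integral_filter_of_dominated_convergence _ ?_ ?_ hci.norm ?_
    · exact Eventually.of_forall fun ε => hci.aestronglyMeasurable.indicator (hm ε)
    · exact Eventually.of_forall fun ε => Eventually.of_forall fun s =>
        norm_indicator_le_norm_self _ _
    · filter_upwards [compl_mem_ae_iff.2 (measure_singleton y)] with s hs
      refine tendsto_const_nhds.congr' ?_
      have hs' : 0 < |y - s| := abs_pos.2 (sub_ne_zero.2 (Ne.symm hs))
      filter_upwards [nhdsWithin_le_nhds (Iio_mem_nhds hs')] with ε hε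
      rw [Set.indicator_of_mem (show s ∈ {t : ℝ | ε < |y - t|} from hε)]
  -- For ε < r the truncation does not touch q - θ, which vanishes within distance r of y. Only the
  -- part from θ is a genuine principal value.
  have hmain : Tendsto (fun ε : ℝ => (1 / Real.pi) * ∫ t in {t : ℝ | ε < |y - t|},
      q t * (1 / (y - t) + t / (1 + t ^ 2))) (𝓝[>] 0)
      (𝓝 ((1 / Real.pi) * (Real.pi * hilbert θ y + modConst θ +
        ∫ t, (q t - θ t) * modKernel y t))) := by
    refine Tendsto.const_mul _ ((((tendsto_truncated_hilbert hθ hc y).add hlim2).add_const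
      (∫ t, (q t - θ t) * modKernel y t)).congr' ?_)
    filter_upwards [self_mem_nhdsWithin, nhdsWithin_le_nhds (Iio_mem_nhds hr)] with ε hε hεr
    have hε0 : 0 < ε := hε
    have hεr' : ε < r := hεr
    have hsum : IntegrableOn (fun t => θ t / (y - t) + θ t * (t / (1 + t ^ 2)))
        {t : ℝ | ε < |y - t|} := (hnear hε0).add hci.integrableOn
    rw [← setIntegral_eq_integral_of_forall_compl_eq_zero (s := {t : ℝ | ε < |y - t|})
        (f := fun t => (q t - θ t) * modKernel y t) fun t ht => ?_,
      ← integral_add (hnear hε0) hci.integrableOn,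
      ← integral_add hsum hfar.integrableOn]
    · congr 1
      ext t
      unfold modKernel
      ring
    · rw [Set.mem_ofPred_eq, not_lt] at ht
      rw [hz t (by linarith), sub_self, zero_mul]
  have := hmain.limUnder_eq
  unfold modHilbert
  rw [this]
  field_simp

lemma modHilbert_eq_hilbert_add (hθ : ContDiff ℝ 1 θ) (hc : HasCompactSupport θ) (y : ℝ) :
    modHilbert θ y = hilbert θ y + (1 / Real.pi) * modConst θ := by
  obtain ⟨B, hB⟩ := hc.exists_bound_of_continuous hθ.continuous
  rw [modHilbert_eq hθ.continuous hB hθ hc one_pos fun t _ => rfl]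
  simp

end ModHilbert

/-! ### Periodization -/

section Periodization

variable {φ : ℝ → ℝ} {ρ : ℝ}

/-- Distinct points x + 2j are at least 2 apart, so if one lies within 2 - ρ of the origin, all the
others lie beyond ρ. -/
lemma periodize_summand_zero (hz : ∀ x, ρ < |x| → φ x = 0) {x : ℝ} {j k : ℤ}
    (h : |x + 2 * k| < 2 - ρ) (hj : j ≠ k) : φ (x + 2 * j) = 0 := by
  apply hz
  have h1 : (1 : ℝ) ≤ |(j : ℝ) - k| := by
    have : (1 : ℤ) ≤ |j - k| := Int.one_le_abs (sub_ne_zero.2 hj)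
    exact_mod_cast this
  have h2 : x + 2 * j = 2 * ((j : ℝ) - k) + (x + 2 * k) := by ring
  have h3 := abs_sub_abs_le_abs_sub (2 * ((j : ℝ) - k)) (-(x + 2 * k))
  rw [sub_neg_eq_add, ← h2, abs_neg, abs_mul, abs_two] at h3
  linarith

lemma periodize_eq (hz : ∀ x, ρ < |x| → φ x = 0) {x : ℝ} {k : ℤ} (h : |x + 2 * k| < 2 - ρ) :
    periodize φ x = φ (x + 2 * k) :=
  tsum_eq_single k fun _ hj => periodize_summand_zero hz h hj

lemma exists_int_abs_add_le (x : ℝ) : ∃ k : ℤ, |x + 2 * k| ≤ 1 := by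
  refine ⟨-round (x / 2), ?_⟩
  have h := abs_sub_round (x / 2)
  rw [abs_le] at h ⊢
  push_cast
  constructor <;> linarith [h.1, h.2]

lemma periodize_eq_self (hρ : ρ < 1) (hz : ∀ x, ρ < |x| → φ x = 0) {x : ℝ} (hx : |x| ≤ 1) :
    periodize φ x = φ x := by
  have := periodize_eq hz (x := x) (k := 0) (by simp; linarith)
  simpa using this

lemma periodize_periodic (φ : ℝ → ℝ) : Function.Periodic (periodize φ) 2 := by
  intro x
  unfold periodize
  rw [← (Equiv.addRight (1 : ℤ)).tsum_eq fun j : ℤ => φ (x + 2 * j)]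
  congr 1
  ext j
  congr 1
  push_cast [Equiv.coe_addRight]
  ring

lemma periodize_eventuallyEq (hz : ∀ x, ρ < |x| → φ x = 0) {x : ℝ} {k : ℤ}
    (h : |x + 2 * k| < 2 - ρ) : periodize φ =ᶠ[𝓝 x] fun t => φ (t + 2 * k) := by
  have hc : ContinuousAt (fun t : ℝ => |t + 2 * k|) x := by fun_prop
  filter_upwards [hc.eventually (Iio_mem_nhds h)] with t ht
  exact periodize_eq hz ht

lemma periodize_contDiff {n : WithTop ℕ∞} (hφ : ContDiff ℝ n φ) (hρ : ρ < 1)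
    (hz : ∀ x, ρ < |x| → φ x = 0) : ContDiff ℝ n (periodize φ) := by
  rw [contDiff_iff_contDiffAt]
  intro x
  obtain ⟨k, hk⟩ := exists_int_abs_add_le x
  refine ContDiffAt.congr_of_eventuallyEq ?_
    (periodize_eventuallyEq hz (k := k) (by linarith))
  exact (hφ.comp (contDiff_id.add contDiff_const)).contDiffAt

lemma norm_periodize_le (hρ : ρ < 1) (hz : ∀ x, ρ < |x| → φ x = 0) {C : ℝ}
    (hC : ∀ x, ‖φ x‖ ≤ C) (x : ℝ) : ‖periodize φ x‖ ≤ C := by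
  obtain ⟨k, hk⟩ := exists_int_abs_add_le x
  rw [periodize_eq hz (k := k) (by linarith)]
  exact hC _

lemma periodize_nonneg (h : ∀ x, 0 ≤ φ x) (x : ℝ) : 0 ≤ periodize φ x :=
  tsum_nonneg fun _ => h _

lemma summable_periodize (hρ : ρ < 1) (hz : ∀ x, ρ < |x| → φ x = 0) (x : ℝ) :
    Summable fun j : ℤ => φ (x + 2 * j) := by
  obtain ⟨k, hk⟩ := exists_int_abs_add_le x
  refine summable_of_ne_finset_zero (s := {k}) fun j hj => ?_
  exact periodize_summand_zero hz (k := k) (by linarith) (by simpa using hj)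

/-- The partial periodization over `|j| ≤ n`. -/
def partialPeriodize (n : ℕ) (φ : ℝ → ℝ) (x : ℝ) : ℝ :=
  ∑ j ∈ Finset.Icc (-n : ℤ) n, φ (x + 2 * j)

/-- Together with `partialPeriodize_eq_zero`: as the translates of φ stay away from odd integers,
the partial sum is Πφ cut off sharply at 2n + 1, yet it is as smooth as φ. -/
lemma partialPeriodize_eq_periodize (hρ : ρ < 1) (hz : ∀ x, ρ < |x| → φ x = 0) {n : ℕ} {x : ℝ}
    (hx : |x| < 2 * n + 1) : partialPeriodize n φ x = periodize φ x := by
  refine (tsum_eq_sum fun j hj => ?_).symm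
  apply hz
  have hj' : (n : ℤ) + 1 ≤ |j| := by
    rw [Finset.mem_Icc, ← abs_le, not_le] at hj
    exact hj
  have hj'' : (n : ℝ) + 1 ≤ |(j : ℝ)| := by exact_mod_cast hj'
  have h3 := abs_sub_abs_le_abs_sub (2 * (j : ℝ)) (-x)
  rw [sub_neg_eq_add, abs_neg, abs_mul, abs_two, add_comm _ x] at h3
  linarith

lemma partialPeriodize_eq_zero (hρ : ρ < 1) (hz : ∀ x, ρ < |x| → φ x = 0) {n : ℕ} {x : ℝ}
    (hx : 2 * n + 1 ≤ |x|) : partialPeriodize n φ x = 0 := by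
  refine Finset.sum_eq_zero fun j hj => ?_
  apply hz
  rw [Finset.mem_Icc, ← abs_le] at hj
  have hj' : |(j : ℝ)| ≤ n := by exact_mod_cast hj
  have h3 := abs_sub_abs_le_abs_sub x (-(2 * (j : ℝ)))
  rw [sub_neg_eq_add, abs_neg, abs_mul, abs_two] at h3
  linarith

lemma hasCompactSupport_of_zero {θ : ℝ → ℝ} {R : ℝ} (hz : ∀ x, R < |x| → θ x = 0) :
    HasCompactSupport θ := by
  refine HasCompactSupport.intro (isCompact_closedBall (0 : ℝ) R) fun x hx => hz x ?_
  rwa [Metric.mem_closedBall, dist_zero_right, Real.norm_eq_abs, not_le] at hx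

lemma contDiff_comp_add {n : WithTop ℕ∞} (hφ : ContDiff ℝ n φ) (a : ℝ) :
    ContDiff ℝ n fun t => φ (t + a) :=
  hφ.comp (contDiff_id.add contDiff_const)

lemma hasCompactSupport_comp_add (hc : HasCompactSupport φ) (a : ℝ) :
    HasCompactSupport fun t => φ (t + a) :=
  hc.comp_homeomorph (Homeomorph.addRight a)

lemma partialPeriodize_contDiff {m : WithTop ℕ∞} (hφ : ContDiff ℝ m φ) (n : ℕ) :
    ContDiff ℝ m (partialPeriodize n φ) :=
  ContDiff.sum fun _ _ => contDiff_comp_add hφ _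

lemma hilbert_partialPeriodize (hφ : ContDiff ℝ 1 φ) (hc : HasCompactSupport φ) (n : ℕ) (y : ℝ) :
    hilbert (partialPeriodize n φ) y = ∑ j ∈ Finset.Icc (-n : ℤ) n, hilbert φ (y + 2 * j) := by
  unfold partialPeriodize
  rw [hilbert_sum _ (fun _ => contDiff_comp_add hφ _) fun _ => hasCompactSupport_comp_add hc _]
  exact Finset.sum_congr rfl fun j _ => hilbert_comp_add _ _ _

/-- The partial periodization serves as the compactly supported comparison function in
`modHilbert_eq`; its Hilbert transform is a finite sum of translates of Hφ. -/
lemma modHilbert_periodize_eq (hφ : ContDiff ℝ 1 φ) (hρ : ρ < 1) (hz : ∀ x, ρ < |x| → φ x = 0)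
    {n : ℕ} {y : ℝ} (hy : |y| < 2 * n + 1) :
    modHilbert (periodize φ) y = ∑ j ∈ Finset.Icc (-n : ℤ) n, hilbert φ (y + 2 * j) +
      (1 / Real.pi) * modConst (partialPeriodize n φ) +
      (1 / Real.pi) * ∫ t, (periodize φ t - partialPeriodize n φ t) * modKernel y t := by
  have hc := hasCompactSupport_of_zero hz
  obtain ⟨C, hC⟩ := hc.exists_bound_of_continuous hφ.continuous
  rw [modHilbert_eq (periodize_contDiff hφ hρ hz).continuous (norm_periodize_le hρ hz hC)
    (partialPeriodize_contDiff hφ n)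
    (hasCompactSupport_of_zero (R := 2 * n + 1) fun x hx => partialPeriodize_eq_zero hρ hz hx.le)
    (r := 2 * n + 1 - |y|) (by linarith), hilbert_partialPeriodize hφ hc]
  intro t ht
  refine (partialPeriodize_eq_periodize hρ hz ?_).symm
  have := abs_sub_abs_le_abs_sub t y
  rw [abs_sub_comm] at this
  linarith

end Periodization

/-! ### Tapering a periodic function -/

section Taper

variable {q : ℝ → ℝ}

lemma Periodic.exists_bound (hq : Continuous q) (hp : Function.Periodic q 2) :
    ∃ C, ∀ x, ‖q x‖ ≤ C := by
  obtain ⟨C, hC⟩ := (hp.isBounded_of_continuous two_ne_zero hq).exists_norm_le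
  exact ⟨C, fun x => hC _ (Set.mem_range_self x)⟩

lemma Periodic.deriv (hp : Function.Periodic q 2) : Function.Periodic (deriv q) 2 := by
  intro x
  have h : (fun t => q (t + 2)) = q := funext hp
  have := deriv_comp_add_const q 2 x
  rw [h] at this
  exact this.symm

/-- A continuous periodic function is a constant plus the derivative of a bounded function. -/
lemma exists_bounded_antideriv (hq : Continuous q) (hp : Function.Periodic q 2) :
    ∃ (μ : ℝ) (Λ : ℝ → ℝ), (∀ x, HasDerivAt Λ (q x - μ) x) ∧ ∃ C, ∀ x, ‖Λ x‖ ≤ C := by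
  -- Subtracting the mean over a period makes the primitive periodic, hence bounded.
  set μ := (∫ x in (0 : ℝ)..0 + 2, q x) / 2 with hμ
  have hc : Continuous fun x => q x - μ := hq.sub continuous_const
  have hi (a b : ℝ) : IntervalIntegrable (fun x => q x - μ) volume a b := hc.intervalIntegrable a b
  have hd : ∀ x, HasDerivAt (fun x => ∫ t in (0 : ℝ)..x, (q t - μ)) (q x - μ) x := fun x =>
    intervalIntegral.integral_hasDerivAt_right (hi 0 x)
      (hc.stronglyMeasurableAtFilter _ _) hc.continuousAt
  refine ⟨μ, fun x => ∫ t in (0 : ℝ)..x, (q t - μ), hd, Periodic.exists_bound ?_ ?_⟩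
  · exact continuous_iff_continuousAt.2 fun x => (hd x).continuousAt
  · intro x
    beta_reduce
    rw [← intervalIntegral.integral_add_adjacent_intervals (hi 0 x) (hi x (x + 2)),
      intervalIntegral.integral_sub (a := x) (b := x + 2) (hq.intervalIntegrable _ _) (by simp),
      hp.intervalIntegral_add_eq x 0, intervalIntegral.integral_const, hμ, smul_eq_mul]
    ring

/-- A smooth cutoff function, equal to `1` on `[-1, 1]` and to `0` off `[-2, 2]`. -/
def cutoff : ContDiffBump (0 : ℝ) := ⟨1, 2, one_pos, one_lt_two⟩

lemma cutoff_one {t : ℝ} (ht : |t| ≤ 1) : cutoff t = 1 :=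
  cutoff.one_of_mem_closedBall (by simpa [cutoff] using ht)

lemma cutoff_zero {t : ℝ} (ht : 2 ≤ |t|) : cutoff t = 0 :=
  cutoff.zero_of_le_dist (by simpa [cutoff] using ht)

/-- The function `q` cut off smoothly at distance `R` from the origin. -/
def taper (R : ℝ) (q : ℝ → ℝ) (t : ℝ) : ℝ := cutoff (t / R) * q t

lemma taper_eq_self {R : ℝ} (hR : 0 < R) (q : ℝ → ℝ) {t : ℝ} (ht : |t| ≤ R) :
    taper R q t = q t := by
  rw [taper, cutoff_one, one_mul]
  rwa [abs_div, abs_of_pos hR, div_le_one hR]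

lemma taper_eq_zero {R : ℝ} (hR : 0 < R) (q : ℝ → ℝ) {t : ℝ} (ht : 2 * R ≤ |t|) :
    taper R q t = 0 := by
  rw [taper, cutoff_zero, zero_mul]
  rwa [abs_div, abs_of_pos hR, le_div_iff₀ hR]

lemma contDiff_cutoff_div {n : ℕ∞} (R : ℝ) : ContDiff ℝ n fun t => cutoff (t / R) :=
  cutoff.contDiff.comp (contDiff_id.div_const R)

lemma taper_contDiff {n : ℕ∞} (R : ℝ) (hq : ContDiff ℝ n q) : ContDiff ℝ n (taper R q) :=
  (contDiff_cutoff_div R).mul hq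

lemma taper_hasCompactSupport {R : ℝ} (hR : 0 < R) (q : ℝ → ℝ) : HasCompactSupport (taper R q) :=
  hasCompactSupport_of_zero fun _ hx => taper_eq_zero hR q hx.le

lemma norm_taper_le (R : ℝ) (q : ℝ → ℝ) (t : ℝ) : ‖taper R q t‖ ≤ ‖q t‖ := by
  rw [taper, norm_mul, Real.norm_of_nonneg cutoff.nonneg]
  exact mul_le_of_le_one_left (norm_nonneg _) cutoff.le_one

lemma hasDerivAt_scaled_mul {Λ Λ' : ℝ → ℝ} (hΛ : ∀ x, HasDerivAt Λ (Λ' x) x) {w : ℝ → ℝ}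
    (hw : Differentiable ℝ w) (R t : ℝ) :
    HasDerivAt (fun t => w (t / R) * Λ t) (R⁻¹ * (deriv w (t / R) * Λ t) + w (t / R) * Λ' t) t := by
  have h1 : HasDerivAt (fun t => w (t / R)) (deriv w (t / R) * (1 / R)) t :=
    (hw _).hasDerivAt.comp t ((hasDerivAt_id t).div_const R)
  exact (h1.mul (hΛ t)).congr_deriv (by ring)

/-- The Hilbert transforms of the tapered functions are uniformly bounded. -/
lemma exists_hilbert_taper_bound (hq : ContDiff ℝ 1 q) (hp : Function.Periodic q 2) :
    ∃ C, ∀ R, 1 ≤ R → ∀ y, ‖hilbert (taper R q) y‖ ≤ C := by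
  obtain ⟨μ, Λ, hΛ, L, hL⟩ := exists_bounded_antideriv hq.continuous hp
  obtain ⟨A, hA⟩ := Periodic.exists_bound hq.continuous hp
  obtain ⟨B, hB⟩ := Periodic.exists_bound (hq.continuous_deriv (by simp)) (Periodic.deriv hp)
  have hw : ContDiff ℝ 3 cutoff := cutoff.contDiff (n := 3)
  have hw1 : ContDiff ℝ 2 (deriv cutoff) :=
    ((contDiff_succ_iff_deriv (n := 2)).1 hw).2.2
  have hw2 : ContDiff ℝ 1 (deriv (deriv cutoff)) :=
    ((contDiff_succ_iff_deriv (n := 1)).1 hw1).2.2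
  obtain ⟨B₁, hB₁⟩ := cutoff.hasCompactSupport.deriv.exists_bound_of_continuous hw1.continuous
  obtain ⟨B₂, hB₂⟩ :=
    cutoff.hasCompactSupport.deriv.deriv.exists_bound_of_continuous hw2.continuous
  have hL0 := (norm_nonneg _).trans (hL 0)
  have hA0 := (norm_nonneg _).trans (hA 0)
  have hB0 := (norm_nonneg _).trans (hB 0)
  have hB₁0 := (norm_nonneg _).trans (hB₁ 0)
  have hB₂0 := (norm_nonneg _).trans (hB₂ 0)
  have hqd : ∀ x, HasDerivAt (fun x => q x - μ) (deriv q x) x := fun x =>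
    (hq.differentiable (by simp) x).hasDerivAt.sub_const μ
  have hΛ2 : ContDiff ℝ 2 Λ := by
    refine (contDiff_succ_iff_deriv (n := 1)).2 ⟨fun x => (hΛ x).differentiableAt, by simp, ?_⟩
    rw [funext fun x => (hΛ x).deriv]
    exact hq.sub contDiff_const
  have hqμ : ∀ x, ‖q x - μ‖ ≤ A + |μ| := fun x =>
    (norm_sub_le _ _).trans (add_le_add (hA x) le_rfl)
  have hw0 : ∀ x, ‖cutoff x‖ ≤ 1 := fun x => by
    rw [Real.norm_of_nonneg cutoff.nonneg]
    exact cutoff.le_one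
  -- With w_R(t) = w(t/R) the cutoff, w_R q = (w_R Λ)' + v, where v = w_R μ - w_R' Λ. The constant E
  -- bounds (w_R Λ)'' for R ≥ 1, and D / R bounds v'.
  set E := B₂ * L + 2 * (B₁ * (A + |μ|)) + B with hE
  set D := |μ| * B₁ + (B₂ * L + B₁ * (A + |μ|)) with hD
  refine ⟨2 * E + 4 * L + 16 * D, fun R hR y => ?_⟩
  have hR0 : 0 < R := one_pos.trans_le hR
  have hRi : R⁻¹ ≤ 1 := inv_le_one_of_one_le₀ hR
  have hRi0 : 0 ≤ R⁻¹ := by positivity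
  have hRn : ‖R⁻¹‖ = R⁻¹ := Real.norm_of_nonneg hRi0
  have hdu := hasDerivAt_scaled_mul hΛ (hw.differentiable (by simp)) R
  have hu : ContDiff ℝ 2 (taper R Λ) := taper_contDiff (n := 2) R hΛ2
  have hdu' : deriv (taper R Λ) = fun t =>
      R⁻¹ * (deriv cutoff (t / R) * Λ t) + cutoff (t / R) * (q t - μ) :=
    funext fun t => (hdu t).deriv
  have hddu := fun t => ((hasDerivAt_scaled_mul hΛ (hw1.differentiable (by simp)) R t).const_mul
    R⁻¹).add (hasDerivAt_scaled_mul hqd (hw.differentiable (by simp)) R t)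
  have hEb : ∀ t, ‖deriv (deriv (taper R Λ)) t‖ ≤ E := by
    intro t
    rw [hdu']
    have e := (hddu t).deriv
    simp only [Pi.add_def] at e
    rw [e]
    have t1 : ‖deriv (deriv cutoff) (t / R) * Λ t‖ ≤ B₂ * L := by
      rw [norm_mul]
      exact mul_le_mul (hB₂ _) (hL _) (norm_nonneg _) hB₂0
    have t2 : ‖deriv cutoff (t / R) * (q t - μ)‖ ≤ B₁ * (A + |μ|) := by
      rw [norm_mul]
      exact mul_le_mul (hB₁ _) (hqμ _) (norm_nonneg _) hB₁0
    have t3 : ‖cutoff (t / R) * deriv q t‖ ≤ B := by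
      rw [norm_mul]
      exact (mul_le_mul (hw0 _) (hB _) (norm_nonneg _) zero_le_one).trans_eq (one_mul _)
    have s1 (a : ℝ) : ‖R⁻¹ * a‖ ≤ ‖a‖ := by
      rw [norm_mul, hRn]
      exact mul_le_of_le_one_left (norm_nonneg _) hRi
    calc _ ≤ ‖R⁻¹ * (R⁻¹ * (deriv (deriv cutoff) (t / R) * Λ t) +
            deriv cutoff (t / R) * (q t - μ))‖ +
            ‖R⁻¹ * (deriv cutoff (t / R) * (q t - μ)) + cutoff (t / R) * deriv q t‖ :=
          norm_add_le _ _
      _ ≤ (B₂ * L + B₁ * (A + |μ|)) + (B₁ * (A + |μ|) + B) := by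
          refine add_le_add ((s1 _).trans ((norm_add_le _ _).trans (add_le_add
            ((s1 _).trans t1) t2))) ((norm_add_le _ _).trans (add_le_add ((s1 _).trans t2) t3))
      _ = E := by rw [hE]; ring
  have hLb : ∀ t, ‖taper R Λ t‖ ≤ L := fun t => (norm_taper_le R Λ t).trans (hL t)
  have h1 := hilbert_deriv_bound hu (taper_hasCompactSupport hR0 Λ) hLb hEb y
  -- the slowly varying remainder
  set v : ℝ → ℝ := fun t => cutoff (t / R) * μ - R⁻¹ * (deriv cutoff (t / R) * Λ t) with hv
  have hvc : ContDiff ℝ 1 v := by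
    refine ((contDiff_cutoff_div (n := 1) R).mul contDiff_const).sub (contDiff_const.mul
      (ContDiff.mul ?_ (hΛ2.of_le (by norm_num))))
    exact (hw1.of_le (by norm_num)).comp (contDiff_id.div_const R)
  have hvz : ∀ x ∉ Set.Icc (-(2 * R)) (2 * R), v x = 0 := by
    intro x hx
    rw [Set.mem_Icc, ← abs_le, not_le] at hx
    have hx' : 2 < |x / R| := by rwa [abs_div, abs_of_pos hR0, lt_div_iff₀ hR0]
    have hz : deriv cutoff (x / R) = 0 := by
      refine image_eq_zero_of_notMem_tsupport fun h => ?_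
      have := tsupport_deriv_subset (𝕜 := ℝ) h
      rw [cutoff.tsupport_eq, Metric.mem_closedBall, dist_zero_right, Real.norm_eq_abs] at this
      exact absurd hx' (not_lt.2 this)
    simp only [hv, cutoff_zero hx'.le, hz, zero_mul, mul_zero, sub_zero]
  have hvd : ∀ t, ‖deriv v t‖ ≤ R⁻¹ * D := by
    intro t
    have e := ((hasDerivAt_scaled_mul (fun x => hasDerivAt_const x μ)
      (hw.differentiable (by simp)) R t).sub
      ((hasDerivAt_scaled_mul hΛ (hw1.differentiable (by simp)) R t).const_mul R⁻¹)).deriv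
    simp only [Pi.sub_def] at e
    rw [hv, e, mul_zero, add_zero, ← mul_sub, norm_mul, hRn]
    refine mul_le_mul_of_nonneg_left ?_ hRi0
    have t1 : ‖deriv (deriv cutoff) (t / R) * Λ t‖ ≤ B₂ * L := by
      rw [norm_mul]
      exact mul_le_mul (hB₂ _) (hL _) (norm_nonneg _) hB₂0
    have t2 : ‖deriv cutoff (t / R) * (q t - μ)‖ ≤ B₁ * (A + |μ|) := by
      rw [norm_mul]
      exact mul_le_mul (hB₁ _) (hqμ _) (norm_nonneg _) hB₁0
    have t3 : ‖deriv cutoff (t / R) * μ‖ ≤ |μ| * B₁ := by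
      rw [norm_mul, mul_comm]
      exact mul_le_mul_of_nonneg_left (hB₁ _) (abs_nonneg _)
    have s1 (a : ℝ) : ‖R⁻¹ * a‖ ≤ ‖a‖ := by
      rw [norm_mul, hRn]
      exact mul_le_of_le_one_left (norm_nonneg _) hRi
    exact (norm_sub_le _ _).trans (add_le_add t3 ((norm_add_le _ _).trans
      (add_le_add ((s1 _).trans t1) t2)))
  -- The support of v has length 4R and its derivative is at most D / R, so the two powers of R
  -- cancel and leave 16 D.
  have h2 := hilbert_bound isCompact_Icc (hvc.differentiable (by simp)) hvz hvd y
  have hvol : volume.real (Set.Icc (-(2 * R)) (2 * R)) = 4 * R := by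
    rw [Real.volume_real_Icc_of_le (by linarith)]
    ring
  have hu1 : ContDiff ℝ 1 (deriv (taper R Λ)) := ((contDiff_succ_iff_deriv (n := 1)).1 hu).2.2
  have hvcs : HasCompactSupport v := HasCompactSupport.intro isCompact_Icc hvz
  have hsum : taper R q = fun t => deriv (taper R Λ) t + v t := by
    ext t
    rw [hdu', hv, taper]
    ring
  rw [hsum, hilbert_add hu1 (taper_hasCompactSupport hR0 Λ).deriv hvc hvcs]
  refine (norm_add_le _ _).trans (add_le_add h1 (h2.trans (le_of_eq ?_)))
  rw [hvol]
  field_simp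
  ring

/-- Up to a constant, the modified Hilbert transform of a periodic function is the limit of the
Hilbert transforms of its tapered versions. -/
lemma tendsto_hilbert_taper (hq : ContDiff ℝ 1 q) (hp : Function.Periodic q 2) (y : ℝ) :
    Tendsto (fun n : ℕ => hilbert (taper (n + 1) q) y - hilbert (taper (n + 1) q) 0) atTop
      (𝓝 (modHilbert q y - modHilbert q 0)) := by
  obtain ⟨A, hA⟩ := Periodic.exists_bound hq.continuous hp
  have hA0 := (norm_nonneg _).trans (hA 0)
  have hpos (n : ℕ) : (0 : ℝ) < n + 1 := by positivity
  have key (y : ℝ) (n : ℕ) (hn : |y| ≤ n) : modHilbert q y = hilbert (taper (n + 1) q) y +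
      (1 / Real.pi) * modConst (taper (n + 1) q) +
      (1 / Real.pi) * ∫ t, (q t - taper (n + 1) q t) * modKernel y t := by
    refine modHilbert_eq hq.continuous hA (taper_contDiff (n := 1) _ hq)
      (taper_hasCompactSupport (hpos n) q) one_pos fun t ht => ?_
    refine (taper_eq_self (hpos n) q ?_).symm
    have := abs_sub_abs_le_abs_sub t y
    rw [abs_sub_comm] at this
    linarith
  -- The taper changes q only beyond radius n + 1, and the modified kernel is integrable there, so
  -- the correction tends to zero.
  have hlim (y : ℝ) : Tendsto (fun n : ℕ => ∫ t, (q t - taper (n + 1) q t) * modKernel y t) atTop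
      (𝓝 0) := by
    rw [← integral_zero ℝ ℝ (μ := volume)]
    refine tendsto_integral_filter_of_dominated_convergence
      (fun t => 2 * A * (((1 + y ^ 2) / 1 + |y|) * (1 + t ^ 2)⁻¹)) ?_ ?_
      ((integrable_inv_one_add_sq.const_mul _).const_mul _) ?_
    · refine Eventually.of_forall fun n => ?_
      exact ((hq.continuous.sub (taper_contDiff (n := 1) _ hq).continuous).measurable.mul
        (measurable_modKernel_right y)).aestronglyMeasurable
    · filter_upwards [eventually_ge_atTop ⌈|y|⌉₊] with n hn
      refine Eventually.of_forall fun t => ?_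
      have hn' : |y| ≤ n := (Nat.le_ceil _).trans (by exact_mod_cast hn)
      rcases lt_or_ge |y - t| 1 with h | h
      · rw [taper_eq_self (hpos n) q, sub_self, zero_mul, norm_zero]
        · positivity
        · have := abs_sub_abs_le_abs_sub t y
          rw [abs_sub_comm] at this
          linarith
      · rw [norm_mul]
        refine mul_le_mul ?_ (norm_modKernel_le one_pos h) (norm_nonneg _) (by positivity)
        linarith [norm_sub_le (q t) (taper (n + 1) q t), norm_taper_le (n + 1) q t, hA t]
    · refine Eventually.of_forall fun t => ?_
      refine tendsto_const_nhds.congr' ?_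
      filter_upwards [eventually_ge_atTop ⌈|t|⌉₊] with n hn
      have hn' : |t| ≤ n := (Nat.le_ceil _).trans (by exact_mod_cast hn)
      rw [taper_eq_self (hpos n) q (by linarith), sub_self, zero_mul]
  have h := ((hlim 0).sub (hlim y)).const_mul (1 / Real.pi)
  rw [sub_zero, mul_zero] at h
  have h' := h.add_const (modHilbert q y - modHilbert q 0)
  rw [zero_add] at h'
  refine h'.congr' ?_
  filter_upwards [eventually_ge_atTop ⌈|y|⌉₊] with n hn
  have hn' : |y| ≤ n := (Nat.le_ceil _).trans (by exact_mod_cast hn)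
  -- The constants `modConst` do not depend on the point and may diverge with n; subtracting the
  -- value at 0 removes them.
  rw [key y n hn', key 0 n (by simp)]
  ring

/-- The uniform bound for the tapered transforms passes to the limit. -/
lemma exists_modHilbert_bound (hq : ContDiff ℝ 1 q) (hp : Function.Periodic q 2) :
    ∃ C, ∀ y, ‖modHilbert q y‖ ≤ C := by
  obtain ⟨C, hC⟩ := exists_hilbert_taper_bound hq hp
  refine ⟨2 * C + ‖modHilbert q 0‖, fun y => ?_⟩
  have h : ‖modHilbert q y - modHilbert q 0‖ ≤ 2 * C := by
    refine le_of_tendsto (tendsto_hilbert_taper hq hp y).norm (Eventually.of_forall fun n => ?_)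
    have hn : (1 : ℝ) ≤ n + 1 := by simp
    linarith [norm_sub_le (hilbert (taper (n + 1) q) y) (hilbert (taper (n + 1) q) 0),
      hC _ hn y, hC _ hn 0]
  have := norm_sub_norm_le (modHilbert q y) (modHilbert q 0)
  linarith

lemma modHilbert_stronglyMeasurable (hq : ContDiff ℝ 1 q) (hp : Function.Periodic q 2) :
    StronglyMeasurable (modHilbert q) := by
  have h : StronglyMeasurable fun y => modHilbert q y - modHilbert q 0 := by
    refine stronglyMeasurable_of_tendsto (u := atTop)
      (f := fun (n : ℕ) y => hilbert (taper (n + 1) q) y - hilbert (taper (n + 1) q) 0)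
      (fun n => ?_) (tendsto_pi_nhds.2 fun y => tendsto_hilbert_taper hq hp y)
    exact (hilbert_measurable (taper_contDiff (n := 1) _ hq).continuous).sub
      stronglyMeasurable_const
  have := h.add (stronglyMeasurable_const (b := modHilbert q 0))
  simpa [Pi.add_def] using this

/-- The modified Hilbert transform of a `2`-periodic function is `2`-periodic. -/
lemma modHilbert_periodic (hq : ContDiff ℝ 1 q) (hp : Function.Periodic q 2) :
    Function.Periodic (modHilbert q) 2 := by
  obtain ⟨A, hA⟩ := Periodic.exists_bound hq.continuous hp
  -- A shift by 2 changes 1 / (y - t) only through translation, but changes the correction t / (1 +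
  -- t²); the resulting defect c does not depend on y.
  set c := (1 / Real.pi) * ∫ t, q t * ((t + 2) / (1 + (t + 2) ^ 2) - t / (1 + t ^ 2)) with hcdef
  have hstep (y : ℝ) : modHilbert q (y + 2) = modHilbert q y + c := by
    set R := |y| + 1 with hR
    have hR0 : 0 < R := by positivity
    have hRy (t : ℝ) (ht : |y - t| < 1) : |t| ≤ R := by
      have := abs_sub_abs_le_abs_sub t y
      rw [abs_sub_comm] at this
      linarith
    set θ := taper R q with hθdef
    have hθ : ContDiff ℝ 1 θ := taper_contDiff (n := 1) R hq
    have hc : HasCompactSupport θ := taper_hasCompactSupport hR0 q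
    have h1 := modHilbert_eq hq.continuous hA hθ hc (y := y) one_pos
      fun t ht => (taper_eq_self hR0 q (hRy t ht)).symm
    have h2 := modHilbert_eq hq.continuous hA (contDiff_comp_add hθ (-2))
      (hasCompactSupport_comp_add hc (-2)) (y := y + 2) one_pos fun t ht => by
        have := (taper_eq_self hR0 q (hRy (t + -2) (by convert ht using 2; ring))).symm
        rw [← hθdef] at this
        rw [← this, ← hp (t + -2), neg_add_cancel_right]
    have hθb (t : ℝ) : ‖θ t‖ ≤ A := (norm_taper_le R q t).trans (hA t)
    have e1 : modConst (fun t => θ (t + -2)) = ∫ t, θ t * ((t + 2) / (1 + (t + 2) ^ 2)) := by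
      unfold modConst
      rw [← integral_add_right_eq_self (fun t => θ (t + -2) * (t / (1 + t ^ 2))) (2 : ℝ)]
      simp only [add_neg_cancel_right]
    have e2 : ∫ t, (q t - θ (t + -2)) * modKernel (y + 2) t =
        ∫ t, (q t - θ t) * modKernel (y + 2) (t + 2) := by
      rw [← integral_add_right_eq_self (fun t => (q t - θ (t + -2)) * modKernel (y + 2) t) (2 : ℝ)]
      simp only [add_neg_cancel_right, hp _]
    have hbd (t : ℝ) : ‖q t - θ t‖ ≤ 2 * A := by
      linarith [norm_sub_le (q t) (θ t), hA t, hθb t]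
    have hz0 (t : ℝ) (ht : |y - t| < 1) : q t - θ t = 0 :=
      sub_eq_zero.2 (taper_eq_self hR0 q (hRy t ht)).symm
    have i1 : Integrable fun t => (q t - θ t) * modKernel y t :=
      integrable_mul_modKernel (hq.continuous.sub hθ.continuous) hbd one_pos hz0
    have i2 : Integrable fun t => (q t - θ t) * modKernel (y + 2) (t + 2) := by
      have := integrable_mul_modKernel (q := fun t => q t - θ (t + -2)) (y := y + 2) (C := 2 * A)
        (hq.continuous.sub (contDiff_comp_add hθ (-2)).continuous)
        (fun t => by linarith [norm_sub_le (q t) (θ (t + -2)), hA t, hθb (t + -2)]) one_pos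
        (fun t ht => by
          have := hz0 (t + -2) (by convert ht using 2; ring)
          rwa [← hp (t + -2), neg_add_cancel_right] at this)
      have := this.comp_add_right 2
      simpa only [add_neg_cancel_right, hp _] using this
    have i3 := integrable_modConst hθ.continuous hc
    have i4 : Integrable fun t => θ t * ((t + 2) / (1 + (t + 2) ^ 2)) :=
      (hθ.continuous.mul (continuous_div_one_add_sq.comp
        (continuous_id.add continuous_const))).integrable_of_hasCompactSupport hc.mul_right
    have hsum : ∫ t, q t * ((t + 2) / (1 + (t + 2) ^ 2) - t / (1 + t ^ 2)) =
        ((∫ t, (q t - θ t) * modKernel (y + 2) (t + 2)) - ∫ t, (q t - θ t) * modKernel y t) +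
        ((∫ t, θ t * ((t + 2) / (1 + (t + 2) ^ 2))) - modConst θ) := by
      unfold modConst
      have i12 : Integrable fun t => (q t - θ t) * modKernel (y + 2) (t + 2) -
        (q t - θ t) * modKernel y t := i2.sub i1
      have i43 : Integrable fun t => θ t * ((t + 2) / (1 + (t + 2) ^ 2)) -
        θ t * (t / (1 + t ^ 2)) := i4.sub i3
      rw [← integral_sub i2 i1, ← integral_sub i4 i3, ← integral_add i12 i43]
      congr 1
      ext t
      unfold modKernel
      rw [show y + 2 - (t + 2) = y - t by ring]
      ring
    rw [h1, h2, e1, e2, hilbert_comp_add, add_neg_cancel_right, hcdef, hsum]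
    ring
  obtain ⟨C, hC⟩ := exists_modHilbert_bound hq hp
  -- A nonzero defect would make H̃q grow linearly along even integers, against its boundedness.
  have hiter (n : ℕ) : modHilbert q (2 * n) = modHilbert q 0 + n * c := by
    induction n with
    | zero => simp
    | succ n ih =>
      have := hstep (2 * n)
      push_cast
      rw [mul_add, mul_one, this, ih]
      ring
  have hc0 : c = 0 := by
    by_contra hne
    obtain ⟨n, hn⟩ := exists_nat_gt (2 * C / |c|)
    rw [div_lt_iff₀ (abs_pos.2 hne)] at hn
    have h1 : (n : ℝ) * c = modHilbert q (2 * n) - modHilbert q 0 := by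
      rw [hiter n]
      ring
    have h2 : (n : ℝ) * |c| = ‖modHilbert q (2 * n) - modHilbert q 0‖ := by
      rw [← h1, norm_mul, Real.norm_of_nonneg n.cast_nonneg, Real.norm_eq_abs]
    linarith [norm_sub_le (modHilbert q (2 * n)) (modHilbert q 0), hC (2 * n), hC 0]
  intro y
  rw [hstep y, hc0, add_zero]

end Taper

/-! ### Periodization of integrable functions -/

section PeriodizeL1

lemma integral_toL1_mul {h : ℝ → ℂ} (hh : Integrable h) (χ : ℝ → ℝ) :
    ∫ x, (χ x : ℂ) * (hh.toL1 h) x = ∫ x, (χ x : ℂ) * h x :=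
  integral_congr_ae (hh.coeFn_toL1.mono fun x hx => by simp only [hx])

/-- Integration against a bounded measurable function, as a functional on `L¹(ℝ)`. -/
lemma exists_integral_mul_CLM {χ : ℝ → ℝ} (hχ : StronglyMeasurable χ) {C : ℝ}
    (hC : ∀ x, ‖χ x‖ ≤ C) : ∃ Φ : L1 →L[ℂ] ℂ, ∀ f : L1, Φ f = ∫ x, (χ x : ℂ) * f x := by
  refine ⟨LinearMap.mkContinuous
    { toFun := fun f => ∫ x, (χ x : ℂ) * f x
      map_add' := fun a b => ?_
      map_smul' := fun c a => ?_ } C fun f => norm_integral_mul_L1_le hC f, fun f => rfl⟩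
  · rw [← integral_add (integrable_mul_L1 hχ ⟨C, hC⟩ a) (integrable_mul_L1 hχ ⟨C, hC⟩ b)]
    exact integral_congr_ae ((Lp.coeFn_add a b).mono fun x hx => by
      simp only [hx, Pi.add_apply, mul_add])
  · rw [RingHom.id_apply, smul_eq_mul, ← integral_const_mul]
    exact integral_congr_ae ((Lp.coeFn_smul c a).mono fun x hx => by
      simp only [hx, Pi.smul_apply, smul_eq_mul]
      ring)

/-- The periods `[2k - 1, 2k + 1[` of the line. -/
def period (k : ℤ) : Set ℝ := Set.Ico (2 * k - 1) (2 * k + 1)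

lemma measurableSet_period (k : ℤ) : MeasurableSet (period k) := measurableSet_Ico

lemma mem_period_iff {k : ℤ} {x : ℝ} : x ∈ period k ↔ ⌊(x + 1) / 2⌋ = k := by
  rw [Int.floor_eq_iff, period, Set.mem_Ico, le_div_iff₀ two_pos, div_lt_iff₀ two_pos]
  constructor <;> rintro ⟨h1, h2⟩ <;> constructor <;> linarith

lemma pairwise_disjoint_period : Pairwise (Function.onFun Disjoint period) := by
  intro i j hij
  refine Set.disjoint_left.2 fun x hi hj => hij ?_
  rw [mem_period_iff] at hi hj
  rw [← hi, ← hj]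

lemma iUnion_period : ⋃ k, period k = Set.univ :=
  Set.eq_univ_of_forall fun _ => Set.mem_iUnion.2 ⟨_, mem_period_iff.2 rfl⟩

lemma hasSum_integral_period {E : Type*} [NormedAddCommGroup E] [NormedSpace ℝ E] {h : ℝ → E}
    (hh : Integrable h) : HasSum (fun k => ∫ x in period k, h x) (∫ x, h x) := by
  have := hasSum_integral_iUnion measurableSet_period pairwise_disjoint_period
    (f := h) (μ := volume) (by rw [iUnion_period]; exact hh.integrableOn)
  rwa [iUnion_period, setIntegral_univ] at this

lemma integral_indicator_shift {E : Type*} [NormedAddCommGroup E] [NormedSpace ℝ E]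
    (k : ℤ) (F : ℝ → E) :
    ∫ x, (Set.Ico (-1 : ℝ) 1).indicator (fun x => F (x + 2 * k)) x = ∫ x in period k, F x := by
  rw [← integral_indicator (measurableSet_period k),
    ← integral_add_right_eq_self ((period k).indicator F) (2 * k : ℝ)]
  congr 1
  ext x
  simp only [Set.indicator_apply, period, Set.mem_Ico]
  congr 1
  apply propext
  constructor <;> rintro ⟨h1, h2⟩ <;> constructor <;> linarith

/-- The periodization of an integrable function, as an integrable function on one period. -/
lemma exists_periodization {h : ℝ → ℂ} (hh : Integrable h) :
    ∃ p : L1, ‖p‖ ≤ ∫ x, ‖h x‖ ∧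
      ∀ q χ : ℝ → ℝ, StronglyMeasurable q → (∃ C, ∀ x, ‖q x‖ ≤ C) → Function.Periodic q 2 →
        StronglyMeasurable χ → (∃ C, ∀ x, ‖χ x‖ ≤ C) → (∀ x ∈ Set.Ico (-1 : ℝ) 1, χ x = q x) →
        ∫ x, (q x : ℂ) * h x = ∫ x, (χ x : ℂ) * p x := by
  -- The piece of h on the k-th period, moved to [-1, 1). The norms of the pieces sum to the L¹ norm
  -- of h, so their sum converges in L¹.
  set F : ℤ → ℝ → ℂ := fun k => (Set.Ico (-1 : ℝ) 1).indicator fun x => h (x + 2 * k) with hF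
  have hFi (k : ℤ) : Integrable (F k) := (hh.comp_add_right (2 * k : ℝ)).indicator measurableSet_Ico
  have hnorm (k : ℤ) : ‖(hFi k).toL1 (F k)‖ = ∫ x in period k, ‖h x‖ := by
    rw [L1.norm_of_fun_eq_integral_norm, ← integral_indicator_shift k fun x => ‖h x‖]
    congr 1
    ext x
    rw [hF, norm_indicator_eq_indicator_norm]
  have hsum : HasSum (fun k => ‖(hFi k).toL1 (F k)‖) (∫ x, ‖h x‖) := by
    simp_rw [hnorm]
    exact hasSum_integral_period hh.norm
  have hs : Summable fun k => (hFi k).toL1 (F k) := hsum.summable.of_norm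
  refine ⟨∑' k, (hFi k).toL1 (F k), tsum_of_norm_bounded hsum fun _ => le_rfl, ?_⟩
  rintro q χ hq ⟨C, hC⟩ hp hχ ⟨C', hC'⟩ hχq
  obtain ⟨Φ, hΦ⟩ := exists_integral_mul_CLM hχ hC'
  rw [← hΦ, Φ.map_tsum hs]
  have hqh : Integrable fun x => (q x : ℂ) * h x :=
    hh.bdd_mul (c := C) (Complex.continuous_ofReal.comp_stronglyMeasurable hq).aestronglyMeasurable
      (Eventually.of_forall fun x => by simpa using hC x)
  rw [← (hasSum_integral_period hqh).tsum_eq]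
  congr 1
  ext k
  rw [hΦ, integral_toL1_mul, ← integral_indicator_shift k]
  congr 1
  ext x
  rw [hF]
  by_cases hx : x ∈ Set.Ico (-1 : ℝ) 1
  · have hk : q (x + 2 * k) = q x := by
      have := hp.int_mul k x
      rwa [mul_comm] at this
    simp only [Set.indicator_of_mem hx, hχq x hx, hk]
  · simp only [Set.indicator_of_notMem hx, mul_zero]

end PeriodizeL1

/-! ### The far part of the periodized Hilbert kernel -/

section FarKernel

/-- The kernel of the modified Hilbert transform, restricted to `-1 ≤ y < 1` and `3 ≤ |t|`. -/
def farKernel (y t : ℝ) : ℝ :=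
  (Set.Ico (-1 : ℝ) 1 ×ˢ {t : ℝ | 3 ≤ |t|}).indicator
    (fun z : ℝ × ℝ => (1 / Real.pi) * modKernel z.1 z.2) (y, t)

lemma measurable_farKernel : Measurable (Function.uncurry farKernel) := by
  have : Function.uncurry farKernel = (Set.Ico (-1 : ℝ) 1 ×ˢ {t : ℝ | 3 ≤ |t|}).indicator
      (fun z : ℝ × ℝ => (1 / Real.pi) * Function.uncurry modKernel z) := rfl
  rw [this]
  exact (measurable_modKernel.const_mul _).indicator
    (measurableSet_Ico.prod (measurableSet_le measurable_const measurable_abs))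

lemma norm_farKernel_le (y t : ℝ) : ‖farKernel y t‖ ≤ (1 + t ^ 2)⁻¹ := by
  unfold farKernel
  by_cases h : (y, t) ∈ Set.Ico (-1 : ℝ) 1 ×ˢ {t : ℝ | 3 ≤ |t|}
  · rw [Set.indicator_of_mem h, norm_mul]
    have hy : |y| ≤ 1 := abs_le.2 ⟨h.1.1, h.1.2.le⟩
    have ht : 3 ≤ |t| := h.2
    have hyt : 2 ≤ |y - t| := by
      have := abs_sub_abs_le_abs_sub t y
      rw [abs_sub_comm] at this
      linarith
    have h1 := norm_modKernel_le two_pos hyt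
    have h2 : (1 + y ^ 2) / 2 + |y| ≤ 2 := by
      have : y ^ 2 ≤ 1 := by
        rw [← sq_abs]
        exact pow_le_one₀ (abs_nonneg y) hy
      linarith
    have h3 : ‖1 / Real.pi‖ ≤ 1 / 2 := by
      rw [Real.norm_of_nonneg (by positivity)]
      exact one_div_le_one_div_of_le two_pos (by linarith [Real.pi_gt_three])
    have h4 : (0 : ℝ) ≤ (1 + t ^ 2)⁻¹ := by positivity
    calc _ ≤ 1 / 2 * (2 * (1 + t ^ 2)⁻¹) :=
          mul_le_mul h3 (h1.trans (mul_le_mul_of_nonneg_right h2 h4)) (norm_nonneg _) (by norm_num)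
      _ = _ := by ring
  · rw [Set.indicator_of_notMem h, norm_zero]
    positivity

/-- The contribution of `|t| ≥ 3` to the modified Hilbert transform of `q` on `[-1, 1[`. -/
def farPart (q : ℝ → ℝ) (y : ℝ) : ℝ := ∫ t, farKernel y t * q t

lemma farPart_stronglyMeasurable {q : ℝ → ℝ} (hq : Measurable q) :
    StronglyMeasurable (farPart q) := by
  have : Measurable (Function.uncurry fun y t => farKernel y t * q t) :=
    measurable_farKernel.mul (hq.comp measurable_snd)
  exact this.stronglyMeasurable.integral_prod_right

lemma norm_farPart_le {q : ℝ → ℝ} {C : ℝ} (hC : ∀ x, ‖q x‖ ≤ C) (y : ℝ) :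
    ‖farPart q y‖ ≤ Real.pi * C := by
  rw [← integral_univ_inv_one_add_sq, ← integral_mul_const]
  refine norm_integral_le_of_norm_le (integrable_inv_one_add_sq.mul_const C)
    (Eventually.of_forall fun t => ?_)
  rw [norm_mul]
  exact mul_le_mul (norm_farKernel_le y t) (hC t) (norm_nonneg _) (by positivity)

lemma integrable_farKernel_mul {q : ℝ → ℝ} (hq : Measurable q) {C : ℝ} (hC : ∀ x, ‖q x‖ ≤ C)
    (p : L1) : Integrable (Function.uncurry fun y t : ℝ =>
      ((farKernel y t * q t : ℝ) : ℂ) * p y) (volume.prod volume) := by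
  have hdom : Integrable (fun z : ℝ × ℝ => ‖p z.1‖ * (C * (1 + z.2 ^ 2)⁻¹))
      (volume.prod volume) :=
    (L1.integrable_coeFn p).norm.mul_prod (integrable_inv_one_add_sq.const_mul C)
  refine hdom.mono' ?_ (Eventually.of_forall fun z => ?_)
  · refine AEStronglyMeasurable.mul ?_ ?_
    · exact (Complex.measurable_ofReal.comp
        (measurable_farKernel.mul (hq.comp measurable_snd))).aestronglyMeasurable
    · exact (L1.integrable_coeFn p).aestronglyMeasurable.comp_fst
  · have h1 : ‖farKernel z.1 z.2 * q z.2‖ ≤ C * (1 + z.2 ^ 2)⁻¹ := by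
      rw [norm_mul, mul_comm]
      exact mul_le_mul (hC _) (norm_farKernel_le _ _) (norm_nonneg _)
        ((norm_nonneg _).trans (hC 0))
    simp only [Function.uncurry]
    rw [norm_mul, Complex.norm_real, mul_comm]
    exact mul_le_mul_of_nonneg_left h1 (norm_nonneg _)

/-- Fubini transposes the far kernel onto p. The constant 4 bounds ∫ (1 + t²)⁻¹ dt = π. -/
lemma exists_dual_farPart (p : L1) :
    ∃ F : ℝ → ℂ, Integrable F ∧ ∫ t, ‖F t‖ ≤ 4 * ‖p‖ ∧
      ∀ q : ℝ → ℝ, Measurable q → (∃ C, ∀ x, ‖q x‖ ≤ C) →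
        ∫ y, (farPart q y : ℂ) * p y = ∫ t, (q t : ℂ) * F t := by
  have hone : Integrable (Function.uncurry fun y t : ℝ => (farKernel y t : ℂ) * p y)
      (volume.prod volume) := by
    have := integrable_farKernel_mul (q := fun _ => 1) measurable_const (C := 1) (by simp) p
    simpa using this
  refine ⟨fun t => ∫ y, (farKernel y t : ℂ) * p y, hone.integral_prod_right, ?_, ?_⟩
  · have hb (t : ℝ) : ‖∫ y, (farKernel y t : ℂ) * p y‖ ≤ (1 + t ^ 2)⁻¹ * ‖p‖ :=
      norm_integral_mul_L1_le (fun y => norm_farKernel_le y t) p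
    calc ∫ t, ‖∫ y, (farKernel y t : ℂ) * p y‖ ≤ ∫ t : ℝ, (1 + t ^ 2)⁻¹ * ‖p‖ :=
          integral_mono hone.integral_prod_right.norm (integrable_inv_one_add_sq.mul_const _) hb
      _ = Real.pi * ‖p‖ := by rw [integral_mul_const, integral_univ_inv_one_add_sq]
      _ ≤ 4 * ‖p‖ := by gcongr; exact Real.pi_le_four
  · rintro q hq ⟨C, hC⟩
    have hsw := integral_integral_swap (integrable_farKernel_mul hq hC p)
    calc ∫ y, (farPart q y : ℂ) * p y
        = ∫ y, ∫ t, ((farKernel y t * q t : ℝ) : ℂ) * p y := by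
          congr 1
          ext y
          rw [integral_mul_const, farPart, integral_complex_ofReal]
      _ = ∫ t, ∫ y, ((farKernel y t * q t : ℝ) : ℂ) * p y := hsw
      _ = ∫ t, (q t : ℂ) * ∫ y, (farKernel y t : ℂ) * p y := by
          congr 1
          ext t
          rw [← integral_const_mul]
          congr 1
          ext y
          push_cast
          ring

end FarKernel

/-! ### The image of an element of `𝔏₀(ℝ)` under `Σ₂` -/

section SuperAction

variable {φ : ℝ → ℝ} {ρ : ℝ}

/-- The case n = 1 of `modHilbert_periodize_eq`: for y in the central period, three translates
account for |t| < 3, and the rest of Πφ stays at distance at least 2 from y. -/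
lemma modHilbert_periodize_eq_near_add_far (hφ : ContDiff ℝ 1 φ) (hρ : ρ < 1)
    (hz : ∀ x, ρ < |x| → φ x = 0) {y : ℝ} (hy : y ∈ Set.Ico (-1 : ℝ) 1) :
    modHilbert (periodize φ) y = ∑ j ∈ Finset.Icc (-1 : ℤ) 1, hilbert φ (y + 2 * j) +
      (1 / Real.pi) * modConst (partialPeriodize 1 φ) + farPart (periodize φ) y := by
  have hy' : |y| ≤ 1 := abs_le.2 ⟨hy.1, hy.2.le⟩
  rw [modHilbert_periodize_eq hφ hρ hz (n := 1) (by push_cast; linarith), farPart,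
    ← integral_const_mul]
  congr 2
  ext t
  unfold farKernel
  rcases lt_or_ge |t| 3 with ht | ht
  · rw [Set.indicator_of_notMem (fun h => absurd h.2 (not_le.2 ht)),
      partialPeriodize_eq_periodize hρ hz (by push_cast; linarith)]
    ring
  · rw [Set.indicator_of_mem (Set.mk_mem_prod hy (by exact ht)),
      partialPeriodize_eq_zero hρ hz (by push_cast; linarith)]
    ring

lemma exists_sum_hilbert_bound (hφ : ContDiff ℝ 1 φ) (hc : HasCompactSupport φ) :
    ∃ C, ∀ y : ℝ, ‖∑ j ∈ Finset.Icc (-1 : ℤ) 1, hilbert φ (y + 2 * j)‖ ≤ C := by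
  obtain ⟨C, hC⟩ := exists_hilbert_bound hφ hc
  refine ⟨∑ j ∈ Finset.Icc (-1 : ℤ) 1, C, fun y => ?_⟩
  exact norm_sum_le_of_le _ fun j _ => hC _

/-- Representation of the restriction to `]-1, 1[` of `Σ₂ H h`. -/
lemma exists_representation {h : ℝ → ℂ} (hh : Integrable h) (h0 : ∫ x, h x = 0) :
    ∃ F G : L1, ∫ x, G x = 0 ∧ ‖F‖ ≤ 4 * ∫ x, ‖h x‖ ∧ ‖G‖ ≤ 4 * ∫ x, ‖h x‖ ∧
      ∀ (φ : ℝ → ℝ) (ρ : ℝ), ContDiff ℝ 1 φ → ρ < 1 → (∀ x, ρ < |x| → φ x = 0) →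
        (∫ x, (modHilbert (periodize φ) x : ℂ) * h x) - ∫ x, (modHilbert φ x : ℂ) * h x =
          (∫ x, (φ x : ℂ) * F x) + ∫ x, (hilbert φ x : ℂ) * G x := by
  -- Two foldings occur: h is folded onto a period because H̃Πφ is periodic, and the transposed far
  -- part F₀ is folded again because it is paired with the periodic Πφ.
  obtain ⟨p, hpn, hp⟩ := exists_periodization hh
  obtain ⟨F₀, hF₀i, hF₀n, hF₀⟩ := exists_dual_farPart p
  obtain ⟨F, hFn, hF⟩ := exists_periodization hF₀i
  have hpint : ∫ x, p x = 0 := by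
    have := hp (fun _ => 1) (fun _ => 1) stronglyMeasurable_const ⟨1, by simp⟩ (fun _ => rfl)
      stronglyMeasurable_const ⟨1, by simp⟩ fun _ _ => rfl
    simp only [Complex.ofReal_one, one_mul] at this
    rw [← this, h0]
  have hpi := L1.integrable_coeFn p
  have hsh (j : ℤ) : Integrable fun x => p (x - 2 * j) := hpi.comp_sub_right _
  have hsum : Integrable fun x => ∑ j ∈ Finset.Icc (-1 : ℤ) 1, p (x - 2 * j) :=
    integrable_finsetSum _ fun j _ => hsh j
  have hG : Integrable fun x => ∑ j ∈ Finset.Icc (-1 : ℤ) 1, p (x - 2 * j) - h x := hsum.sub hh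
  have hcard : (Finset.Icc (-1 : ℤ) 1).card = 3 := rfl
  -- G collects three translates of p from the near part, minus h for the subtracted term ∫ (H̃φ) h.
  -- Hence the factor 3 + 1 in its norm.
  refine ⟨F, hG.toL1 _, ?_, hFn.trans (hF₀n.trans (by linarith)), ?_, ?_⟩
  · rw [integral_congr_ae hG.coeFn_toL1, integral_sub hsum hh, h0, sub_zero,
      integral_finsetSum _ fun j _ => hsh j]
    refine Finset.sum_eq_zero fun j _ => ?_
    rw [integral_sub_right_eq_self (fun x => p x), hpint]
  · rw [L1.norm_of_fun_eq_integral_norm]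
    calc ∫ x, ‖∑ j ∈ Finset.Icc (-1 : ℤ) 1, p (x - 2 * j) - h x‖
        ≤ ∫ x, (∑ j ∈ Finset.Icc (-1 : ℤ) 1, ‖p (x - 2 * j)‖ + ‖h x‖) := by
          refine integral_mono hG.norm
            ((integrable_finsetSum _ fun j _ => (hsh j).norm).add hh.norm) fun x => ?_
          exact (norm_sub_le _ _).trans (add_le_add (norm_sum_le _ _) le_rfl)
      _ = ∑ j ∈ Finset.Icc (-1 : ℤ) 1, ‖p‖ + ∫ x, ‖h x‖ := by
          rw [integral_add (integrable_finsetSum _ fun j _ => (hsh j).norm) hh.norm,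
            integral_finsetSum _ fun j _ => (hsh j).norm]
          congr 1
          refine Finset.sum_congr rfl fun j _ => ?_
          rw [integral_sub_right_eq_self (fun x => ‖p x‖), L1.norm_eq_integral_norm]
      _ ≤ 4 * ∫ x, ‖h x‖ := by
          rw [Finset.sum_const, hcard]
          simp only [nsmul_eq_mul]
          push_cast
          linarith
  · intro φ ρ hφ hρ hz
    have hc := hasCompactSupport_of_zero hz
    have hq := periodize_contDiff hφ hρ hz
    have hqp := periodize_periodic φ
    obtain ⟨A, hA⟩ := hc.exists_bound_of_continuous hφ.continuous
    have hqA := norm_periodize_le hρ hz hA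
    obtain ⟨S, hS⟩ := exists_sum_hilbert_bound hφ hc
    obtain ⟨B, hB⟩ := exists_hilbert_bound hφ hc
    have hHm := hilbert_measurable hφ.continuous
    have hfm := farPart_stronglyMeasurable hq.continuous.measurable
    have hfb := norm_farPart_le hqA
    set c := (1 / Real.pi) * modConst (partialPeriodize 1 φ) with hcdef
    have hSm : StronglyMeasurable fun y : ℝ =>
        ∑ j ∈ Finset.Icc (-1 : ℤ) 1, hilbert φ (y + 2 * j) :=
      Finset.stronglyMeasurable_fun_sum _ fun j _ =>
        hHm.comp_measurable (measurable_id.add_const _)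
    -- The near-far formula holds only on [-1, 1), but its right side is bounded on the whole line,
    -- which is all that the folding requires.
    have hP := hp (modHilbert (periodize φ))
      (fun y => ∑ j ∈ Finset.Icc (-1 : ℤ) 1, hilbert φ (y + 2 * j) + c + farPart (periodize φ) y)
      (modHilbert_stronglyMeasurable hq hqp) (exists_modHilbert_bound hq hqp)
      (modHilbert_periodic hq hqp) ((hSm.add stronglyMeasurable_const).add hfm)
      ⟨S + ‖c‖ + Real.pi * A, fun y => (norm_add_le _ _).trans (add_le_add ((norm_add_le _ _).trans
        (add_le_add (hS y) le_rfl)) (hfb y))⟩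
      fun y hy => (modHilbert_periodize_eq_near_add_far hφ hρ hz hy).symm
    have hfar : ∫ y, (farPart (periodize φ) y : ℂ) * p y = ∫ x, (φ x : ℂ) * F x := by
      rw [hF₀ _ hq.continuous.measurable ⟨A, hqA⟩]
      exact hF _ _ hq.continuous.stronglyMeasurable ⟨A, hqA⟩ hqp
        hφ.continuous.stronglyMeasurable ⟨A, hA⟩ fun x hx =>
          (periodize_eq_self hρ hz (abs_le.2 ⟨hx.1, hx.2.le⟩)).symm
    have hHp (j : ℤ) : Integrable fun y => (hilbert φ (y + 2 * j) : ℂ) * p y :=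
      integrable_mul_L1 (hHm.comp_measurable (measurable_id.add_const _)) ⟨B, fun y => hB _⟩ p
    have hHsum : Integrable fun y =>
        ∑ j ∈ Finset.Icc (-1 : ℤ) 1, (hilbert φ (y + 2 * j) : ℂ) * p y :=
      integrable_finsetSum _ fun j _ => hHp j
    have hfp : Integrable fun y => (farPart (periodize φ) y : ℂ) * p y :=
      integrable_mul_L1 hfm ⟨_, hfb⟩ p
    have hcp : Integrable fun y => (c : ℂ) * p y := hpi.const_mul _
    have hHh : Integrable fun y => (hilbert φ y : ℂ) * h y :=
      hh.bdd_mul (c := B)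
        (Complex.continuous_ofReal.comp_stronglyMeasurable hHm).aestronglyMeasurable
        (Eventually.of_forall fun x => by simpa using hB x)
    have hHsh (j : ℤ) : Integrable fun x => (hilbert φ x : ℂ) * p (x - 2 * j) :=
      (hsh j).bdd_mul (c := B)
        (Complex.continuous_ofReal.comp_stronglyMeasurable hHm).aestronglyMeasurable
        (Eventually.of_forall fun x => by simpa using hB x)
    have hPval : ∫ x, (modHilbert (periodize φ) x : ℂ) * h x =
        (∑ j ∈ Finset.Icc (-1 : ℤ) 1, ∫ x, (hilbert φ x : ℂ) * p (x - 2 * j)) +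
          ∫ x, (φ x : ℂ) * F x := by
      rw [hP, ← hfar]
      have e : ∀ y, ((∑ j ∈ Finset.Icc (-1 : ℤ) 1, hilbert φ (y + 2 * j) + c +
          farPart (periodize φ) y : ℝ) : ℂ) * p y =
          (∑ j ∈ Finset.Icc (-1 : ℤ) 1, (hilbert φ (y + 2 * j) : ℂ) * p y + (c : ℂ) * p y) +
          (farPart (periodize φ) y : ℂ) * p y := by
        intro y
        push_cast
        rw [← Finset.sum_mul]
        ring
      simp_rw [e]
      have hHc : Integrable fun y => ∑ j ∈ Finset.Icc (-1 : ℤ) 1,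
          (hilbert φ (y + 2 * j) : ℂ) * p y + (c : ℂ) * p y := hHsum.add hcp
      rw [integral_add hHc hfp, integral_add hHsum hcp, integral_const_mul, hpint,
        mul_zero, add_zero, integral_finsetSum _ fun j _ => hHp j]
      congr 1
      refine Finset.sum_congr rfl fun j _ => ?_
      rw [← integral_add_right_eq_self (fun x => (hilbert φ x : ℂ) * p (x - 2 * j)) (2 * j : ℝ)]
      simp only [add_sub_cancel_right]
    have hφval : ∫ x, (modHilbert φ x : ℂ) * h x = ∫ x, (hilbert φ x : ℂ) * h x := by
      simp_rw [modHilbert_eq_hilbert_add hφ hc]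
      push_cast
      simp_rw [add_mul]
      rw [integral_add hHh (hh.const_mul _), integral_const_mul, h0, mul_zero, add_zero]
    have hGval : ∫ x, (hilbert φ x : ℂ) * (hG.toL1 _) x =
        (∑ j ∈ Finset.Icc (-1 : ℤ) 1, ∫ x, (hilbert φ x : ℂ) * p (x - 2 * j)) -
          ∫ x, (hilbert φ x : ℂ) * h x := by
      rw [integral_toL1_mul, ← integral_finsetSum _ fun j _ => hHsh j,
        ← integral_sub (integrable_finsetSum _ fun j _ => hHsh j) hHh]
      simp_rw [mul_sub, Finset.mul_sum]
    rw [hPval, hφval, hGval]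
    ring

end SuperAction

/-! ### The subtransfer operator on `𝔏(I₁)` -/

section Subtransfer

variable {β : ℝ}

lemma test_exists_radius (φ : 𝓓(I₁, ℝ)) : ∃ ρ, 0 ≤ ρ ∧ ρ < 1 ∧ ∀ x, ρ < |x| → φ x = 0 := by
  rcases (tsupport φ).eq_empty_or_nonempty with h | h
  · refine ⟨0, le_rfl, one_pos, fun x _ => image_eq_zero_of_notMem_tsupport ?_⟩
    rw [h]
    exact Set.notMem_empty x
  · obtain ⟨a, ha, hmax⟩ := φ.hasCompactSupport.isCompact.exists_isMaxOn h
      (f := fun x : ℝ => |x|) continuous_abs.continuousOn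
    refine ⟨|a|, abs_nonneg a, abs_lt.2 (φ.tsupport_subset ha), fun x hx => ?_⟩
    exact image_eq_zero_of_notMem_tsupport fun hxs => absurd (hmax hxs) (not_le.2 hx)

lemma test_contDiff_one (φ : 𝓓(I₁, ℝ)) : ContDiff ℝ 1 φ := φ.contDiff.of_le (by exact_mod_cast le_top)

lemma superAction_eq (φ : ℝ → ℝ) (f g : ℝ → ℂ) :
    superAction φ f g = ((∫ x, (periodize φ x : ℂ) * f x) - ∫ x, (φ x : ℂ) * f x) -
      ((∫ x, (modHilbert (periodize φ) x : ℂ) * g x) - ∫ x, (modHilbert φ x : ℂ) * g x) := by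
  unfold superAction extAction
  ring

/-- `Σ₂ J_β U` restricted to `I₁` belongs to `𝔏(I₁)`, with control of the norm. -/
lemma exists_subtransfer_value (hβ : 0 < β) (f : L1) (g : L10) :
    ∃ v : LSpace I₁, (∀ φ : 𝓓(I₁, ℝ),
      v.toDist φ = superAction φ (invol β f) (invol β (g : L1))) ∧ ‖v‖ ≤ 8 * (‖f‖ + ‖g‖) := by
  have hf := integrable_invol hβ (L1.integrable_coeFn f)
  have hg := integrable_invol hβ (L1.integrable_coeFn (g : L1))
  have hfn : ∫ x, ‖invol β f x‖ = ‖f‖ := by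
    rw [integral_norm_invol hβ, L1.norm_eq_integral_norm]
  have hgn : ∫ x, ‖invol β (g : L1) x‖ = ‖g‖ := by
    rw [integral_norm_invol hβ, ← L1.norm_eq_integral_norm, Submodule.coe_norm]
  have hg0 : ∫ x, invol β (g : L1) x = 0 := by
    rw [integral_invol hβ]
    exact g.2
  obtain ⟨P, hPn, hP⟩ := exists_periodization hf
  obtain ⟨F, G, hG0, hFn, hGn, hrep⟩ := exists_representation hg hg0
  rw [hfn] at hPn
  rw [hgn] at hFn hGn
  set K : L1 := hf.toL1 _ with hK
  have hKn : ‖K‖ = ‖f‖ := by rw [hK, L1.norm_of_fun_eq_integral_norm, hfn]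
  -- The H-part enters the pairing with a minus sign: F is therefore subtracted, while G already
  -- carries the sign used in `action`.
  refine ⟨LSpace.mk I₁ (P - K - F, ⟨G, hG0⟩), fun φ => ?_, ?_⟩
  · obtain ⟨ρ, -, hρ, hz⟩ := test_exists_radius φ
    have hφ := test_contDiff_one φ
    obtain ⟨A, hA⟩ := test_bound φ
    obtain ⟨Φ, hΦ⟩ := exists_integral_mul_CLM φ.continuous.stronglyMeasurable hA
    rw [LSpace.toDist_mk, superAction_eq, hrep φ ρ hφ hρ hz, action, ← hΦ, map_sub, map_sub, hΦ,
      hΦ, hΦ, hK, integral_toL1_mul hf,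
      hP (periodize φ) φ (periodize_contDiff hφ hρ hz).continuous.stronglyMeasurable
        ⟨A, norm_periodize_le hρ hz hA⟩ (periodize_periodic φ) φ.continuous.stronglyMeasurable
        ⟨A, hA⟩ fun x hx => (periodize_eq_self hρ hz (abs_le.2 ⟨hx.1, hx.2.le⟩)).symm]
    ring
  · refine (LSpace.norm_mk_le _ _).trans ?_
    -- The three norms are at most ‖f‖, ‖f‖ and 4‖g‖, and G contributes another 4‖g‖.
    have h1 : ‖P - K - F‖ ≤ ‖P‖ + ‖K‖ + ‖F‖ :=
      (norm_sub_le _ _).trans (add_le_add (norm_sub_le _ _) le_rfl)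
    have h2 : ‖(⟨G, hG0⟩ : L10)‖ = ‖G‖ := rfl
    rw [h2]
    linarith [norm_nonneg f]

/-- The test function `x ↦ θ(-β / x)` on `I₁`. -/
lemma exists_inverted_test (hβ₀ : 0 < β) (hβ₁ : β ≤ 1) {θ : ℝ → ℝ}
    (hθ : ContDiff ℝ (⊤ : ℕ∞) θ) {r R : ℝ} (hr : 1 < r) (hR : 0 < R)
    (hin : ∀ y, |y| < r → θ y = 0) (hout : ∀ y, R < |y| → θ y = 0) :
    ∃ ψ : 𝓓(I₁, ℝ), ∀ x, ψ x = θ (-β / x) := by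
  have hr0 : 0 < r := one_pos.trans hr
  have h0 : θ 0 = 0 := hin 0 (by simpa using hr0)
  have hz : ∀ x, β / r < |x| → θ (-β / x) = 0 := by
    intro x hx
    have hx0 : 0 < |x| := (div_pos hβ₀ hr0).trans hx
    apply hin
    rw [abs_div, abs_neg, abs_of_pos hβ₀, div_lt_iff₀ hx0]
    rw [div_lt_iff₀ hr0] at hx
    linarith
  -- Here β ≤ 1 enters: it keeps the inverted support inside I₁.
  have hlt : β / r < 1 := by
    rw [div_lt_one hr0]
    linarith
  refine ⟨⟨fun x => θ (-β / x), contDiff_inversion hβ₀ hθ hR hout h0,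
    hasCompactSupport_of_zero hz, ?_⟩, fun x => rfl⟩
  have hsub : tsupport (fun x => θ (-β / x)) ⊆ Metric.closedBall 0 (β / r) := by
    refine closure_minimal (fun x hx => ?_) Metric.isClosed_closedBall
    by_contra hnot
    rw [Metric.mem_closedBall, dist_zero_right, Real.norm_eq_abs, not_le] at hnot
    exact hx (hz x hnot)
  intro x hx
  have := hsub hx
  rw [Metric.mem_closedBall, dist_zero_right, Real.norm_eq_abs] at this
  exact abs_lt.1 (this.trans_lt hlt)

/-- If `U = f + Hg` vanishes on `I₁`, then so does `Σ₂ J_β U`. -/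
lemma superAction_eq_zero (hβ₀ : 0 < β) (hβ₁ : β ≤ 1) {f : L1} {g : L10}
    (hfg : LSpace.mk I₁ (f, g) = 0) (φ : 𝓓(I₁, ℝ)) :
    superAction φ (invol β f) (invol β (g : L1)) = 0 := by
  obtain ⟨ρ, hρ0, hρ, hz⟩ := test_exists_radius φ
  have hφ := test_contDiff_one φ
  have hφc := φ.hasCompactSupport
  obtain ⟨A, hA⟩ := test_bound φ
  obtain ⟨B, hB⟩ := hilbert_test_bound φ
  set q := periodize φ with hqdef
  have hqs : ContDiff ℝ (⊤ : ℕ∞) q := periodize_contDiff φ.contDiff hρ hz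
  have hq : ContDiff ℝ 1 q := periodize_contDiff hφ hρ hz
  have hqp : Function.Periodic q 2 := periodize_periodic φ
  have hqA : ∀ x, ‖q x‖ ≤ A := norm_periodize_le hρ hz hA
  obtain ⟨C, hC⟩ := exists_hilbert_taper_bound hq hqp
  obtain ⟨C', hC'⟩ := exists_modHilbert_bound hq hqp
  have hf := integrable_invol hβ₀ (L1.integrable_coeFn f)
  have hg := integrable_invol hβ₀ (L1.integrable_coeFn (g : L1))
  have hg0 : ∫ x, invol β (g : L1) x = 0 := by
    rw [integral_invol hβ₀]
    exact g.2
  have hpos (n : ℕ) : (0 : ℝ) < n + 1 := by positivity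
  -- The tapered version of Πφ - φ. It vanishes for |y| < 2 - ρ, where 2 - ρ > 1, and for large |y|,
  -- so its inversion is a test function on I₁.
  set Θ : ℕ → ℝ → ℝ := fun n t => taper (n + 1) q t - φ t with hΘ
  have hΘs (n : ℕ) : ContDiff ℝ (⊤ : ℕ∞) (Θ n) := (taper_contDiff _ hqs).sub φ.contDiff
  have hΘ1 (n : ℕ) : ContDiff ℝ 1 (Θ n) := (taper_contDiff (n := 1) _ hq).sub hφ
  have hout (n : ℕ) (y : ℝ) (hy : 2 * ((n : ℝ) + 1) < |y|) : Θ n y = 0 := by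
    have hn : (0 : ℝ) ≤ n := n.cast_nonneg
    rw [hΘ]
    beta_reduce
    rw [taper_eq_zero (hpos n) q hy.le, hz y (by linarith), sub_zero]
  have hin (n : ℕ) (y : ℝ) (hy : |y| < 2 - ρ) : Θ n y = 0 := by
    have hn : (0 : ℝ) ≤ n := n.cast_nonneg
    have hqy : q y = φ y := by
      have := periodize_eq hz (x := y) (k := 0) (by simpa using hy)
      simpa using this
    rw [hΘ]
    beta_reduce
    rcases le_or_gt |y| 1 with h | h
    · rw [taper_eq_self (hpos n) q (by linarith), hqy, sub_self]
    · have : φ y = 0 := hz y (by linarith)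
      rw [taper, hqy, this, mul_zero, sub_zero]
  have hΘc (n : ℕ) : HasCompactSupport (Θ n) := hasCompactSupport_of_zero (hout n)
  have hHΘ (n : ℕ) (y : ℝ) : hilbert (Θ n) y = hilbert (taper (n + 1) q) y - hilbert φ y :=
    hilbert_sub (taper_contDiff (n := 1) _ hq) (taper_hasCompactSupport (hpos n) q) hφ hφc y
  -- This is ⟨ψ, U⟩ = 0 for the inverted test function ψ, rewritten on the other side of the
  -- inversion. The constant from `hilbert_inversion` is kept, as it is needed for the limit.
  have hzero (n : ℕ) : (∫ y, (Θ n y : ℂ) * invol β f y) -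
      ∫ y, ((hilbert (Θ n) y - hilbert (Θ n) 0 : ℝ) : ℂ) * invol β (g : L1) y = 0 := by
    obtain ⟨ψ, hψ⟩ := exists_inverted_test hβ₀ hβ₁ (hΘs n) (r := 2 - ρ) (by linarith)
      (by linarith [hpos n] : (0 : ℝ) < 2 * (n + 1)) (hin n) (hout n)
    have hψ' : (ψ : ℝ → ℝ) = fun x => Θ n (-β / x) := funext hψ
    have h := LSpace.toDist_mk f g ψ
    rw [hfg, map_zero, action] at h
    rw [integral_mul_invol hβ₀, integral_mul_invol hβ₀ fun y => hilbert (Θ n) y - hilbert (Θ n) 0]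
    refine Eq.trans ?_ h.symm
    congr 1
    · simp_rw [hψ]
    · refine integral_congr_ae ?_
      filter_upwards [compl_mem_ae_iff.2 (measure_singleton (0 : ℝ))] with x hx
      have h1 : ContDiff ℝ 1 fun x => Θ n (-β / x) := by
        rw [← hψ']
        exact test_contDiff_one ψ
      have h2 : HasCompactSupport fun x => Θ n (-β / x) := by
        rw [← hψ']
        exact ψ.hasCompactSupport
      rw [hψ', hilbert_inversion hβ₀ (hΘ1 n) (hΘc n) h1 h2 hx]
  have hlim1 : Tendsto (fun n => ∫ y, (Θ n y : ℂ) * invol β f y) atTop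
      (𝓝 (∫ y, ((q y - φ y : ℝ) : ℂ) * invol β f y)) := by
    refine tendsto_integral_of_dominated_convergence (fun y => 2 * A * ‖invol β f y‖) ?_
      (hf.norm.const_mul _) ?_ ?_
    · intro n
      exact (Complex.continuous_ofReal.comp (hΘ1 n).continuous).aestronglyMeasurable.mul
        hf.aestronglyMeasurable
    · intro n
      refine Eventually.of_forall fun y => ?_
      rw [norm_mul, Complex.norm_real]
      refine mul_le_mul_of_nonneg_right ?_ (norm_nonneg _)
      linarith [norm_sub_le (taper (n + 1) q y) (φ y), norm_taper_le (n + 1) q y, hqA y, hA y]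
    · refine Eventually.of_forall fun y => ?_
      refine tendsto_const_nhds.congr' ?_
      filter_upwards [eventually_ge_atTop ⌈|y|⌉₊] with n hn
      have hn' : |y| ≤ n := (Nat.le_ceil _).trans (by exact_mod_cast hn)
      rw [hΘ]
      beta_reduce
      rw [taper_eq_self (hpos n) q (by linarith)]
  -- The bounds for the tapered transforms are uniform in n and y, so J_β g itself gives the
  -- majorant.
  have hlim2 : Tendsto (fun n => ∫ y, ((hilbert (Θ n) y - hilbert (Θ n) 0 : ℝ) : ℂ) *
      invol β (g : L1) y) atTop
      (𝓝 (∫ y, (((modHilbert q y - modHilbert q 0) - (hilbert φ y - hilbert φ 0) : ℝ) : ℂ) *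
        invol β (g : L1) y)) := by
    refine tendsto_integral_of_dominated_convergence
      (fun y => (2 * C + 2 * B) * ‖invol β (g : L1) y‖) ?_ (hg.norm.const_mul _) ?_ ?_
    · intro n
      exact (Complex.continuous_ofReal.comp ((hilbert_continuous (hΘ1 n) (hΘc n)).sub
        continuous_const)).aestronglyMeasurable.mul hg.aestronglyMeasurable
    · intro n
      refine Eventually.of_forall fun y => ?_
      rw [norm_mul, Complex.norm_real]
      refine mul_le_mul_of_nonneg_right ?_ (norm_nonneg _)
      have hn : (1 : ℝ) ≤ n + 1 := by simp
      rw [hHΘ, hHΘ]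
      refine (norm_sub_le _ _).trans ?_
      linarith [norm_sub_le (hilbert (taper (n + 1) q) y) (hilbert φ y),
        norm_sub_le (hilbert (taper (n + 1) q) 0) (hilbert φ 0), hC _ hn y, hC _ hn 0, hB y, hB 0]
    · refine Eventually.of_forall fun y => ?_
      refine Tendsto.mul_const _ ?_
      refine (Complex.continuous_ofReal.tendsto _).comp ?_
      refine ((tendsto_hilbert_taper hq hqp y).sub_const (hilbert φ y - hilbert φ 0)).congr
        fun n => ?_
      rw [hHΘ, hHΘ]
      ring
  have hfin := (hlim1.sub hlim2).congr fun n => hzero n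
  have hval := tendsto_nhds_unique hfin tendsto_const_nhds
  have bddmul {χ : ℝ → ℝ} {h : ℝ → ℂ} {c : ℝ} (hχ : StronglyMeasurable χ) (hb : ∀ x, ‖χ x‖ ≤ c)
      (hh : Integrable h) : Integrable fun x => (χ x : ℂ) * h x :=
    hh.bdd_mul (c := c) (Complex.continuous_ofReal.comp_stronglyMeasurable hχ).aestronglyMeasurable
      (Eventually.of_forall fun x => by simpa using hb x)
  have i1 := bddmul hq.continuous.stronglyMeasurable hqA hf
  have i2 := bddmul φ.continuous.stronglyMeasurable hA hf
  have i3 := bddmul (modHilbert_stronglyMeasurable hq hqp) hC' hg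
  have i4 := bddmul (hilbert_measurable φ.continuous) hB hg
  have hφval : ∫ x, (modHilbert φ x : ℂ) * invol β (g : L1) x =
      ∫ x, (hilbert φ x : ℂ) * invol β (g : L1) x := by
    simp_rw [modHilbert_eq_hilbert_add hφ hφc]
    push_cast
    simp_rw [add_mul]
    rw [integral_add i4 (hg.const_mul _), integral_const_mul, hg0, mul_zero, add_zero]
  have e1 : ∫ y, ((q y - φ y : ℝ) : ℂ) * invol β f y =
      (∫ y, (q y : ℂ) * invol β f y) - ∫ y, (φ y : ℂ) * invol β f y := by
    rw [← integral_sub i1 i2]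
    congr 1
    ext y
    push_cast
    ring
  have e2 : ∫ y, (((modHilbert q y - modHilbert q 0) - (hilbert φ y - hilbert φ 0) : ℝ) : ℂ) *
      invol β (g : L1) y = (∫ y, (modHilbert q y : ℂ) * invol β (g : L1) y) -
        ∫ y, (hilbert φ y : ℂ) * invol β (g : L1) y := by
    have i34 : Integrable fun y => (modHilbert q y : ℂ) * invol β (g : L1) y -
      (hilbert φ y : ℂ) * invol β (g : L1) y := i3.sub i4
    -- The normalizing constants H̃q(0) and Hφ(0) drop out because J_β g has integral zero.
    rw [← integral_sub i3 i4, ← sub_zero (∫ y, (_ - _)),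
      ← mul_zero ((modHilbert q 0 - hilbert φ 0 : ℝ) : ℂ), ← hg0, ← integral_const_mul,
      ← integral_sub i34 (hg.const_mul _)]
    congr 1
    ext y
    push_cast
    ring
  rw [superAction_eq, hφval, ← hqdef, ← e1, ← e2]
  exact hval

/-! ### Construction of the operator and its action on functions -/

lemma measurable_inversion (β : ℝ) : Measurable fun x : ℝ => -β / x := by fun_prop

/-- For a fixed test function, `⟨φ, Σ₂ J_β (f + Hg)⟩` depends linearly on `(f, g)`. -/
lemma exists_superAction_linear (hβ : 0 < β) (φ : 𝓓(I₁, ℝ)) :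
    ∃ Ψ : (L1 × L10) →ₗ[ℂ] ℂ, ∀ (f : L1) (g : L10),
      superAction φ (invol β f) (invol β (g : L1)) = Ψ (f, g) := by
  obtain ⟨ρ, -, hρ, hz⟩ := test_exists_radius φ
  have hφ := test_contDiff_one φ
  obtain ⟨A, hA⟩ := test_bound φ
  obtain ⟨B, hB⟩ := hilbert_test_bound φ
  have hq := periodize_contDiff hφ hρ hz
  have hqp := periodize_periodic φ
  have hqA := norm_periodize_le hρ hz hA
  obtain ⟨C, hC⟩ := exists_modHilbert_bound hq hqp
  have hm := measurable_inversion β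
  have hmφ : StronglyMeasurable (modHilbert φ) := by
    rw [funext (modHilbert_eq_hilbert_add hφ φ.hasCompactSupport)]
    exact (hilbert_measurable φ.continuous).add stronglyMeasurable_const
  have hbφ : ∀ y, ‖modHilbert φ y‖ ≤ B + ‖(1 / Real.pi) * modConst φ‖ := fun y => by
    rw [modHilbert_eq_hilbert_add hφ φ.hasCompactSupport]
    exact (norm_add_le _ _).trans (add_le_add (hB y) le_rfl)
  obtain ⟨Φ₁, h₁⟩ := exists_integral_mul_CLM
    (hq.continuous.stronglyMeasurable.comp_measurable hm) (fun x => hqA (-β / x))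
  obtain ⟨Φ₂, h₂⟩ := exists_integral_mul_CLM
    (φ.continuous.stronglyMeasurable.comp_measurable hm) (fun x => hA (-β / x))
  obtain ⟨Φ₃, h₃⟩ := exists_integral_mul_CLM
    ((modHilbert_stronglyMeasurable hq hqp).comp_measurable hm) (fun x => hC (-β / x))
  obtain ⟨Φ₄, h₄⟩ := exists_integral_mul_CLM (hmφ.comp_measurable hm) (fun x => hbφ (-β / x))
  refine ⟨(Φ₁ - Φ₂).toLinearMap ∘ₗ LinearMap.fst ℂ L1 L10 -
    (Φ₃ - Φ₄).toLinearMap ∘ₗ L10.subtype ∘ₗ LinearMap.snd ℂ L1 L10, fun f g => ?_⟩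
  rw [superAction_eq, integral_mul_invol hβ, integral_mul_invol hβ, integral_mul_invol hβ,
    integral_mul_invol hβ]
  simp [h₁, h₂, h₃, h₄]

/-- The subtransfer operator on `𝔏(I₁)` exists and is bounded. -/
lemma exists_subtransfer (hβ₀ : 0 < β) (hβ₁ : β ≤ 1) :
    ∃ T : LSpace I₁ →L[ℂ] LSpace I₁, IsSubtransfer β T := by
  choose v hv hvn using fun p : L1 × L10 => exists_subtransfer_value hβ₀ p.1 p.2
  let A : (L1 × L10) →ₗ[ℂ] LSpace I₁ :=
    { toFun := v
      map_add' := fun p p' => by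
        apply LSpace.toDist_injective
        ext φ
        obtain ⟨Ψ, hΨ⟩ := exists_superAction_linear hβ₀ φ
        rw [map_add, add_apply, hv, hv, hv, hΨ, hΨ, hΨ]
        exact map_add Ψ p p'
      map_smul' := fun c p => by
        apply LSpace.toDist_injective
        ext φ
        obtain ⟨Ψ, hΨ⟩ := exists_superAction_linear hβ₀ φ
        rw [map_smul, smul_apply, hv, hv, hΨ, hΨ]
        exact map_smul Ψ c p }
  have hA (p : L1 × L10) : A p = v p := rfl
  have hker (p : L1 × L10) (hp : LSpace.mk I₁ p = 0) : A p = 0 := by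
    apply LSpace.toDist_injective
    ext φ
    rw [hA, hv, superAction_eq_zero hβ₀ hβ₁ hp, map_zero]
    rfl
  -- The linear section s is arbitrary. As A annihilates the kernel of the restriction map, A ∘ s
  -- does not depend on it, and the bound 8 may be taken over every representative.
  obtain ⟨s, hs⟩ := (LSpace.mk I₁).exists_rightInverse_of_surjective
    (LinearMap.range_eq_top.2 LSpace.mk_surjective)
  have hAs (p : L1 × L10) : A (s (LSpace.mk I₁ p)) = A p := by
    rw [← sub_eq_zero, ← map_sub]
    apply hker
    have := LinearMap.congr_fun hs (LSpace.mk I₁ p)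
    rw [map_sub, sub_eq_zero]
    exact this
  refine ⟨(A ∘ₗ s).mkContinuous 8 fun u => ?_, fun f g φ => ?_⟩
  · rw [← div_le_iff₀' (by norm_num)]
    refine LSpace.le_norm fun f g hu => ?_
    rw [div_le_iff₀' (by norm_num), ← hu, LinearMap.comp_apply, hAs]
    exact hvn (f, g)
  · change LSpace.toDist (A (s (LSpace.mk I₁ (f, g)))) φ = _
    rw [hAs, hA, hv]

/-- Unfolding of `Σ₂` on integrable functions. -/
lemma integral_periodize_sub_mul {φ : ℝ → ℝ} {ρ : ℝ} (hφ : Continuous φ) (hρ : ρ < 1)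
    (hz : ∀ x, ρ < |x| → φ x = 0) {F : ℝ → ℂ} (hF : Integrable F) :
    (∫ x, (periodize φ x : ℂ) * F x) - ∫ x, (φ x : ℂ) * F x =
      ∫ x in Set.Ioo (-1 : ℝ) 1, (φ x : ℂ) * ∑' j : {j : ℤ // j ≠ 0}, F (2 * (j : ℤ) + x) := by
  obtain ⟨A, hA⟩ := (hasCompactSupport_of_zero hz).exists_bound_of_continuous hφ
  have hbdd {χ : ℝ → ℝ} {h : ℝ → ℂ} (hχ : Continuous χ) (hb : ∀ x, ‖χ x‖ ≤ A)
      (hh : Integrable h) : Integrable fun x => (χ x : ℂ) * h x :=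
    hh.bdd_mul (c := A) (Complex.continuous_ofReal.comp hχ).aestronglyMeasurable
      (Eventually.of_forall fun x => by simpa using hb x)
  let S : {j : ℤ // j ≠ 0} → ℝ → ℂ := fun j x => (φ x : ℂ) * F (2 * (j : ℤ) + x)
  let G : {j : ℤ // j ≠ 0} → ℝ → ℂ := fun j y => (φ (y - 2 * (j : ℤ)) : ℂ) * F y
  have hSi (j) : Integrable (S j) := hbdd hφ hA (hF.comp_add_left _)
  have hGi (j) : Integrable (G j) := hbdd (by fun_prop) (fun x => hA _) hF
  have hSG (j) (x : ℝ) : S j x = G j (x + 2 * (j : ℤ)) := by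
    simp only [S, G, add_sub_cancel_right, add_comm]
  have hint (j) : ∫ x, S j x = ∫ y, G j y := by
    simp_rw [hSG]
    exact integral_add_right_eq_self (G j) _
  have hnorm (j) : ∫ x, ‖S j x‖ = ∫ y, ‖G j y‖ := by
    simp_rw [hSG]
    exact integral_add_right_eq_self (fun y => ‖G j y‖) _
  have hz' : ∀ x, ρ < |x| → |φ x| = 0 := fun x hx => by rw [hz x hx, abs_zero]
  -- At most one translate of φ is nonzero at y. This domination justifies exchanging sum and
  -- integral.
  have hsum_le (s : Finset {j : ℤ // j ≠ 0}) (y : ℝ) :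
      ∑ j ∈ s, ‖G j y‖ ≤ A * ‖F y‖ := by
    simp only [G, norm_mul, ← Finset.sum_mul]
    refine mul_le_mul_of_nonneg_right ?_ (norm_nonneg _)
    have hA0 := (norm_nonneg _).trans (hA 0)
    have hb := norm_periodize_le (φ := fun x => |φ x|) hρ hz' (C := A)
      (fun x => by simpa using hA x) y
    have hsm := summable_periodize (φ := fun x => |φ x|) hρ hz' y
    have hinj : Function.Injective fun j : {j : ℤ // j ≠ 0} => -(j : ℤ) :=
      fun a b h => Subtype.ext (neg_injective h)
    have := hsm.sum_le_tsum (s.map ⟨_, hinj⟩) fun _ _ => abs_nonneg _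
    rw [Finset.sum_map] at this
    refine le_trans (le_of_eq ?_) (this.trans ((le_abs_self _).trans hb))
    refine Finset.sum_congr rfl fun j _ => ?_
    simp only [Function.Embedding.coeFn_mk, Complex.norm_real, Real.norm_eq_abs]
    push_cast
    rw [mul_neg, ← sub_eq_add_neg]
  have hGs : Summable fun j => ∫ y, ‖G j y‖ := by
    refine summable_of_sum_le (c := A * ∫ y, ‖F y‖)
      (fun j => integral_nonneg fun _ => norm_nonneg _) fun s => ?_
    rw [← integral_finsetSum _ fun j _ => (hGi j).norm, ← integral_const_mul]
    exact integral_mono (integrable_finsetSum _ fun j _ => (hGi j).norm) (hF.norm.const_mul A)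
      (hsum_le s)
  have hSs : Summable fun j => ∫ y, ‖S j y‖ := by
    simp_rw [hnorm]
    exact hGs
  have h1 := hasSum_integral_of_summable_integral_norm hSi hSs
  have h2 := hasSum_integral_of_summable_integral_norm hGi hGs
  simp_rw [hint] at h1
  have h3 := h1.unique h2
  have h4 (y : ℝ) : ∑' j, G j y = (periodize φ y : ℂ) * F y - (φ y : ℂ) * F y := by
    have hsm := summable_periodize hρ hz y
    have e1 : periodize φ y = φ y + ∑' j : {j : ℤ // j ≠ 0}, φ (y - 2 * (j : ℤ)) := by
      unfold periodize
      rw [← (Equiv.neg ℤ).tsum_eq fun j : ℤ => φ (y + 2 * j)]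
      have hsm' : Summable fun j : ℤ => φ (y + 2 * ((Equiv.neg ℤ j : ℤ) : ℝ)) :=
        (Equiv.neg ℤ).summable_iff.2 hsm
      rw [hsm'.tsum_eq_add_tsum_ite 0, ← tsum_subtype_eq_of_support_subset
        (s := {j : ℤ | j ≠ 0})]
      · congr 1
        · simp
        · refine tsum_congr fun j => ?_
          have hj : (j : ℤ) ≠ 0 := j.2
          rw [if_neg hj, Equiv.neg_apply]
          push_cast
          rw [mul_neg, ← sub_eq_add_neg]
      · intro j hj
        rw [Function.mem_support] at hj
        intro h0
        exact hj (if_pos h0)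
    simp only [G]
    rw [tsum_mul_right, e1, ← Complex.ofReal_tsum]
    push_cast
    ring
  have h5 : ∫ x, ∑' j, S j x =
      ∫ x in Set.Ioo (-1 : ℝ) 1, (φ x : ℂ) * ∑' j : {j : ℤ // j ≠ 0}, F (2 * (j : ℤ) + x) := by
    rw [setIntegral_eq_integral_of_forall_compl_eq_zero]
    · simp only [S, tsum_mul_left]
    · intro x hx
      have : 1 ≤ |x| := by
        rw [Set.mem_Ioo, ← abs_lt, not_lt] at hx
        exact hx
      rw [hz x (by linarith), Complex.ofReal_zero, zero_mul]
  rw [← h5, h3, ← integral_sub]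
  · congr 1
    ext y
    rw [h4]
  · exact hbdd (χ := periodize φ) ((periodize_contDiff (n := 0) (contDiff_zero.2 hφ) hρ hz).continuous)
      (norm_periodize_le hρ hz hA) hF
  · exact hbdd hφ hA hF

lemma integral_mul_invol_zero (hβ : 0 < β) (χ : ℝ → ℝ) :
    ∫ x, (χ x : ℂ) * invol β (0 : L1) x = 0 := by
  rw [integral_mul_invol hβ, ← integral_zero ℝ ℂ (μ := volume)]
  refine integral_congr_ae ((Lp.coeFn_zero ℂ 1 volume).mono fun x hx => ?_)
  beta_reduce
  rw [hx, Pi.zero_apply, mul_zero]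

/-- The subtransfer operator on `𝔏(I₁)` extends the one on functions. -/
lemma IsSubtransfer.apply_function (hβ : 0 < β) {T : LSpace I₁ →ₗ[ℂ] LSpace I₁}
    (hT : IsSubtransfer β T) (f : L1) (φ : 𝓓(I₁, ℝ)) :
    (T (LSpace.mk I₁ (f, 0))).toDist φ =
      ∫ x in Set.Ioo (-1 : ℝ) 1, (φ x : ℂ) * subtransferFun β f x := by
  obtain ⟨ρ, -, hρ, hz⟩ := test_exists_radius φ
  rw [hT, superAction_eq, Submodule.coe_zero, integral_mul_invol_zero hβ,
    integral_mul_invol_zero hβ, sub_self, sub_zero,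
    integral_periodize_sub_mul φ.continuous hρ hz (integrable_invol hβ (L1.integrable_coeFn f))]
  rfl

end Subtransfer

/-! ### The norm of the subtransfer operator -/

section NormBound

variable {φ : ℝ → ℝ} {ρ : ℝ}

lemma integrable_div_sub (hφ : Continuous φ) (hz : ∀ t, ρ < |t| → φ t = 0) {x : ℝ}
    (hx : ρ < |x|) : Integrable fun t => φ t / (x - t) := by
  refine Continuous.integrable_of_hasCompactSupport ?_
    (hasCompactSupport_of_zero (R := ρ) fun t ht => by rw [hz t ht, zero_div])
  rw [continuous_iff_continuousAt]
  intro t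
  rcases eq_or_ne x t with rfl | h
  · refine (continuousAt_const (y := (0 : ℝ))).congr ?_
    filter_upwards [(continuous_abs.isOpen_preimage _ isOpen_Ioi).mem_nhds
      (show x ∈ (fun x : ℝ => |x|) ⁻¹' Set.Ioi ρ from hx)] with s hs
    rw [hz s hs, zero_div]
  · exact hφ.continuousAt.div (by fun_prop) (sub_ne_zero.2 h)

lemma hilbert_eq_of_lt_abs (hφ : Continuous φ) (hz : ∀ t, ρ < |t| → φ t = 0) {x : ℝ}
    (hx : ρ < |x|) : hilbert φ x = (1 / Real.pi) * ∫ t, φ t / (x - t) := by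
  refine hilbert_eq_of_zero_near (hφ.integrable_of_hasCompactSupport
    (hasCompactSupport_of_zero hz)) (sub_pos.2 hx) fun t ht => hz t ?_
  linarith [abs_sub_abs_le_abs_sub x t]

/-- To the right of the support each kernel 1 / (x - t) is positive and decreasing in x. -/
lemma hilbert_antitone_right (hφ : Continuous φ) (hz : ∀ t, ρ < |t| → φ t = 0)
    (h0 : ∀ t, 0 ≤ φ t) {x y : ℝ} (hx : ρ < x) (hxy : x ≤ y) :
    hilbert φ y ≤ hilbert φ x := by
  have hx' : ρ < |x| := hx.trans_le (le_abs_self x)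
  have hy' : ρ < |y| := (hx.trans_le hxy).trans_le (le_abs_self y)
  rw [hilbert_eq_of_lt_abs hφ hz hx', hilbert_eq_of_lt_abs hφ hz hy']
  refine mul_le_mul_of_nonneg_left (integral_mono (integrable_div_sub hφ hz hy')
    (integrable_div_sub hφ hz hx') fun t => ?_) (by positivity)
  rcases lt_or_ge ρ |t| with ht | ht
  · simp [hz t ht]
  · have : t ≤ ρ := (le_abs_self t).trans ht
    exact div_le_div_of_nonneg_left (h0 t) (by linarith) (by linarith)

lemma hilbert_nonneg_right (hφ : Continuous φ) (hz : ∀ t, ρ < |t| → φ t = 0)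
    (h0 : ∀ t, 0 ≤ φ t) {x : ℝ} (hx : ρ < x) : 0 ≤ hilbert φ x := by
  have hx' : ρ < |x| := hx.trans_le (le_abs_self x)
  rw [hilbert_eq_of_lt_abs hφ hz hx']
  refine mul_nonneg (by positivity) (integral_nonneg fun t => ?_)
  rcases lt_or_ge ρ |t| with ht | ht
  · simp [hz t ht]
  · have : t ≤ ρ := (le_abs_self t).trans ht
    exact div_nonneg (h0 t) (by linarith)

/-- The size of the Hilbert transform at a few points far from the support. -/
lemma hilbert_far_lower_bound (hφ : Continuous φ) (hz : ∀ t, 1 / 40 < |t| → φ t = 0)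
    (h0 : ∀ t, 0 ≤ φ t) {s : ℝ} (hs : |s| ≤ 1 / 20) :
    (1 / Real.pi) * (1 / 100 * ∫ t, φ t) ≤
      hilbert φ (2 + s) - hilbert φ (4 - s) - hilbert φ (6 - s) := by
  obtain ⟨hs1, hs2⟩ := abs_le.1 hs
  have e2 : 1 / 40 < |2 + s| := by rw [abs_of_pos (by linarith)]; linarith
  have e4 : 1 / 40 < |4 - s| := by rw [abs_of_pos (by linarith)]; linarith
  have e6 : 1 / 40 < |6 - s| := by rw [abs_of_pos (by linarith)]; linarith
  have i2 := integrable_div_sub hφ hz e2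
  have i4 := integrable_div_sub hφ hz e4
  have i6 := integrable_div_sub hφ hz e6
  have i24 : Integrable fun t => φ t / (2 + s - t) - φ t / (4 - s - t) := i2.sub i4
  have hi := hφ.integrable_of_hasCompactSupport (hasCompactSupport_of_zero hz) (μ := volume)
  rw [hilbert_eq_of_lt_abs hφ hz e2, hilbert_eq_of_lt_abs hφ hz e4,
    hilbert_eq_of_lt_abs hφ hz e6, ← mul_sub, ← mul_sub, ← integral_sub i2 i4,
    ← integral_sub i24 i6, ← integral_const_mul]
  refine mul_le_mul_of_nonneg_left (integral_mono (hi.const_mul _) (i24.sub i6) fun t => ?_)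
    (by positivity)
  beta_reduce
  rcases lt_or_ge (1 / 40) |t| with ht | ht
  · simp [hz t ht]
  · obtain ⟨ht1, ht2⟩ := abs_le.1 ht
    -- The extreme denominators for |s| ≤ 1/20 and |t| ≤ 1/40. At s = t = 0 the kernel equals 1/2 -
    -- 1/4 - 1/6 = 1/12, which leaves room for the lower bound 1/100.
    have a2 : 1 / (83 / 40) ≤ 1 / (2 + s - t) := one_div_le_one_div_of_le (by linarith) (by linarith)
    have a4 : 1 / (4 - s - t) ≤ 1 / (157 / 40) :=
      one_div_le_one_div_of_le (by norm_num) (by linarith)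
    have a6 : 1 / (6 - s - t) ≤ 1 / (237 / 40) :=
      one_div_le_one_div_of_le (by norm_num) (by linarith)
    have hk : 1 / 100 ≤ 1 / (2 + s - t) - 1 / (4 - s - t) - 1 / (6 - s - t) := by
      norm_num at a2 a4 a6 ⊢
      linarith
    have := mul_le_mul_of_nonneg_right hk (h0 t)
    calc 1 / 100 * φ t ≤ _ := this
      _ = _ := by ring

/-- The difference of the modified Hilbert transforms of `Σ₂ φ` at `-2 + s` and `2 - s`. -/
lemma modHilbert_difference_lower_bound (hφ : ContDiff ℝ 1 φ) (hz : ∀ t, 1 / 40 < |t| → φ t = 0)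
    (h0 : ∀ t, 0 ≤ φ t) (he : ∀ t, φ (-t) = φ t) {s : ℝ} (hs : |s| ≤ 1 / 20) :
    2 * hilbert φ s + 2 * ((1 / Real.pi) * (1 / 100 * ∫ t, φ t)) ≤
      (modHilbert (periodize φ) (-2 + s) - modHilbert φ (-2 + s)) -
        (modHilbert (periodize φ) (2 - s) - modHilbert φ (2 - s)) := by
  obtain ⟨hs1, hs2⟩ := abs_le.1 hs
  have hρ : (1 / 40 : ℝ) < 1 := by norm_num
  have hc := hasCompactSupport_of_zero hz
  obtain ⟨A, hA⟩ := hc.exists_bound_of_continuous hφ.continuous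
  have hy1 : |-2 + s| < 2 * (2 : ℕ) + 1 := by rw [abs_lt]; constructor <;> push_cast <;> linarith
  have hy2 : |2 - s| < 2 * (2 : ℕ) + 1 := by rw [abs_lt]; constructor <;> push_cast <;> linarith
  have hlow := hilbert_far_lower_bound hφ.continuous hz h0 hs
  rw [modHilbert_periodize_eq hφ hρ hz hy1, modHilbert_periodize_eq hφ hρ hz hy2,
    modHilbert_eq_hilbert_add hφ hc, modHilbert_eq_hilbert_add hφ hc]
  set χ : ℝ → ℝ := fun t => periodize φ t - partialPeriodize 2 φ t with hχ
  have hχz (t : ℝ) (ht : |t| < 5) : χ t = 0 := by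
    rw [hχ]
    beta_reduce
    rw [partialPeriodize_eq_periodize hρ hz (by push_cast; linarith), sub_self]
  have hχe (t : ℝ) (ht : 5 ≤ |t|) : χ t = periodize φ t := by
    rw [hχ]
    beta_reduce
    rw [partialPeriodize_eq_zero hρ hz (by push_cast; linarith), sub_zero]
  have hχc : Continuous χ :=
    (periodize_contDiff hφ hρ hz).continuous.sub (partialPeriodize_contDiff hφ 2).continuous
  have hχb (t : ℝ) : ‖χ t‖ ≤ A := by
    rcases lt_or_ge |t| 5 with ht | ht
    · rw [hχz t ht, norm_zero]
      exact (norm_nonneg _).trans (hA 0)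
    · rw [hχe t ht]
      exact norm_periodize_le hρ hz hA t
  have hχi {y : ℝ} (hy : |y| ≤ 4) : Integrable fun t => χ t * modKernel y t := by
    refine integrable_mul_modKernel hχc hχb one_pos fun t ht => hχz t ?_
    have := abs_sub_abs_le_abs_sub t y
    rw [abs_sub_comm] at this
    linarith
  have i1 := hχi (y := -2 + s) (by rw [abs_le]; constructor <;> linarith)
  have i2 := hχi (y := 2 - s) (by rw [abs_le]; constructor <;> linarith)
  have hfar : ∫ t, χ t * modKernel (2 - s) t ≤ ∫ t, χ t * modKernel (-2 + s) t := by
    refine integral_mono i2 i1 fun t => ?_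
    beta_reduce
    rcases lt_or_ge |t| 5 with ht | ht
    · rw [hχz t ht, zero_mul, zero_mul]
    · rw [hχe t ht]
      refine mul_le_mul_of_nonneg_left ?_ (periodize_nonneg h0 t)
      unfold modKernel
      -- For |t| ≥ 5 the two denominators have the same sign and the left one is the larger, so the
      -- tail favours -2 + s.
      have : 1 / (2 - s - t) ≤ 1 / (-2 + s - t) := by
        rcases le_abs.1 ht with h | h
        · exact one_div_le_one_div_of_neg_of_le (by linarith) (by linarith)
        · exact one_div_le_one_div_of_le (by linarith) (by linarith)
      linarith
  have hfar' := mul_le_mul_of_nonneg_left hfar (by positivity : 0 ≤ 1 / Real.pi)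
  have hsum (y : ℝ) : ∑ j ∈ Finset.Icc (-(2 : ℕ) : ℤ) (2 : ℕ), hilbert φ (y + 2 * j) =
      hilbert φ (y - 4) + hilbert φ (y - 2) + hilbert φ y + hilbert φ (y + 2) +
        hilbert φ (y + 4) := by
    have : Finset.Icc (-(2 : ℕ) : ℤ) (2 : ℕ) = {-2, -1, 0, 1, 2} := rfl
    rw [this]
    rw [Finset.sum_insert (by decide), Finset.sum_insert (by decide),
      Finset.sum_insert (by decide), Finset.sum_insert (by decide), Finset.sum_singleton]
    push_cast
    ring_nf
  -- The terms j = 0 cancel against H̃φ and the constants cancel in the difference. By oddness what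
  -- remains of the translates is 2Hφ(s) + 2(Hφ(2 + s) - Hφ(4 - s) - Hφ(6 - s)).
  have odd := hilbert_neg_of_even he
  have o1 : hilbert φ (-2 + s - 4) = -hilbert φ (6 - s) := by rw [← odd]; congr 1; ring
  have o2 : hilbert φ (-2 + s - 2) = -hilbert φ (4 - s) := by rw [← odd]; congr 1; ring
  have o3 : hilbert φ (-2 + s + 2) = hilbert φ s := by congr 1; ring
  have o4 : hilbert φ (-2 + s + 4) = hilbert φ (2 + s) := by congr 1; ring
  have o5 : hilbert φ (2 - s - 4) = -hilbert φ (2 + s) := by rw [← odd]; congr 1; ring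
  have o6 : hilbert φ (2 - s - 2) = -hilbert φ s := by rw [← odd]; congr 1; ring
  have o7 : hilbert φ (2 - s + 2) = hilbert φ (4 - s) := by congr 1; ring
  have o8 : hilbert φ (2 - s + 4) = hilbert φ (6 - s) := by congr 1; ring
  rw [hsum, hsum, o1, o2, o3, o4, o5, o6, o7, o8]
  linarith

/-- The pairing with a test function is controlled by uniform bounds for it and its Hilbert
transform. -/
lemma norm_toDist_le (φ : 𝓓(I₁, ℝ)) {M : ℝ} (h1 : ∀ x, ‖φ x‖ ≤ M) (h2 : ∀ x, ‖hilbert φ x‖ ≤ M)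
    (u : LSpace I₁) : ‖u.toDist φ‖ ≤ M * ‖u‖ := by
  have hM : 0 ≤ M := (norm_nonneg _).trans (h1 0)
  have key (f : L1) (g : L10) (hu : LSpace.mk I₁ (f, g) = u) :
      ‖u.toDist φ‖ ≤ M * (‖f‖ + ‖g‖) := by
    rw [← hu, LSpace.toDist_mk, mul_add]
    exact (norm_sub_le _ _).trans (add_le_add (norm_integral_mul_L1_le h1 f)
      (norm_integral_mul_L1_le h2 g))
  -- Passing to the infimum requires division by M, so M = 0 is separate.
  rcases hM.eq_or_lt with h | h
  · obtain ⟨⟨f, g⟩, hu⟩ := LSpace.mk_surjective u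
    have := key f g hu
    rw [← h, zero_mul] at this ⊢
    exact this
  · rw [← div_le_iff₀' h]
    refine LSpace.le_norm fun f g hu => ?_
    rw [div_le_iff₀' h]
    exact key f g hu

/-- A test function with nearly vertical flanks is dominated by its Hilbert transform. -/
lemma exists_flat_bump : ∃ φ : 𝓓(I₁, ℝ), (∀ t, 201 / 10000 < |t| → φ t = 0) ∧ (∀ t, 0 ≤ φ t) ∧
    (∀ t, φ (-t) = φ t) ∧ (∀ t, φ t ≤ 1) ∧ 0 < ∫ t, φ t ∧ 1 ≤ hilbert φ (202 / 10000) := by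
  let b : ContDiffBump (0 : ℝ) := ⟨200 / 10000, 201 / 10000, by norm_num, by norm_num⟩
  have hz (t : ℝ) (ht : 201 / 10000 < |t|) : b t = 0 :=
    b.zero_of_le_dist (by rw [dist_zero_right]; exact ht.le)
  have hsub : tsupport b ⊆ (I₁ : Set ℝ) := by
    rw [b.tsupport_eq]
    intro x hx
    rw [Metric.mem_closedBall, dist_zero_right, Real.norm_eq_abs] at hx
    have : (201 / 10000 : ℝ) < 1 := by norm_num
    exact abs_lt.1 (lt_of_le_of_lt hx this)
  refine ⟨⟨b, b.contDiff, b.hasCompactSupport, hsub⟩, hz, fun t => b.nonneg, fun t => b.neg t,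
    fun t => b.le_one, b.integral_pos, ?_⟩
  change 1 ≤ hilbert b (202 / 10000)
  have hx : (201 / 10000 : ℝ) < |202 / 10000| := by
    rw [abs_of_pos (by norm_num)]
    norm_num
  have hi := integrable_div_sub b.continuous hz hx
  rw [hilbert_eq_of_lt_abs b.continuous hz hx, one_div, le_inv_mul_iff₀ Real.pi_pos, mul_one]
  -- The plateau alone contributes log(402/2) = log 201 at a point just beyond the flank; this
  -- exceeds π, as e^π ≤ e⁴ < 81.
  have h1 : ∫ t in (-(200 / 10000) : ℝ)..(200 / 10000), 1 / (202 / 10000 - t) = Real.log 201 := by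
    rw [intervalIntegral.integral_comp_sub_left (fun t : ℝ => 1 / t),
      integral_one_div_of_pos (by norm_num) (by norm_num)]
    norm_num
  have h2 : Real.pi ≤ Real.log 201 := by
    rw [Real.le_log_iff_exp_le (by norm_num)]
    have e : Real.exp 4 = Real.exp 1 ^ 4 := by rw [← Real.exp_nat_mul]; norm_num
    have := Real.exp_one_lt_d9
    calc Real.exp Real.pi ≤ Real.exp 4 := Real.exp_le_exp.2 Real.pi_le_four
      _ = Real.exp 1 ^ 4 := e
      _ ≤ 3 ^ 4 := pow_le_pow_left₀ (Real.exp_pos 1).le (by linarith) 4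
      _ ≤ 201 := by norm_num
  refine h2.trans (h1 ▸ ?_)
  rw [intervalIntegral.integral_of_le (by norm_num)]
  have h3 : ∫ t in Set.Ioc (-(200 / 10000) : ℝ) (200 / 10000), 1 / (202 / 10000 - t) =
      ∫ t in Set.Ioc (-(200 / 10000) : ℝ) (200 / 10000), b t / (202 / 10000 - t) := by
    refine setIntegral_congr_fun measurableSet_Ioc fun t ht => ?_
    rw [b.one_of_mem_closedBall]
    rw [Metric.mem_closedBall, dist_zero_right]
    exact abs_le.2 ⟨ht.1.le, ht.2⟩
  rw [h3]
  refine setIntegral_le_integral hi (Eventually.of_forall fun t => ?_)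
  rcases lt_or_ge (201 / 10000) |t| with ht | ht
  · simp [hz t ht]
  · have : t ≤ 201 / 10000 := (le_abs_self t).trans ht
    exact div_nonneg b.nonneg (by linarith)

/-- The extremal property of the Hilbert transform of an even bump: it takes its largest absolute
value, with positive sign, near the support. -/
lemma exists_hilbert_max {φ : ℝ → ℝ} (hφ : ContDiff ℝ 1 φ)
    (hz : ∀ t, 201 / 10000 < |t| → φ t = 0) (h0 : ∀ t, 0 ≤ φ t) (he : ∀ t, φ (-t) = φ t) :
    ∃ s, |s| ≤ 1 / 40 ∧ ∀ x, |hilbert φ x| ≤ hilbert φ s := by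
  have hcont := hilbert_continuous hφ (hasCompactSupport_of_zero hz)
  have hodd := hilbert_neg_of_even he
  obtain ⟨a, ha, hmax⟩ := isCompact_Icc.exists_isMaxOn (s := Set.Icc (-(1 / 40) : ℝ) (1 / 40))
    ⟨0, by norm_num⟩ (f := fun x => |hilbert φ x|) hcont.abs.continuousOn
  -- Outside [-1/40, 1/40] oddness reduces to the right side, where Hφ is nonnegative and
  -- decreasing, hence at most its value at 1/40.
  have hall (x : ℝ) : |hilbert φ x| ≤ |hilbert φ a| := by
    rcases le_or_gt |x| (1 / 40) with hx | hx
    · exact hmax (abs_le.1 hx)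
    · have hx' : |hilbert φ x| = |hilbert φ (|x|)| := by
        rcases abs_cases x with ⟨h, _⟩ | ⟨h, _⟩
        · rw [h]
        · rw [h, hodd, abs_neg]
      have hlt : (201 / 10000 : ℝ) < 1 / 40 := by norm_num
      have h1 := hilbert_antitone_right hφ.continuous hz h0 hlt hx.le
      have h2 := hilbert_nonneg_right hφ.continuous hz h0 (hlt.trans hx)
      have h3 : |hilbert φ (1 / 40)| ≤ |hilbert φ a| := hmax (by norm_num)
      rw [hx', abs_of_nonneg h2]
      exact h1.trans ((le_abs_self _).trans h3)
  -- If the extreme value at a is negative, oddness makes it positive at -a.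
  rcases le_total 0 (hilbert φ a) with h | h
  · exact ⟨a, abs_le.2 ha, fun x => (hall x).trans_eq (abs_of_nonneg h)⟩
  · refine ⟨-a, by rw [abs_neg]; exact abs_le.2 ha, fun x => (hall x).trans_eq ?_⟩
    rw [abs_of_nonpos h, hodd]

/-- J_β is an involution, so any integrable h can be prescribed as J_β g. The detour through the
inversion is needed because g is only an almost-everywhere class. -/
lemma integral_mul_invol_toL1_invol {β : ℝ} (hβ : 0 < β) {h : ℝ → ℂ}
    (hh : Integrable (invol β h)) (χ : ℝ → ℝ) :
    ∫ x, (χ x : ℂ) * invol β (hh.toL1 _) x = ∫ x, (χ x : ℂ) * h x := by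
  rw [integral_mul_invol hβ, integral_toL1_mul hh fun x => χ (-β / x), ← integral_mul_invol hβ]
  refine integral_congr_ae ?_
  filter_upwards [compl_mem_ae_iff.2 (measure_singleton (0 : ℝ))] with x hx
  rw [invol_invol hβ h hx]

/-- The difference of the indicators of two intervals of length `2δ` around `a` and `b`. -/
def indicatorDiff (a b δ : ℝ) (x : ℝ) : ℂ :=
  (Set.Ioc (a - δ) (a + δ)).indicator (fun _ => (1 : ℂ)) x -
    (Set.Ioc (b - δ) (b + δ)).indicator (fun _ => (1 : ℂ)) x

lemma integrable_indicator_Ioc (a δ : ℝ) :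
    Integrable ((Set.Ioc (a - δ) (a + δ)).indicator fun _ : ℝ => (1 : ℂ)) :=
  (integrable_indicator_iff measurableSet_Ioc).2 (integrableOn_const (by simp))

lemma integrable_indicatorDiff (a b δ : ℝ) : Integrable (indicatorDiff a b δ) :=
  (integrable_indicator_Ioc a δ).sub (integrable_indicator_Ioc b δ)

lemma integral_norm_indicatorDiff_le (a b : ℝ) {δ : ℝ} (hδ : 0 ≤ δ) :
    ∫ x, ‖indicatorDiff a b δ x‖ ≤ 4 * δ := by
  have hv (a : ℝ) : ∫ x, ‖(Set.Ioc (a - δ) (a + δ)).indicator (fun _ : ℝ => (1 : ℂ)) x‖ =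
      2 * δ := by
    simp_rw [norm_indicator_eq_indicator_norm]
    rw [integral_indicator measurableSet_Ioc]
    simp only [norm_one, integral_const, smul_eq_mul, mul_one, measureReal_restrict_apply_univ]
    rw [Real.volume_real_Ioc_of_le (by linarith)]
    ring
  refine (integral_mono (integrable_indicatorDiff a b δ).norm
    ((integrable_indicator_Ioc a δ).norm.add (integrable_indicator_Ioc b δ).norm)
    fun x => norm_sub_le _ _).trans (le_of_eq ?_)
  rw [integral_add' (integrable_indicator_Ioc a δ).norm (integrable_indicator_Ioc b δ).norm, hv, hv]
  ring

lemma integral_mul_indicatorDiff {D : ℝ → ℝ} (hD : StronglyMeasurable D) {C : ℝ}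
    (hC : ∀ x, ‖D x‖ ≤ C) (a b : ℝ) {δ : ℝ} (hδ : 0 ≤ δ) :
    ∫ x, (D x : ℂ) * indicatorDiff a b δ x =
      ((∫ s in (-δ)..δ, (D (a + s) - D (b - s)) : ℝ) : ℂ) := by
  have hi (u v : ℝ) : IntervalIntegrable D volume u v := by
    refine (intervalIntegrable_const (c := C) (μ := volume) (a := u) (b := v)).mono_fun
      hD.aestronglyMeasurable (Eventually.of_forall fun x => ?_)
    exact (hC x).trans (le_abs_self C)
  have hind (a : ℝ) : Integrable fun x =>
      (D x : ℂ) * (Set.Ioc (a - δ) (a + δ)).indicator (fun _ => (1 : ℂ)) x :=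
    (integrable_indicator_Ioc a δ).bdd_mul (c := C)
      (Complex.continuous_ofReal.comp_stronglyMeasurable hD).aestronglyMeasurable
      (Eventually.of_forall fun x => by simpa using hC x)
  have hval (a : ℝ) : ∫ x, (D x : ℂ) * (Set.Ioc (a - δ) (a + δ)).indicator (fun _ => (1 : ℂ)) x =
      ((∫ x in (a - δ)..(a + δ), D x : ℝ) : ℂ) := by
    rw [intervalIntegral.integral_of_le (by linarith), ← integral_complex_ofReal,
      ← integral_indicator measurableSet_Ioc]
    congr 1
    ext x
    simp only [Set.indicator_apply]
    split_ifs <;> simp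
  unfold indicatorDiff
  simp_rw [mul_sub]
  have e1 : ∫ s in (-δ)..δ, D (a + s) = ∫ x in (a - δ)..(a + δ), D x := by
    rw [intervalIntegral.integral_comp_add_left]
    rfl
  have e2 : ∫ s in (-δ)..δ, D (b - s) = ∫ x in (b - δ)..(b + δ), D x := by
    rw [intervalIntegral.integral_comp_sub_left, sub_neg_eq_add]
  have j1 : IntervalIntegrable (fun s => D (a + s)) volume (-δ) δ := by
    simpa using (hi (a - δ) (a + δ)).comp_add_left a
  have j2 : IntervalIntegrable (fun s => D (b - s)) volume (-δ) δ := by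
    simpa using (hi (b + δ) (b - δ)).comp_sub_left b
  rw [integral_sub (hind a) (hind b), hval, hval, ← Complex.ofReal_sub, ← e1, ← e2,
    ← intervalIntegral.integral_sub j1 j2]

/-- The subtransfer operator is not a contraction. -/
lemma IsSubtransfer.one_lt_norm {β : ℝ} (hβ : 0 < β) {T : LSpace I₁ →L[ℂ] LSpace I₁}
    (hT : IsSubtransfer β T) : 1 < ‖T‖ := by
  by_contra! hle
  obtain ⟨φ, hz, h0, he, h1, hm, hone⟩ := exists_flat_bump
  have hφ := test_contDiff_one φ
  have hρ : (201 / 10000 : ℝ) < 1 := by norm_num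
  have hz' : ∀ t, 1 / 40 < |t| → φ t = 0 := fun t ht => hz t (by linarith)
  obtain ⟨s, hs, hmax⟩ := exists_hilbert_max hφ hz h0 he
  set M := hilbert φ s with hM
  have hM1 : 1 ≤ M := hone.trans ((le_abs_self _).trans (hmax _))
  set κ := (1 / Real.pi) * (1 / 100 * ∫ t, φ t) with hκ
  have hκ0 : 0 < κ := by positivity
  have hφM : ∀ x, ‖φ x‖ ≤ M := fun x => by
    rw [Real.norm_of_nonneg (h0 x)]
    exact (h1 x).trans hM1
  have hq := periodize_contDiff hφ hρ hz
  have hqp := periodize_periodic φ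
  obtain ⟨C, hC⟩ := exists_modHilbert_bound hq hqp
  -- the function dual to the action on the conjugate part
  set D : ℝ → ℝ := fun y => modHilbert (periodize φ) y - modHilbert φ y with hD
  have hmφ : StronglyMeasurable (modHilbert φ) := by
    rw [funext (modHilbert_eq_hilbert_add hφ φ.hasCompactSupport)]
    exact (hilbert_measurable φ.continuous).add stronglyMeasurable_const
  have hbφ : ∀ y, ‖modHilbert φ y‖ ≤ M + ‖(1 / Real.pi) * modConst φ‖ := fun y => by
    rw [modHilbert_eq_hilbert_add hφ φ.hasCompactSupport]
    exact (norm_add_le _ _).trans (add_le_add (hmax y) le_rfl)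
  have hDm : StronglyMeasurable D := (modHilbert_stronglyMeasurable hq hqp).sub hmφ
  have hDb : ∀ y, ‖D y‖ ≤ C + (M + ‖(1 / Real.pi) * modConst φ‖) := fun y =>
    (norm_sub_le _ _).trans (add_le_add (hC y) (hbφ y))
  have hcont := (hilbert_continuous hφ φ.hasCompactSupport).continuousAt (x := s)
  obtain ⟨δ₀, hδ₀, hnear⟩ := Metric.continuousAt_iff.1 hcont (κ / 2) (by positivity)
  -- On |t| ≤ δ the value Hφ(s + t) stays above M - κ/2, so 2Hφ(s + t) + 2κ ≥ 2M + κ. The cap 1/40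
  -- keeps |s + t| ≤ 1/20.
  set δ := min (δ₀ / 2) (1 / 40) with hδdef
  have hδ : 0 < δ := lt_min (by positivity) (by norm_num)
  have hδ1 : δ < δ₀ := (min_le_left _ _).trans_lt (by linarith)
  have hδ2 : δ ≤ 1 / 40 := min_le_right _ _
  have hlow : ∀ t ∈ Set.Icc (-δ) δ, 2 * M + κ ≤ D (-2 + s + t) - D (2 - s - t) := by
    intro t ht
    have ht' : |t| ≤ δ := abs_le.2 ht
    have hst : |s + t| ≤ 1 / 20 := (abs_add_le s t).trans (by linarith)
    have h := modHilbert_difference_lower_bound hφ hz' h0 he hst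
    have hn := hnear (x := s + t) (by
      rw [Real.dist_eq, add_sub_cancel_left]
      linarith)
    rw [Real.dist_eq, abs_lt] at hn
    rw [← add_assoc, ← sub_sub, ← hκ] at h
    simp only [hD]
    linarith [hn.1]
  have hDs : 2 * δ * (2 * M + κ) ≤ ∫ t in (-δ)..δ, (D (-2 + s + t) - D (2 - s - t)) := by
    have hconst : ∫ _t in (-δ)..δ, (2 * M + κ) = 2 * δ * (2 * M + κ) := by
      rw [intervalIntegral.integral_const, smul_eq_mul]
      ring
    rw [← hconst]
    refine intervalIntegral.integral_mono_on (by linarith) intervalIntegrable_const ?_ hlow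
    refine (intervalIntegrable_const (c := 2 * (C + (M + ‖(1 / Real.pi) * modConst φ‖)))
      (μ := volume) (a := -δ) (b := δ)).mono_fun ?_ (Eventually.of_forall fun t => ?_)
    · exact ((hDm.comp_measurable (measurable_const.add measurable_id)).sub
        (hDm.comp_measurable (measurable_const.sub measurable_id))).aestronglyMeasurable
    · refine le_trans ?_ (le_abs_self _)
      linarith [norm_sub_le (D (-2 + s + t)) (D (2 - s - t)), hDb (-2 + s + t), hDb (2 - s - t)]
  -- Centred at translates of the extremal points s and -s, so that both intervals contribute about
  -- M with the same sign.
  set h := indicatorDiff (-2 + s) (2 - s) δ with hh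
  have hhi : Integrable h := integrable_indicatorDiff _ _ _
  have hJi := integrable_invol hβ hhi
  have hh0 : ∫ x, h x = 0 := by
    have := integral_mul_indicatorDiff (D := fun _ => 1) stronglyMeasurable_const (C := 1)
      (by simp) (-2 + s) (2 - s) hδ.le
    simpa using this
  have hg0 : ∫ x, (hJi.toL1 _) x = 0 := by
    rw [integral_congr_ae hJi.coeFn_toL1, integral_invol hβ, hh0]
  set g : L10 := ⟨hJi.toL1 _, hg0⟩ with hg
  have hgn : ‖g‖ ≤ 4 * δ := by
    have : ‖g‖ = ‖hJi.toL1 _‖ := rfl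
    rw [this, L1.norm_of_fun_eq_integral_norm, integral_norm_invol hβ]
    exact integral_norm_indicatorDiff_le _ _ hδ.le
  have hval : (T (LSpace.mk I₁ (0, g))).toDist φ =
      -((∫ t in (-δ)..δ, (D (-2 + s + t) - D (2 - s - t)) : ℝ) : ℂ) := by
    have hbd {χ : ℝ → ℝ} {c : ℝ} (hχ : StronglyMeasurable χ) (hb : ∀ x, ‖χ x‖ ≤ c) :
        Integrable fun x => (χ x : ℂ) * h x :=
      hhi.bdd_mul (c := c)
        (Complex.continuous_ofReal.comp_stronglyMeasurable hχ).aestronglyMeasurable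
        (Eventually.of_forall fun x => by simpa using hb x)
    have e := hT 0 g φ
    rw [ContinuousLinearMap.coe_coe] at e
    rw [e, superAction_eq, integral_mul_invol_zero hβ, integral_mul_invol_zero hβ, hg,
      integral_mul_invol_toL1_invol hβ hJi, integral_mul_invol_toL1_invol hβ hJi,
      ← integral_sub (hbd (modHilbert_stronglyMeasurable hq hqp) hC) (hbd hmφ hbφ), sub_self,
      zero_sub, ← integral_mul_indicatorDiff hDm hDb _ _ hδ.le]
    congr 2
    ext x
    simp only [hD]
    push_cast
    ring
  have hup : ‖(T (LSpace.mk I₁ (0, g))).toDist φ‖ ≤ M * (4 * δ) := by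
    refine (norm_toDist_le φ hφM hmax _).trans (mul_le_mul_of_nonneg_left ?_ (by linarith))
    refine (T.le_opNorm _).trans ?_
    have h2 := LSpace.norm_mk_le (Ω := I₁) 0 g
    rw [norm_zero, zero_add] at h2
    calc ‖T‖ * ‖LSpace.mk I₁ (0, g)‖ ≤ 1 * ‖LSpace.mk I₁ (0, g)‖ :=
          mul_le_mul_of_nonneg_right hle (norm_nonneg _)
      _ ≤ 4 * δ := by
          rw [one_mul]
          exact h2.trans hgn
  rw [hval, norm_neg, Complex.norm_real] at hup
  have := (le_abs_self _).trans hup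
  -- The bounds combine to 2δ(2M + κ) ≤ 4δM, which contradicts δκ > 0.
  nlinarith [mul_pos hδ hκ0]

end NormBound

end GaussType

end

theorem mainTheorem7 (β : ℝ) (hβ₀ : 0 < β) (hβ₁ : β ≤ 1) :
    ∃ T : GaussType.LSpace GaussType.I₁ →L[ℂ] GaussType.LSpace GaussType.I₁,
      GaussType.IsSubtransfer β T ∧
      (∀ (f : GaussType.L1) (φ : 𝓓(GaussType.I₁, ℝ)),
        (T (GaussType.LSpace.mk GaussType.I₁ (f, 0))).toDist φ =
          ∫ x in Set.Ioo (-1 : ℝ) 1, (φ x : ℂ) * GaussType.subtransferFun β f x) ∧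
      1 < ‖T‖ := by
  obtain ⟨T, hT⟩ := GaussType.exists_subtransfer hβ₀ hβ₁
  exact ⟨T, hT, hT.apply_function hβ₀, hT.one_lt_norm hβ₀⟩
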